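/- **Definitions.** Let $\mathcal C$ be a category. A *phased coproduct* of a family $(A_i)_{i\in J}$ is an object $E$ with morphisms (coprojections) $\kappa_i\colon A_i\to E$ such that (i) for all $f_i\colon A_i\to T$ there is some $h\colon E\to T$ with $h\kappa_i=f_i$ for all $i$, and (ii) whenever $h\kappa_i=h'\kappa_i$ for all $i$, one has $h'=hU$ for some *phase* $U$ of $E$, i.e. an endomorphism $U$ of $E$ with $U\kappa_i=\kappa_i$ for all $i$. A binary phased coproduct of $A,B$ is written $A\mathbin{\dot+}B$. Phased products are dual. A *phased biproduct* (in a category with zero morphisms) is an object that is both a phased coproduct $(\kappa_i)$ and a phased product $(\pi_i)$, with the same phases for both, and with $\pi_i\kappa_i=\mathrm{id}$, $\pi_j\kappa_i=0$ for $i\ne j$; in a dagger category it is a *phased dagger biproduct* if moreover $\pi_i=\kappa_i^\dagger$. Dagger biproducts are biproducts with $\pi_i=\kappa_i^\dagger$. (Phased) coproducts are *monic* if all coprojections are monic. A morphism $f\colon A\mathbin{\dot+}B\to C\mathbin{\dot+}D$ is *diagonal* if $f\kappa_A=\kappa_C g$ and $f\kappa_B=\kappa_D h$ for some $g,h$. Phases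 are *transitive* if for every diagonal $f\colon A\mathbin{\dot+}B\to C\mathbin{\dot+}D$ and phase $U$ of $A\mathbin{\dot+}B$ there is a phase $V$ of $C\mathbin{\dot+}D$ with $fU=Vf$. In a monoidal category, phased coproducts are *distributive* if each functor $A\otimes(-)$ and $(-)\otimes A$ sends every binary phased coproduct to a phased coproduct, every phase of which is the image of a phase; coproducts are distributive if these functors preserve binary coproducts; (phased, dagger) biproducts are distributive if they are so as (phased) coproducts. A dagger category with phased dagger biproducts has *positive-free phases* if every phase of some $A\mathbin{\dot\oplus}B$ of the form $g^\dagger g$ is an identity. A *choice of global phases* in a monoidal category $\mathcal A$ is a group $\mathbb P$ of invertible scalars $p\colon I\to I$ that are central ($p\cdot f=f\cdot p$ for all morphisms $f$). The monoidal category $\mathcal A/\mathbb P$ has the same objects as $\mathcal A$, and as morphisms the classes of morphisms of $\mathcal A$ under $f\sim g\iff f=p\cdot g$ for some $p\in\mathbb P$. In a dagger monoidal category $\mathbb P$ is *unitary* if all its elements are, and *positive-free* if $p\cdot\mathrm{id}_A=\mathrm{id}_A$ whenever $p\in\mathbb P$ and $p\cdot\mathrm{id}_A$ has the form $g^\dagger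 g$. For a monoidal category $\mathcal B$ with unit $I$, the category $\mathsf{GP}(\mathcal B)$ has as objects the phased coproducts $\mathbf A=A\mathbin{\dot+}I$ in $\mathcal B$ (with $A$ and the coprojections as part of the data) and as morphisms $\mathbf A\to\mathbf B$ the diagonal morphisms $f$ with $f\kappa_I=\kappa_I$. It is considered with a monoidal structure $\hat\otimes$ for which $\mathbf A\mapsto A$ is strict monoidal and for which there are morphisms $c_{\mathbf A,\mathbf B}\colon\mathbf A\hat\otimes\mathbf B\to\mathbf A\otimes\mathbf B$ of $\mathcal B$, compatible with the tensor of morphisms and with the associators, with $c\,\kappa_{A\otimes B}=\kappa_A\otimes\kappa_B$ and $c\,\kappa_I=(\kappa_I\otimes\kappa_I)\rho_I^{-1}$; and with the set $\mathbb P$ of those scalars $\mathbf I\to\mathbf I$ of $\mathsf{GP}(\mathcal B)$ that are phases of the unit object $\mathbf I=I\mathbin{\dot+}I$ in $\mathcal B$. If $\mathcal B$ is a dagger category, $\mathsf{GP}^\dagger(\mathcal B)$ is defined in the same way with only phased dagger biproducts $A\mathbin{\dot\oplus}I$ as objects, and has the dagger of $\mathcal B$. **Theorem.** The assignments $(\mathcal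 A,\mathbb P)\mapsto\mathcal A/\mathbb P$ and $\mathcal B\mapsto(\mathsf{GP}(\mathcal B),\mathbb P)$ give a one-to-one correspondence, up to monoidal equivalence, between * monoidal categories $\mathcal A$ with distributive, monic finite coproducts and a choice of global phases $\mathbb P$, and * monoidal categories $\mathcal B$ with distributive, monic finite phased coproducts with transitive phases. They also give such a correspondence between monoidal categories $\mathcal A$ with distributive finite biproducts and a choice of global phases $\mathbb P$, and monoidal categories $\mathcal B$ with distributive finite phased biproducts. Likewise $(\mathcal A,\mathbb P)\mapsto\mathcal A/\mathbb P$ and $\mathcal B\mapsto(\mathsf{GP}^\dagger(\mathcal B),\mathbb P)$ give a one-to-one correspondence, up to dagger monoidal equivalence, between dagger monoidal categories $\mathcal A$ with distributive finite dagger biproducts and a positive-free choice of unitary global phases $\mathbb P$, and dagger monoidal categories $\mathcal B$ with distributive finite phased dagger biproducts with positive-free phases. Explicitly, in each of the three cases: a monoidal structure as described exists on $\mathsf{GP}(\mathcal B)$ (resp. $\mathsf{GP}^\dagger(\mathcal B)$), and for every such structure both assignments land in the stated classes; $(\mathcal A,\mathbb P)\simeq\mathsf{GP}(\mathcal A/\mathbb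 P)$ by a (dagger) monoidal equivalence that identifies the groups of global phases; $\mathcal B\simeq\mathsf{GP}(\mathcal B)/\mathbb P$ by a (dagger) monoidal equivalence; and two categories of one class are equivalent (on the side of the $\mathcal A$'s: by a (dagger) monoidal equivalence identifying the chosen global phases) if and only if the categories assigned to them are. -/

import Mathlib

open CategoryTheory MonoidalCategory Limits

universe w v u v' u'

namespace PhasedCoprod

/-! ### Phased coproducts -/

section Phased

variable {C : Type u} [Category.{v} C]

/-- `U` is a phase for the coprojections `κA : A ⟶ E`, `κB : B ⟶ E`. -/
def IsPhase {A B E : C} (κA : A ⟶ E) (κB : B ⟶ E) (U : E ⟶ E) : Prop :=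
  κA ≫ U = κA ∧ κB ≫ U = κB

/-- `E` with coprojections `κA`, `κB` is a (binary) phased coproduct of `A` and `B`. -/
structure IsPhasedCoproduct {A B E : C} (κA : A ⟶ E) (κB : B ⟶ E) : Prop where
  exists_desc : ∀ {T : C} (f : A ⟶ T) (g : B ⟶ T), ∃ h : E ⟶ T, κA ≫ h = f ∧ κB ≫ h = g
  exists_phase : ∀ {T : C} (h h' : E ⟶ T), κA ≫ h = κA ≫ h' → κB ≫ h = κB ≫ h' →
    ∃ U : E ⟶ E, IsPhase κA κB U ∧ h' = U ≫ h

/-- `E` with coprojections `κ i` is a phased coproduct of the family `X`. -/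
structure IsPhasedCoproductFamily {ι : Type w} {X : ι → C} {E : C}
    (κ : ∀ i, X i ⟶ E) : Prop where
  exists_desc : ∀ {T : C} (f : ∀ i, X i ⟶ T), ∃ h : E ⟶ T, ∀ i, κ i ≫ h = f i
  exists_phase : ∀ {T : C} (h h' : E ⟶ T), (∀ i, κ i ≫ h = κ i ≫ h') →
    ∃ U : E ⟶ E, (∀ i, κ i ≫ U = κ i) ∧ h' = U ≫ h

/-- `E` with projections `πA`, `πB` is a (binary) phased product of `A` and `B`. -/
structure IsPhasedProduct {A B E : C} (πA : E ⟶ A) (πB : E ⟶ B) : Prop where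
  exists_lift : ∀ {T : C} (f : T ⟶ A) (g : T ⟶ B), ∃ h : T ⟶ E, h ≫ πA = f ∧ h ≫ πB = g
  exists_phase : ∀ {T : C} (h h' : T ⟶ E), h ≫ πA = h' ≫ πA → h ≫ πB = h' ≫ πB →
    ∃ U : E ⟶ E, (U ≫ πA = πA ∧ U ≫ πB = πB) ∧ h' = h ≫ U

/-- `E` with projections `π i` is a phased product of the family `X`. -/
structure IsPhasedProductFamily {ι : Type w} {X : ι → C} {E : C}
    (π : ∀ i, E ⟶ X i) : Prop where
  exists_lift : ∀ {T : C} (f : ∀ i, T ⟶ X i), ∃ h : T ⟶ E, ∀ i, h ≫ π i = f i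
  exists_phase : ∀ {T : C} (h h' : T ⟶ E), (∀ i, h ≫ π i = h' ≫ π i) →
    ∃ U : E ⟶ E, (∀ i, U ≫ π i = π i) ∧ h' = h ≫ U

/-- A family bicone (so that `ι i ≫ π j` is the identity or zero) is a phased biproduct. -/
structure IsPhasedBiproductFamily [HasZeroMorphisms C] {ι : Type w} {X : ι → C}
    (b : Bicone X) : Prop where
  coprod : IsPhasedCoproductFamily b.ι
  prod : IsPhasedProductFamily b.π
  phases : ∀ U : b.pt ⟶ b.pt, (∀ i, b.ι i ≫ U = b.ι i) ↔ (∀ i, U ≫ b.π i = b.π i)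

/-- `E` with the given (co)projections is a (binary) phased biproduct of `A` and `B`. -/
structure IsPhasedBiproduct [HasZeroMorphisms C] {A B E : C}
    (κA : A ⟶ E) (κB : B ⟶ E) (πA : E ⟶ A) (πB : E ⟶ B) : Prop where
  inl_fst : κA ≫ πA = 𝟙 A
  inr_fst : κB ≫ πA = 0
  inl_snd : κA ≫ πB = 0
  inr_snd : κB ≫ πB = 𝟙 B
  coprod : IsPhasedCoproduct κA κB
  prod : IsPhasedProduct πA πB
  phases : ∀ U : E ⟶ E, IsPhase κA κB U ↔ (U ≫ πA = πA ∧ U ≫ πB = πB)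

variable (C) in
/-- Every finite family of objects has a phased coproduct. -/
def HasFinitePhasedCoproducts : Prop :=
  ∀ (n : ℕ) (X : Fin n → C), ∃ (E : C) (κ : ∀ i, X i ⟶ E), IsPhasedCoproductFamily κ

variable (C) in
/-- All coprojections of phased coproducts are monic. -/
def MonicPhasedCoproducts : Prop :=
  ∀ ⦃A B E : C⦄ (κA : A ⟶ E) (κB : B ⟶ E), IsPhasedCoproduct κA κB → Mono κA ∧ Mono κB

variable (C) in
/-- Transitive phases: for each diagonal `f : A ∔ B ⟶ A' ∔ B'` and each phase `U` of `A ∔ B`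
there is a phase `V` of `A' ∔ B'` with `f ∘ U = V ∘ f`. -/
def TransitivePhases : Prop :=
  ∀ ⦃A B E A' B' E' : C⦄ (κA : A ⟶ E) (κB : B ⟶ E) (κA' : A' ⟶ E') (κB' : B' ⟶ E'),
    IsPhasedCoproduct κA κB → IsPhasedCoproduct κA' κB' →
    ∀ f : E ⟶ E', (∃ g, κA ≫ f = g ≫ κA') → (∃ h, κB ≫ f = h ≫ κB') →
    ∀ U : E ⟶ E, IsPhase κA κB U → ∃ V : E' ⟶ E', IsPhase κA' κB' V ∧ U ≫ f = f ≫ V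

/-- `F` strongly preserves phased coproducts: it sends phased coproducts to phased coproducts,
and every phase of the image is the image of a phase. -/
def StronglyPreserves {D : Type u'} [Category.{v'} D] (F : C ⥤ D) : Prop :=
  ∀ ⦃A B E : C⦄ (κA : A ⟶ E) (κB : B ⟶ E), IsPhasedCoproduct κA κB →
    IsPhasedCoproduct (F.map κA) (F.map κB) ∧
    ∀ V, IsPhase (F.map κA) (F.map κB) V → ∃ U, IsPhase κA κB U ∧ F.map U = V

variable (C) in
/-- Phased coproducts are distributive. -/
def DistributivePhasedCoproducts [MonoidalCategory C] : Prop :=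
  ∀ A : C, StronglyPreserves (tensorLeft A) ∧ StronglyPreserves (tensorRight A)

variable (C) in
/-- Ordinary (binary) coproducts are distributive: they are preserved by
`A ⊗ (-)` and `(-) ⊗ A`. -/
def DistributiveCoproducts [MonoidalCategory C] : Prop :=
  ∀ A : C, PreservesColimitsOfShape (Discrete WalkingPair) (tensorLeft A) ∧
    PreservesColimitsOfShape (Discrete WalkingPair) (tensorRight A)

end Phased

/-! ### Dagger categories -/

/-- A dagger on a category. -/
class Dagger (C : Type u) [Category.{v} C] where
  /-- the dagger `f†` of a morphism -/
  dag : ∀ {X Y : C}, (X ⟶ Y) → (Y ⟶ X)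
  dag_dag : ∀ {X Y : C} (f : X ⟶ Y), dag (dag f) = f
  dag_comp : ∀ {X Y Z : C} (f : X ⟶ Y) (g : Y ⟶ Z), dag (f ≫ g) = dag g ≫ dag f
  dag_id : ∀ X : C, dag (𝟙 X) = 𝟙 X

open Dagger (dag)

section DaggerDefs

variable {C : Type u} [Category.{v} C] [Dagger C]

/-- An isomorphism is unitary if its dagger is its inverse. -/
def IsUnitary {X Y : C} (e : X ≅ Y) : Prop := dag e.hom = e.inv

/-- A positive endomorphism is one of the form `g† ∘ g`. -/
def IsPositive {X : C} (f : X ⟶ X) : Prop := ∃ (Y : C) (g : X ⟶ Y), f = g ≫ dag g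

/-- `E` with coprojections `κA`, `κB` is a phased dagger biproduct: a phased biproduct
with projections `κA†`, `κB†`. (Zero morphisms on a category are unique.) -/
def IsPhasedDaggerBiproduct {A B E : C} (κA : A ⟶ E) (κB : B ⟶ E) : Prop :=
  ∃ _ : HasZeroMorphisms C, IsPhasedBiproduct κA κB (dag κA) (dag κB)

variable (C) in
/-- Every finite family of objects has a phased dagger biproduct. -/
def HasFinitePhasedDaggerBiproducts : Prop :=
  ∃ _ : HasZeroMorphisms C, ∀ (n : ℕ) (X : Fin n → C),
    ∃ b : Bicone X, IsPhasedBiproductFamily b ∧ ∀ i, b.π i = dag (b.ι i)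

variable (C) in
/-- Every finite family of objects has a dagger biproduct. -/
def HasFiniteDaggerBiproducts : Prop :=
  ∃ _ : HasZeroMorphisms C, ∀ (n : ℕ) (X : Fin n → C),
    ∃ b : Bicone X, Nonempty b.IsBilimit ∧ ∀ i, b.π i = dag (b.ι i)

variable (C) in
/-- Every positive phase of a phased dagger biproduct is an identity. -/
def PositiveFreePhases : Prop :=
  ∀ ⦃A B E : C⦄ (κA : A ⟶ E) (κB : B ⟶ E), IsPhasedDaggerBiproduct κA κB →
    ∀ U : E ⟶ E, IsPhase κA κB U → IsPositive U → U = 𝟙 E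

variable (C) in
/-- Dagger monoidal categories. -/
class DaggerMonoidal [MonoidalCategory C] : Prop where
  dag_tensor : ∀ {X Y X' Y' : C} (f : X ⟶ Y) (g : X' ⟶ Y'), dag (f ⊗ₘ g) = dag f ⊗ₘ dag g
  associator_unitary : ∀ X Y Z : C, IsUnitary (α_ X Y Z)
  leftUnitor_unitary : ∀ X : C, IsUnitary (λ_ X)
  rightUnitor_unitary : ∀ X : C, IsUnitary (ρ_ X)

end DaggerDefs

/-- The dagger of a diagonal morphism preserving the second coprojection is of the same kind. -/
lemma IsPhasedDaggerBiproduct.dag_diag {B : Type u} [Category.{v} B] [Dagger B] {A E A' E' J : B}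
    {κ : A ⟶ E} {κJ : J ⟶ E} {κ' : A' ⟶ E'} {κJ' : J ⟶ E'}
    (h : IsPhasedDaggerBiproduct κ κJ) (h' : IsPhasedDaggerBiproduct κ' κJ')
    (f : E ⟶ E') (g : A ⟶ A') (hg : κ ≫ f = g ≫ κ') (hJ : κJ ≫ f = κJ') :
    κ' ≫ dag f = dag g ≫ κ ∧ κJ' ≫ dag f = κJ := by
  obtain ⟨z, h⟩ := h
  obtain ⟨z', h'⟩ := h'
  obtain rfl : z = z' := Subsingleton.elim _ _
  have key : ∀ {T : B} (a b : E ⟶ T), κ ≫ a = κ ≫ b → κJ ≫ a = κJ ≫ b →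
      (∀ U, IsPhase κ κJ U → U ≫ a = a) → b = a := by
    intro T a b h1 h2 h3
    obtain ⟨U, hU, e⟩ := h.coprod.exists_phase a b h1 h2
    rw [e, h3 U hU]
  have e1 : f ≫ dag κ' = dag κ ≫ g := by
    refine key _ _ ?_ ?_ ?_
    · rw [← Category.assoc, h.inl_fst, ← Category.assoc, hg, Category.assoc, h'.inl_fst]
      simp
    · rw [← Category.assoc, h.inr_fst, ← Category.assoc, hJ, h'.inr_fst]
      simp
    · intro U hU
      rw [← Category.assoc, ((h.phases U).1 hU).1]
  have e2 : f ≫ dag κJ' = dag κJ := by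
    refine key _ _ ?_ ?_ ?_
    · rw [h.inl_snd, ← Category.assoc, hg, Category.assoc, h'.inl_snd]
      simp
    · rw [h.inr_snd, ← Category.assoc, hJ, h'.inr_snd]
    · intro U hU
      exact ((h.phases U).1 hU).2
  constructor
  · have := congrArg dag e1
    simpa only [Dagger.dag_comp, Dagger.dag_dag] using this
  · have := congrArg dag e2
    simpa only [Dagger.dag_comp, Dagger.dag_dag] using this

/-! ### Global phases and the quotient `A/P` -/

section GlobalPhases

variable {C : Type u} [Category.{v} C] [MonoidalCategory C]

/-- Scalar multiplication `s · f`. -/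
def smulHom (s : 𝟙_ C ⟶ 𝟙_ C) {X Y : C} (f : X ⟶ Y) : X ⟶ Y :=
  (λ_ X).inv ≫ (s ⊗ₘ f) ≫ (λ_ Y).hom

/-- Scalar multiplication on the other side, `f · s`. -/
def homSmul {X Y : C} (f : X ⟶ Y) (s : 𝟙_ C ⟶ 𝟙_ C) : X ⟶ Y :=
  (ρ_ X).inv ≫ (f ⊗ₘ s) ≫ (ρ_ Y).hom

/-- A scalar is central if `s · f = f · s` for all morphisms `f`. -/
def IsCentralScalar (s : 𝟙_ C ⟶ 𝟙_ C) : Prop :=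
  ∀ ⦃X Y : C⦄ (f : X ⟶ Y), smulHom s f = homSmul f s

variable (C) in
/-- A choice of global phases: a group of invertible, central scalars. -/
structure GlobalPhases where
  carrier : Subgroup (Aut (𝟙_ C))
  central : ∀ p ∈ carrier, IsCentralScalar p.hom

lemma smulHom_eq (s : 𝟙_ C ⟶ 𝟙_ C) {X Y : C} (f : X ⟶ Y) :
    smulHom s f = smulHom s (𝟙 X) ≫ f := by
  simp only [smulHom, MonoidalCategory.tensorHom_def, whiskerLeft_id, Category.comp_id,
    Category.assoc, leftUnitor_naturality]

lemma smulHom_eq' (s : 𝟙_ C ⟶ 𝟙_ C) {X Y : C} (f : X ⟶ Y) :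
    smulHom s f = f ≫ smulHom s (𝟙 Y) := by
  simp only [smulHom, MonoidalCategory.tensorHom_def, whiskerLeft_id, Category.comp_id,
    Category.assoc, leftUnitor_inv_naturality_assoc, whisker_exchange_assoc]

lemma smulHom_comp_left (s : 𝟙_ C ⟶ 𝟙_ C) {X Y Z : C} (f : X ⟶ Y) (g : Y ⟶ Z) :
    smulHom s f ≫ g = smulHom s (f ≫ g) := by
  rw [smulHom_eq, smulHom_eq s (f ≫ g), Category.assoc]

lemma smulHom_comp_right (s : 𝟙_ C ⟶ 𝟙_ C) {X Y Z : C} (f : X ⟶ Y) (g : Y ⟶ Z) :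
    f ≫ smulHom s g = smulHom s (f ≫ g) := by
  rw [smulHom_eq', smulHom_eq' s (f ≫ g), Category.assoc]

lemma smulHom_id {X Y : C} (f : X ⟶ Y) : smulHom (𝟙 (𝟙_ C)) f = f := by
  simp [smulHom]

lemma smulHom_smulHom (s t : 𝟙_ C ⟶ 𝟙_ C) {X Y : C} (f : X ⟶ Y) :
    smulHom s (smulHom t f) = smulHom (s ≫ t) f := by
  rw [smulHom_eq s, smulHom_eq t, smulHom_eq (s ≫ t)]
  simp [smulHom, MonoidalCategory.tensorHom_def]

lemma smulHom_whiskerRight (s : 𝟙_ C ⟶ 𝟙_ C) {X Y : C} (f : X ⟶ Y) (Z : C) :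
    smulHom s f ▷ Z = smulHom s (f ▷ Z) := by
  simp [smulHom, MonoidalCategory.tensorHom_def]

lemma homSmul_whiskerLeft (s : 𝟙_ C ⟶ 𝟙_ C) {X Y : C} (f : X ⟶ Y) (Z : C) :
    Z ◁ homSmul f s = homSmul (Z ◁ f) s := by
  simp [homSmul, MonoidalCategory.tensorHom_def]

namespace GlobalPhases

variable (P : GlobalPhases C)

/-- `f ∼ g` if `f = p · g` for some `p ∈ P`. -/
def rel : HomRel C := fun _ _ f g => ∃ p ∈ P.carrier, f = smulHom p.hom g

instance : Congruence P.rel where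
  equivalence :=
    { refl := fun f => ⟨1, P.carrier.one_mem, (smulHom_id f).symm⟩
      symm := by
        rintro f g ⟨p, hp, rfl⟩
        refine ⟨p⁻¹, P.carrier.inv_mem hp, ?_⟩
        rw [smulHom_smulHom]
        exact ((congrArg (fun t => smulHom t g) p.inv_hom_id).trans (smulHom_id g)).symm
      trans := by
        rintro f g h ⟨p, hp, rfl⟩ ⟨q, hq, rfl⟩
        exact ⟨q * p, P.carrier.mul_mem hq hp, smulHom_smulHom _ _ _⟩ }
  comp_left := by
    rintro _ _ _ f _ g ⟨p, hp, rfl⟩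
    exact ⟨p, hp, smulHom_comp_right _ _ _⟩
  comp_right := by
    rintro _ _ _ _ f g ⟨p, hp, rfl⟩
    exact ⟨p, hp, smulHom_comp_left _ _ _⟩

lemma rel_whiskerLeft {X Y : C} {f g : X ⟶ Y} (h : P.rel f g) (Z : C) :
    P.rel (Z ◁ f) (Z ◁ g) := by
  obtain ⟨p, hp, rfl⟩ := h
  refine ⟨p, hp, ?_⟩
  rw [P.central p hp, homSmul_whiskerLeft, ← P.central p hp]

lemma rel_whiskerRight {X Y : C} {f g : X ⟶ Y} (h : P.rel f g) (Z : C) :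
    P.rel (f ▷ Z) (g ▷ Z) := by
  obtain ⟨p, hp, rfl⟩ := h
  exact ⟨p, hp, smulHom_whiskerRight _ _ _⟩

/-- The quotient category `A/P`: same objects, morphisms up to a global phase. -/
abbrev Quotient : Type u := CategoryTheory.Quotient P.rel

/-- The quotient functor `A ⥤ A/P`. -/
abbrev proj : C ⥤ P.Quotient := CategoryTheory.Quotient.functor P.rel

/-- The monoidal structure of `A/P`, inherited from `A` along the quotient functor. -/
instance : MonoidalCategoryStruct P.Quotient where
  tensorObj X Y := ⟨X.as ⊗ Y.as⟩
  tensorUnit := ⟨𝟙_ C⟩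
  whiskerLeft Z _ _ f := Quot.liftOn f (fun f => P.proj.map (Z.as ◁ f)) (by
    intro f g h
    rw [HomRel.compClosure_iff_self] at h
    exact CategoryTheory.Quotient.sound _ (P.rel_whiskerLeft h _))
  whiskerRight f Z := Quot.liftOn f (fun f => P.proj.map (f ▷ Z.as)) (by
    intro f g h
    rw [HomRel.compClosure_iff_self] at h
    exact CategoryTheory.Quotient.sound _ (P.rel_whiskerRight h _))
  associator X Y Z := P.proj.mapIso (α_ X.as Y.as Z.as)
  leftUnitor X := P.proj.mapIso (λ_ X.as)
  rightUnitor X := P.proj.mapIso (ρ_ X.as)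

lemma proj_tensorHom {X Y X' Y' : C} (f : X ⟶ Y) (g : X' ⟶ Y') :
    (P.proj.map f ⊗ₘ P.proj.map g) = P.proj.map (f ⊗ₘ g) := by
  rw [MonoidalCategory.tensorHom_def]
  rfl

instance : MonoidalCategory P.Quotient where
  id_tensorHom_id X Y :=
    (P.proj_tensorHom (𝟙 X.as) (𝟙 Y.as)).trans (congrArg P.proj.map (id_tensorHom_id X.as Y.as))
  tensorHom_comp_tensorHom := by
    rintro _ _ _ _ _ _ ⟨f⟩ ⟨f'⟩ ⟨g⟩ ⟨g'⟩
    change (P.proj.map f ⊗ₘ P.proj.map f') ≫ (P.proj.map g ⊗ₘ P.proj.map g') =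
      (P.proj.map (f ≫ g)) ⊗ₘ (P.proj.map (f' ≫ g'))
    rw [proj_tensorHom, proj_tensorHom, proj_tensorHom, ← Functor.map_comp,
      tensorHom_comp_tensorHom]
  whiskerLeft_id X Y := congrArg P.proj.map (whiskerLeft_id X.as Y.as)
  id_whiskerRight X Y := congrArg P.proj.map (id_whiskerRight X.as Y.as)
  associator_naturality := by
    rintro _ _ _ _ _ _ ⟨f⟩ ⟨g⟩ ⟨h⟩
    have e := congrArg P.proj.map (associator_naturality f g h)
    simp only [MonoidalCategory.tensorHom_def] at e
    exact e
  leftUnitor_naturality := by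
    rintro _ _ ⟨f⟩
    exact congrArg P.proj.map (leftUnitor_naturality f)
  rightUnitor_naturality := by
    rintro _ _ ⟨f⟩
    exact congrArg P.proj.map (rightUnitor_naturality f)
  pentagon W X Y Z := congrArg P.proj.map (pentagon W.as X.as Y.as Z.as)
  triangle X Y := congrArg P.proj.map (triangle X.as Y.as)

/-- All the global phases are unitary. -/
class AllUnitary [Dagger C] : Prop where
  unitary : ∀ p ∈ P.carrier, IsUnitary (C := C) p

/-- Positive-free global phases: whenever `p · 𝟙 A` is positive, it is `𝟙 A`. -/
def PositiveFree [Dagger C] : Prop :=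
  ∀ p ∈ P.carrier, ∀ A : C, IsPositive (smulHom p.hom (𝟙 A)) → smulHom p.hom (𝟙 A) = 𝟙 A

lemma rel_dag [Dagger C] [DaggerMonoidal C] [P.AllUnitary] {X Y : C} {f g : X ⟶ Y}
    (h : P.rel f g) : P.rel (dag f) (dag g) := by
  obtain ⟨p, hp, rfl⟩ := h
  refine ⟨p⁻¹, P.carrier.inv_mem hp, ?_⟩
  have h1 : dag p.hom = p.inv := AllUnitary.unitary p hp
  have h2 : ∀ X : C, dag (λ_ X).hom = (λ_ X).inv := DaggerMonoidal.leftUnitor_unitary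
  have h3 : ∀ X : C, dag (λ_ X).inv = (λ_ X).hom := fun X => by rw [← h2, Dagger.dag_dag]
  simp only [smulHom, Dagger.dag_comp, DaggerMonoidal.dag_tensor, h1, h2, h3, Category.assoc]
  rfl

/-- The dagger of `A/P`, inherited from `A`. -/
instance [Dagger C] [DaggerMonoidal C] [P.AllUnitary] : Dagger P.Quotient where
  dag f := Quot.liftOn f (fun f => P.proj.map (dag f)) (by
    intro f g h
    rw [HomRel.compClosure_iff_self] at h
    exact CategoryTheory.Quotient.sound _ (P.rel_dag h))
  dag_dag := by
    rintro _ _ ⟨f⟩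
    exact congrArg P.proj.map (Dagger.dag_dag f)
  dag_comp := by
    rintro _ _ _ ⟨f⟩ ⟨g⟩
    exact congrArg P.proj.map (Dagger.dag_comp f g)
  dag_id X := congrArg P.proj.map (Dagger.dag_id X.as)

end GlobalPhases

end GlobalPhases

/-! ### The construction `GP(B)` -/

section GP

variable {B : Type u} [Category.{v} B] [MonoidalCategory B]

/-- Objects `𝐀 = A ∔ I` over a given kind `W` of cospans `A ⟶ E ⟵ I`, where `I` is the unit. -/
@[ext]
structure GPCat (W : ∀ ⦃A E : B⦄, (A ⟶ E) → (𝟙_ B ⟶ E) → Prop) where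
  base : B
  tot : B
  inl : base ⟶ tot
  inr : 𝟙_ B ⟶ tot
  prop : W inl inr

variable (B) in
/-- `GP(B)`: the objects are the phased coproducts `A ∔ I`. -/
abbrev GP : Type max u v := GPCat (B := B) fun _ _ inl inr => IsPhasedCoproduct inl inr

variable (B) in
/-- `GP†(B)`: the objects are the phased dagger biproducts of some `A` and `I`. -/
abbrev GPDag [Dagger B] : Type max u v :=
  GPCat (B := B) fun _ _ inl inr => IsPhasedDaggerBiproduct inl inr

namespace GPCat

variable {W : ∀ ⦃A E : B⦄, (A ⟶ E) → (𝟙_ B ⟶ E) → Prop}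

/-- Morphisms: diagonal morphisms which preserve the coprojection of `I`. -/
@[ext]
structure Hom (X Y : GPCat W) where
  hom : X.tot ⟶ Y.tot
  diag : ∃ g : X.base ⟶ Y.base, X.inl ≫ hom = g ≫ Y.inl
  inr_hom : X.inr ≫ hom = Y.inr

@[simps]
instance : Category (GPCat W) where
  Hom := Hom
  id X := ⟨𝟙 X.tot, ⟨𝟙 _, by simp⟩, by simp⟩
  comp {X Y Z} f g := ⟨f.hom ≫ g.hom, by
    obtain ⟨a, ha⟩ := f.diag
    obtain ⟨b, hb⟩ := g.diag
    exact ⟨a ≫ b, by rw [← Category.assoc, ha, Category.assoc, hb, Category.assoc]⟩, by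
    rw [← Category.assoc, f.inr_hom, g.inr_hom]⟩

@[ext]
lemma hom_ext {X Y : GPCat W} {f g : X ⟶ Y} (h : Hom.hom f = Hom.hom g) : f = g := Hom.ext h

variable (W) in
/-- The monoidal structures considered on `GP(B)`: the tensor `X ⊗ Y` is some object
`A ⊗ B ∔ I`, with a morphism `c X Y` from it to the tensor in `B` such that
`c ∘ κ_{A ⊗ B} = κ_A ⊗ κ_B` and `c ∘ κ_I = (κ_I ⊗ κ_I) ∘ ρ_I⁻¹`; the morphisms `c` determine
the tensor of morphisms and the associator; the unit is some `I ∔ I`, and the unitors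
lie over those of `B`. In particular `X ↦ X.base` is strict monoidal. -/
structure TensorStructure [MonoidalCategory (GPCat W)] where
  base_tensor : ∀ X Y : GPCat W, (X ⊗ Y).base = X.base ⊗ Y.base
  base_unit : (𝟙_ (GPCat W)).base = 𝟙_ B
  c : ∀ X Y : GPCat W, (X ⊗ Y).tot ⟶ X.tot ⊗ Y.tot
  inl_c : ∀ X Y : GPCat W,
    (X ⊗ Y).inl ≫ c X Y = eqToHom (base_tensor X Y) ≫ (X.inl ⊗ₘ Y.inl)
  inr_c : ∀ X Y : GPCat W, (X ⊗ Y).inr ≫ c X Y = (ρ_ (𝟙_ B)).inv ≫ (X.inr ⊗ₘ Y.inr)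
  tensorHom_c : ∀ {X Y X' Y' : GPCat W} (f : X ⟶ Y) (g : X' ⟶ Y'),
    (f ⊗ₘ g).hom ≫ c Y Y' = c X X' ≫ (f.hom ⊗ₘ g.hom)
  associator_c : ∀ X Y Z : GPCat W,
    (α_ X Y Z).hom.hom ≫ c X (Y ⊗ Z) ≫ (X.tot ◁ c Y Z) =
      c (X ⊗ Y) Z ≫ (c X Y ▷ Z.tot) ≫ (α_ X.tot Y.tot Z.tot).hom
  inl_leftUnitor : ∀ X : GPCat W,
    (𝟙_ (GPCat W) ⊗ X).inl ≫ (λ_ X).hom.hom =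
      eqToHom ((base_tensor (𝟙_ _) X).trans (congrArg (fun A => A ⊗ X.base) base_unit)) ≫
        (λ_ X.base).hom ≫ X.inl
  inl_rightUnitor : ∀ X : GPCat W,
    (X ⊗ 𝟙_ (GPCat W)).inl ≫ (ρ_ X).hom.hom =
      eqToHom ((base_tensor X (𝟙_ _)).trans (congrArg (fun A => X.base ⊗ A) base_unit)) ≫
        (ρ_ X.base).hom ≫ X.inl

variable (B) in
/-- The monoidal structures considered on `GP(B)`. -/
abbrev GPTensor [MonoidalCategory (GP B)] :=
  TensorStructure (B := B) fun _ _ inl inr => IsPhasedCoproduct inl inr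

variable (B) in
/-- The monoidal structures considered on `GP†(B)`. -/
abbrev GPDagTensor [Dagger B] [MonoidalCategory (GPDag B)] :=
  TensorStructure (B := B) fun _ _ inl inr => IsPhasedDaggerBiproduct inl inr

variable (W) in
/-- The scalars of `GP(B)` which are phases, in `B`, on the unit object `I ∔ I` of `GP(B)`. -/
def phases [MonoidalCategory (GPCat W)] : Subgroup (Aut (𝟙_ (GPCat W))) where
  carrier := {u | IsPhase (𝟙_ (GPCat W)).inl (𝟙_ (GPCat W)).inr u.hom.hom}
  one_mem' := ⟨Category.comp_id _, Category.comp_id _⟩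
  mul_mem' := by
    rintro p q ⟨hp, hp'⟩ ⟨hq, hq'⟩
    refine ⟨?_, ?_⟩
    · change _ ≫ q.hom.hom ≫ p.hom.hom = _
      rw [← Category.assoc, hq, hp]
    · change _ ≫ q.hom.hom ≫ p.hom.hom = _
      rw [← Category.assoc, hq', hp']
  inv_mem' := by
    rintro p ⟨hp, hp'⟩
    have h : p.hom.hom ≫ p.inv.hom = 𝟙 _ := congrArg Hom.hom p.hom_inv_id
    refine ⟨?_, ?_⟩
    · change _ ≫ p.inv.hom = _
      conv_lhs => rw [← hp]
      rw [Category.assoc, h, Category.comp_id]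
    · change _ ≫ p.inv.hom = _
      conv_lhs => rw [← hp']
      rw [Category.assoc, h, Category.comp_id]

end GPCat

/-- `GP†(B)` has the same dagger as `B`. -/
instance [Dagger B] : Dagger (GPDag B) where
  dag {X Y} f := ⟨dag f.hom, by
    obtain ⟨g, hg⟩ := f.diag
    exact ⟨dag g, (X.prop.dag_diag Y.prop f.hom g hg f.inr_hom).1⟩, by
    obtain ⟨g, hg⟩ := f.diag
    exact (X.prop.dag_diag Y.prop f.hom g hg f.inr_hom).2⟩
  dag_dag f := GPCat.hom_ext (Dagger.dag_dag f.hom)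
  dag_comp f g := GPCat.hom_ext (Dagger.dag_comp f.hom g.hom)
  dag_id X := GPCat.hom_ext (Dagger.dag_id X.tot)

end GP

/-! ### The classes of monoidal categories -/

section Classes

variable (C : Type u) [Category.{v} C] [MonoidalCategory C]

/-- Distributive, monic finite coproducts. -/
structure CoprodCat : Prop where
  finite : HasFiniteCoproducts C
  monic : MonoCoprod C
  distrib : DistributiveCoproducts C

/-- Distributive, monic finite phased coproducts with transitive phases. -/
structure PhasedCoprodCat : Prop where
  finite : HasFinitePhasedCoproducts C
  monic : MonicPhasedCoproducts C
  distrib : DistributivePhasedCoproducts C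
  transitive : TransitivePhases C

/-- Distributive finite biproducts. -/
structure BiprodCat : Prop where
  finite : ∃ _ : HasZeroMorphisms C, HasFiniteBiproducts C
  distrib : DistributiveCoproducts C

/-- Distributive finite phased biproducts. -/
structure PhasedBiprodCat : Prop where
  finite : ∃ _ : HasZeroMorphisms C, ∀ (n : ℕ) (X : Fin n → C),
    ∃ b : Bicone X, IsPhasedBiproductFamily b
  distrib : DistributivePhasedCoproducts C

/-- Distributive finite dagger biproducts, in a dagger monoidal category. -/
structure DaggerBiprodCat [Dagger C] : Prop where
  finite : HasFiniteDaggerBiproducts C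
  distrib : DistributiveCoproducts C

/-- Distributive finite phased dagger biproducts with positive-free phases, in a
dagger monoidal category. -/
structure PhasedDaggerBiprodCat [Dagger C] : Prop where
  finite : HasFinitePhasedDaggerBiproducts C
  distrib : DistributivePhasedCoproducts C
  positiveFree : PositiveFreePhases C

end Classes

/-! ### Monoidal equivalences -/

section Equivalences

variable {C : Type u} [Category.{v} C] [MonoidalCategory C]
  {D : Type u'} [Category.{v'} D] [MonoidalCategory D]

/-- The monoidal functor `F` restricts to an isomorphism of the global phases `P` and `Q`
(for fully faithful `F`): a scalar is in `P` iff its image is in `Q`. -/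
def MatchesPhases (F : C ⥤ D) [F.Monoidal] (P : GlobalPhases C) (Q : GlobalPhases D) : Prop :=
  ∀ s : 𝟙_ C ≅ 𝟙_ C, s ∈ P.carrier ↔
    (Functor.Monoidal.εIso F ≪≫ F.mapIso s ≪≫ (Functor.Monoidal.εIso F).symm) ∈ Q.carrier

variable (C D) in
/-- Monoidal equivalence. -/
def MonEquiv : Prop := ∃ (F : C ⥤ D) (_ : F.Monoidal), F.IsEquivalence

/-- Monoidal equivalence of categories with chosen global phases. -/
def PhaseMonEquiv (P : GlobalPhases C) (Q : GlobalPhases D) : Prop :=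
  ∃ (F : C ⥤ D) (_ : F.Monoidal), F.IsEquivalence ∧ MatchesPhases F P Q

/-- `F` is a dagger monoidal equivalence: a dagger functor with unitary structure isomorphisms,
full, faithful, and such that each object of `D` is unitarily isomorphic to some `F A`. -/
structure IsDaggerMonoidalEquivalence [Dagger C] [Dagger D] (F : C ⥤ D) [F.Monoidal] : Prop where
  map_dag : ∀ {X Y : C} (f : X ⟶ Y), F.map (dag f) = dag (F.map f)
  ε_unitary : IsUnitary (Functor.Monoidal.εIso F)
  μ_unitary : ∀ X Y : C, IsUnitary (Functor.Monoidal.μIso F X Y)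
  full : F.Full
  faithful : F.Faithful
  unitarily_surj : ∀ Y : D, ∃ (X : C) (e : F.obj X ≅ Y), IsUnitary e

variable (C D) in
/-- Dagger monoidal equivalence. -/
def DaggerMonEquiv [Dagger C] [Dagger D] : Prop :=
  ∃ (F : C ⥤ D) (_ : F.Monoidal), IsDaggerMonoidalEquivalence F

/-- Dagger monoidal equivalence of categories with chosen global phases. -/
def PhaseDaggerMonEquiv [Dagger C] [Dagger D] (P : GlobalPhases C) (Q : GlobalPhases D) : Prop :=
  ∃ (F : C ⥤ D) (_ : F.Monoidal), IsDaggerMonoidalEquivalence F ∧ MatchesPhases F P Q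

end Equivalences

end PhasedCoprod

open PhasedCoprod PhasedCoprod.GPCat

namespace PhasedCoprod

open PhasedCoprod.Dagger (dag)

/-! ### Basic facts on phased coproducts -/

section Basics

variable {C : Type u} [Category.{v} C]

/-! The extra summand `I` of `A ∔ I` serves as a reference for phases. In `A/P` a morphism is known
only up to a scalar. A diagonal morphism out of `X ∔ I` that fixes `κ_I` has, however, exactly one
representative fixing the chosen representative of `κ_I`, because that representative is monic
(`eq_of_rel`, `homRep_eq`). Its first component is an honest morphism of `A`. This gives a fully
faithful functor `GP(A/P) ⥤ A`, surjective up to isomorphism (`repFunctor`).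

In the other direction, `baseMap` makes `GP(B) ⥤ B` full and surjective on objects, and two
morphisms with the same base differ by a phase of some `A ∔ I`. Each such phase is multiplication by
a scalar which is a phase of `I ∔ I` (`exists_smulHom`), and these scalars are central
(`smulHom_eq_homSmul`). Dividing by them therefore leaves `B` (`rel_iff`, `quotientBase`).

The main work is to see that `GP(B)` has genuine coproducts. The total object over `A ∔ B` can be
regrouped as `(A ∔ I) ∔ B` (`IsPhasedCoproduct.assoc`). A cotuple exists because transitivity moves
the defect on one leg to the whole object (`Admissible.exists_desc`). Uniqueness (`desc_unique`)
reduces to the triviality of a phase of `A ∔ B ∔ I` that fixes both `A ∔ I` and `B ∔ I`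
(`eq_id_of_fixes`). To see this, embed the object into `(A ∔ I) ⊗ (B ∔ I)`: there the phase becomes
`X ◁ V` with `V` a phase of `B ∔ I`, and `V` is forced to be the identity.

The tensor of `GP(B)` is inherited from `B` along the morphisms `c`. They are monic because they
become coprojections after composition with a further morphism (`isPreCoprojection_tensor`), and
unlike monicity this survives tensoring. Unit coherence of functors is never checked by hand: a
tensorator together with any isomorphism of units can be completed to a monoidal functor
(`Tensorator.exists_monoidal`).

Phased biproducts are automatically monic and transitive, and the coproducts of `GP(B)` are then
biproducts (`isBiproduct`). In the dagger case, positive-freeness lifts isometries from bases to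
`GP†(B)` (`comp_dag_eq_id`, `c_comp_dag`) and from `A/P` to `A` (`comp_dag_eq_id_of_proj`). Since
quotients and `GP` act on equivalences, and equivalences can be inverted and composed, the two round
trips show that each assignment reflects equivalence. The plain and the dagger versions of `GP` are
treated together as `GPCat W` with `W` satisfying `Admissible`. -/

lemma IsPhase.id {A B E : C} (κA : A ⟶ E) (κB : B ⟶ E) : IsPhase κA κB (𝟙 E) :=
  ⟨Category.comp_id _, Category.comp_id _⟩

lemma IsPhase.swap {A B E : C} {κA : A ⟶ E} {κB : B ⟶ E} {U : E ⟶ E}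
    (hU : IsPhase κA κB U) : IsPhase κB κA U := ⟨hU.2, hU.1⟩

namespace IsPhasedCoproduct

variable {A B E : C} {κA : A ⟶ E} {κB : B ⟶ E}

/-- Comparing `U` with the identity gives a phase `V` with `V ≫ U = 𝟙 E`. The same argument for `V`
gives a phase `W` with `W ≫ V = 𝟙 E`, and then `W = U`. -/
lemma isIso_phase (h : IsPhasedCoproduct κA κB) {U : E ⟶ E} (hU : IsPhase κA κB U) :
    IsIso U := by
  have key : ∀ {U : E ⟶ E}, IsPhase κA κB U → ∃ V, IsPhase κA κB V ∧ V ≫ U = 𝟙 E := by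
    intro U hU
    obtain ⟨V, hV, e⟩ := h.exists_phase U (𝟙 E) (by rw [hU.1, Category.comp_id])
      (by rw [hU.2, Category.comp_id])
    exact ⟨V, hV, e.symm⟩
  obtain ⟨V, hV, e⟩ := key hU
  obtain ⟨W, hW, e'⟩ := key hV
  have : W = U := by
    calc W = W ≫ V ≫ U := by rw [e, Category.comp_id]
      _ = U := by rw [reassoc_of% e']
  subst this
  exact ⟨V, e', e⟩

lemma swap (h : IsPhasedCoproduct κA κB) : IsPhasedCoproduct κB κA where
  exists_desc f g := by
    obtain ⟨k, h1, h2⟩ := h.exists_desc g f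
    exact ⟨k, h2, h1⟩
  exists_phase k k' h1 h2 := by
    obtain ⟨U, hU, e⟩ := h.exists_phase k k' h2 h1
    exact ⟨U, hU.swap, e⟩

/-- Two morphisms with the same components differ by an invertible phase. -/
lemma exists_iso_phase (h : IsPhasedCoproduct κA κB) {T : C} {f f' : E ⟶ T}
    (hA : κA ≫ f = κA ≫ f') (hB : κB ≫ f = κB ≫ f') :
    ∃ U : E ⟶ E, IsPhase κA κB U ∧ IsIso U ∧ f' = U ≫ f := by
  obtain ⟨U, hU, e⟩ := h.exists_phase f f' hA hB
  exact ⟨U, hU, h.isIso_phase hU, e⟩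

lemma mono_of_components (h : IsPhasedCoproduct κA κB) {T : C} {f f' : E ⟶ T}
    (hA : κA ≫ f = κA ≫ f') (hB : κB ≫ f = κB ≫ f') [Mono f] : Mono f' := by
  obtain ⟨U, -, hU, rfl⟩ := h.exists_iso_phase hA hB
  exact mono_comp U f

/-- Up to an invertible phase `f ≫ d` is the monomorphism `k`, so its first factor is monic. This is
the test used for embeddings that have no evident retraction. -/
lemma mono_of_extension (h : IsPhasedCoproduct κA κB) {F T : C} (f : E ⟶ F) (d : F ⟶ T)
    (k : E ⟶ T) [Mono k] (hA : κA ≫ f ≫ d = κA ≫ k) (hB : κB ≫ f ≫ d = κB ≫ k) : Mono f := by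
  have := h.mono_of_components hA.symm hB.symm
  exact mono_of_mono f d

/-- A morphism whose components are not changed by phases is determined by its components. -/
lemma eq_of_components (h : IsPhasedCoproduct κA κB) {T : C} {f f' : E ⟶ T}
    (hA : κA ≫ f = κA ≫ f') (hB : κB ≫ f = κB ≫ f')
    (hf : ∀ U, IsPhase κA κB U → U ≫ f = f) : f' = f := by
  obtain ⟨U, hU, e⟩ := h.exists_phase f f' hA hB
  rw [e, hf U hU]

/-- A diagonal morphism with invertible components is invertible. -/
lemma isIso_of_diagonal (h : IsPhasedCoproduct κA κB) {A' B' E' : C} {κA' : A' ⟶ E'}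
    {κB' : B' ⟶ E'} (h' : IsPhasedCoproduct κA' κB') (f : E ⟶ E') (a : A ⟶ A') (b : B ⟶ B')
    [IsIso a] [IsIso b] (hA : κA ≫ f = a ≫ κA') (hB : κB ≫ f = b ≫ κB') : IsIso f := by
  -- `g` need not be the inverse of `f`, but both composites are phases and hence invertible, which
  -- is enough.
  obtain ⟨g, gA, gB⟩ := h'.exists_desc (CategoryTheory.inv a ≫ κA) (CategoryTheory.inv b ≫ κB)
  have h1 : IsIso (f ≫ g) := by
    refine h.isIso_phase ⟨?_, ?_⟩
    · rw [reassoc_of% hA, gA, IsIso.hom_inv_id_assoc]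
    · rw [reassoc_of% hB, gB, IsIso.hom_inv_id_assoc]
  have h2 : IsIso (g ≫ f) := by
    refine h'.isIso_phase ⟨?_, ?_⟩
    · rw [reassoc_of% gA, hA, IsIso.inv_hom_id_assoc]
    · rw [reassoc_of% gB, hB, IsIso.inv_hom_id_assoc]
  have h3 : IsSplitMono f := ⟨⟨⟨g ≫ inv (f ≫ g), by rw [← Category.assoc, IsIso.hom_inv_id]⟩⟩⟩
  have h4 : IsSplitEpi f := ⟨⟨⟨inv (g ≫ f) ≫ g, by rw [Category.assoc, IsIso.inv_hom_id]⟩⟩⟩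
  exact isIso_of_mono_of_isSplitEpi f

lemma comp_iso (h : IsPhasedCoproduct κA κB) {E' : C} (e : E ⟶ E') [IsIso e] :
    IsPhasedCoproduct (κA ≫ e) (κB ≫ e) where
  exists_desc f g := by
    obtain ⟨k, h1, h2⟩ := h.exists_desc f g
    exact ⟨inv e ≫ k, by simpa using h1, by simpa using h2⟩
  exists_phase k k' h1 h2 := by
    obtain ⟨U, hU, eU⟩ := h.exists_phase (e ≫ k) (e ≫ k') (by simpa using h1) (by simpa using h2)
    refine ⟨inv e ≫ U ≫ e, ⟨?_, ?_⟩, ?_⟩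
    · simp [reassoc_of% hU.1]
    · simp [reassoc_of% hU.2]
    · rw [Category.assoc, Category.assoc, IsIso.eq_inv_comp, eU]

lemma iso_comp (h : IsPhasedCoproduct κA κB) {A' B' : C} (a : A' ⟶ A) (b : B' ⟶ B)
    [IsIso a] [IsIso b] : IsPhasedCoproduct (a ≫ κA) (b ≫ κB) where
  exists_desc f g := by
    obtain ⟨k, h1, h2⟩ := h.exists_desc (inv a ≫ f) (inv b ≫ g)
    exact ⟨k, by simp [h1], by simp [h2]⟩
  exists_phase k k' h1 h2 := by
    obtain ⟨U, hU, eU⟩ := h.exists_phase k k' (by simpa [cancel_epi] using h1)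
      (by simpa [cancel_epi] using h2)
    exact ⟨U, ⟨by rw [Category.assoc, hU.1], by rw [Category.assoc, hU.2]⟩, eU⟩

/-- If `P = A ∔ B`, `Z = P ∔ J` and `X = A ∔ J`, then `Z = X ∔ B`. -/
lemma assoc {P J Z X G : C} {kA : A ⟶ P} {kB : B ⟶ P} {l : P ⟶ Z} {lJ : J ⟶ Z} {xA : A ⟶ X}
    {xJ : J ⟶ X} (hP : IsPhasedCoproduct kA kB) (hZ : IsPhasedCoproduct l lJ)
    (hX : IsPhasedCoproduct xA xJ) (i : X ⟶ Z) (hA : xA ≫ i = kA ≫ l) (hJ : xJ ≫ i = lJ)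
    {γ : X ⟶ G} {β : B ⟶ G} (hG : IsPhasedCoproduct γ β) : IsPhasedCoproduct i (kB ≫ l) := by
  -- `G = X ∔ B` and `Z` are compared in both directions. The composites need not be phases: they
  -- restrict to phases `U` of `X` and `V` of `P`. They are still diagonal with invertible
  -- components.
  obtain ⟨j, j1, j2⟩ := hG.exists_desc i (kB ≫ l)
  obtain ⟨p, p1, p2⟩ := hP.exists_desc (xA ≫ γ) β
  obtain ⟨j', j1', j2'⟩ := hZ.exists_desc p (xJ ≫ γ)
  obtain ⟨U, -, hU, eU⟩ := hX.exists_iso_phase (f := γ) (f' := i ≫ j')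
    (by rw [reassoc_of% hA, j1', p1]) (by rw [reassoc_of% hJ, j2'])
  obtain ⟨V, -, hV, eV⟩ := hP.exists_iso_phase (f := l) (f' := l ≫ j' ≫ j)
    (by rw [reassoc_of% j1', reassoc_of% p1, j1, hA])
    (by rw [reassoc_of% j1', reassoc_of% p2, j2])
  have h1 : IsIso (j ≫ j') := hG.isIso_of_diagonal hG _ U (𝟙 B)
    (by rw [reassoc_of% j1, eU]) (by rw [reassoc_of% j2, j1', p2, Category.id_comp])
  have h2 : IsIso (j' ≫ j) := hZ.isIso_of_diagonal hZ _ V (𝟙 J) eV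
    (by rw [reassoc_of% j2', j1, hJ, Category.id_comp])
  have h3 : IsSplitMono j := ⟨⟨⟨j' ≫ inv (j ≫ j'), by rw [← Category.assoc, IsIso.hom_inv_id]⟩⟩⟩
  have h4 : IsSplitEpi j := ⟨⟨⟨inv (j' ≫ j) ≫ j', by rw [Category.assoc, IsIso.inv_hom_id]⟩⟩⟩
  have := isIso_of_mono_of_isSplitEpi j
  rw [← j1, ← j2]
  exact hG.comp_iso j

/-- Phased coproducts of the same objects are isomorphic over the coprojections. -/
lemma exists_iso (h : IsPhasedCoproduct κA κB) {E' : C} {κA' : A ⟶ E'} {κB' : B ⟶ E'}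
    (h' : IsPhasedCoproduct κA' κB') :
    ∃ e : E ⟶ E', IsIso e ∧ κA ≫ e = κA' ∧ κB ≫ e = κB' := by
  obtain ⟨e, h1, h2⟩ := h.exists_desc κA' κB'
  exact ⟨e, h.isIso_of_diagonal h' e (𝟙 A) (𝟙 B) (by simpa using h1) (by simpa using h2), h1, h2⟩

end IsPhasedCoproduct

lemma HasFinitePhasedCoproducts.exists_binary (h : HasFinitePhasedCoproducts C) (A B : C) :
    ∃ (E : C) (κA : A ⟶ E) (κB : B ⟶ E), IsPhasedCoproduct κA κB := by
  obtain ⟨E, κ, hκ⟩ := h 2 ![A, B]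
  refine ⟨E, κ 0, κ 1, ⟨fun {T} f g => ?_, fun {T} k k' h1 h2 => ?_⟩⟩
  · obtain ⟨k, hk⟩ := hκ.exists_desc (T := T) (fun i => Fin.cases f (fun j => Fin.cases g
      (fun l => l.elim0) j) i)
    exact ⟨k, hk 0, hk 1⟩
  · obtain ⟨U, hU, e⟩ := hκ.exists_phase k k' (by
      intro i
      fin_cases i
      · exact h1
      · exact h2)
    exact ⟨U, ⟨hU 0, hU 1⟩, e⟩

/-- Parallel morphisms out of the empty phased coproduct `Z` differ by an endomorphism of `Z`.
Applied to the two coprojections of `Z ∔ Z`, this yields one `u` that works for all pairs at once,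
and the pair `𝟙 Z, 𝟙 Z` shows `u = 𝟙 Z`. -/
lemma HasFinitePhasedCoproducts.exists_initial (h : HasFinitePhasedCoproducts C) :
    ∃ Z : C, (∀ T : C, Nonempty (Z ⟶ T)) ∧ ∀ (T : C) (f g : Z ⟶ T), f = g := by
  obtain ⟨Z, κ, hκ⟩ := h 0 (fun i => i.elim0)
  obtain ⟨E, k, k', hE⟩ := h.exists_binary Z Z
  obtain ⟨u, -, eu⟩ := hκ.exists_phase k k' (fun i => i.elim0)
  have key : ∀ (T : C) (f g : Z ⟶ T), g = u ≫ f := by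
    intro T f g
    obtain ⟨l, h1, h2⟩ := hE.exists_desc f g
    rw [← h1, ← h2, eu, Category.assoc]
  refine ⟨Z, fun T => ⟨(hκ.exists_desc (T := T) (fun i => i.elim0)).choose⟩, fun T f g => ?_⟩
  have hu : 𝟙 Z = u := (key Z (𝟙 Z) (𝟙 Z)).trans (Category.comp_id u)
  rw [key T f g, ← hu, Category.id_comp]

end Basics

/-! ### Morphisms which extend to a coprojection -/

section PreCoprojection

variable {C : Type u} [Category.{v} C]

/-- `f` becomes a coprojection of a phased coproduct after composition with some morphism. -/
def IsPreCoprojection {X Y : C} (f : X ⟶ Y) : Prop :=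
  ∃ (Z T : C) (d : Y ⟶ T) (m : Z ⟶ T), IsPhasedCoproduct (f ≫ d) m

lemma IsPreCoprojection.mono (hC : MonicPhasedCoproducts C) {X Y : C} {f : X ⟶ Y}
    (h : IsPreCoprojection f) : Mono f := by
  obtain ⟨Z, T, d, m, h⟩ := h
  have := (hC _ _ h).1
  exact mono_of_mono f d

lemma IsPhasedCoproduct.isPreCoprojection {A B E : C} {κA : A ⟶ E} {κB : B ⟶ E}
    (h : IsPhasedCoproduct κA κB) : IsPreCoprojection κA :=
  ⟨B, E, 𝟙 E, κB, by simpa using h⟩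

/-- The phase relating `f ≫ d` to `k` is absorbed as an isomorphism of the first summand. -/
lemma IsPreCoprojection.of_components {A B E F Z T : C} {κA : A ⟶ E} {κB : B ⟶ E}
    (h : IsPhasedCoproduct κA κB) {k : E ⟶ T} {m : Z ⟶ T} (hk : IsPhasedCoproduct k m)
    (f : E ⟶ F) (d : F ⟶ T) (hA : κA ≫ f ≫ d = κA ≫ k) (hB : κB ≫ f ≫ d = κB ≫ k) :
    IsPreCoprojection f := by
  obtain ⟨U, -, hU, e⟩ := h.exists_iso_phase hA.symm hB.symm
  refine ⟨Z, T, d, m, ?_⟩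
  rw [e]
  simpa using hk.iso_comp U (𝟙 Z)

/-- Monicity alone would not survive tensoring. This property does, by distributivity, which is the
reason to work with it. -/
lemma IsPreCoprojection.whiskerLeft [MonoidalCategory C] (hC : DistributivePhasedCoproducts C)
    {X Y : C} {f : X ⟶ Y} (h : IsPreCoprojection f) (A : C) : IsPreCoprojection (A ◁ f) := by
  obtain ⟨Z, T, d, m, h⟩ := h
  refine ⟨A ⊗ Z, A ⊗ T, A ◁ d, A ◁ m, ?_⟩
  have := ((hC A).1 _ _ h).1
  rwa [← MonoidalCategory.whiskerLeft_comp]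

lemma IsPreCoprojection.whiskerRight [MonoidalCategory C] (hC : DistributivePhasedCoproducts C)
    {X Y : C} {f : X ⟶ Y} (h : IsPreCoprojection f) (A : C) : IsPreCoprojection (f ▷ A) := by
  obtain ⟨Z, T, d, m, h⟩ := h
  refine ⟨Z ⊗ A, T ⊗ A, d ▷ A, m ▷ A, ?_⟩
  have := ((hC A).2 _ _ h).1
  rwa [← MonoidalCategory.comp_whiskerRight]

variable [MonoidalCategory C]

lemma DistributivePhasedCoproducts.whiskerLeft (hC : DistributivePhasedCoproducts C)
    {A B E : C} {κA : A ⟶ E} {κB : B ⟶ E} (h : IsPhasedCoproduct κA κB) (X : C) :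
    IsPhasedCoproduct (X ◁ κA) (X ◁ κB) := ((hC X).1 _ _ h).1

lemma DistributivePhasedCoproducts.whiskerRight (hC : DistributivePhasedCoproducts C)
    {A B E : C} {κA : A ⟶ E} {κB : B ⟶ E} (h : IsPhasedCoproduct κA κB) (X : C) :
    IsPhasedCoproduct (κA ▷ X) (κB ▷ X) := ((hC X).2 _ _ h).1

lemma DistributivePhasedCoproducts.exists_desc_tensor (hC : DistributivePhasedCoproducts C)
    {A B E A' B' E' : C} {κA : A ⟶ E} {κB : B ⟶ E} {κA' : A' ⟶ E'} {κB' : B' ⟶ E'}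
    (h : IsPhasedCoproduct κA κB) (h' : IsPhasedCoproduct κA' κB') {T : C}
    (f₁ : A ⊗ A' ⟶ T) (f₂ : A ⊗ B' ⟶ T) (f₃ : B ⊗ A' ⟶ T) (f₄ : B ⊗ B' ⟶ T) :
    ∃ f : E ⊗ E' ⟶ T, (κA ⊗ₘ κA') ≫ f = f₁ ∧ (κA ⊗ₘ κB') ≫ f = f₂ ∧
      (κB ⊗ₘ κA') ≫ f = f₃ ∧ (κB ⊗ₘ κB') ≫ f = f₄ := by
  obtain ⟨a, a1, a2⟩ := (hC.whiskerRight h A').exists_desc f₁ f₃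
  obtain ⟨b, b1, b2⟩ := (hC.whiskerRight h B').exists_desc f₂ f₄
  obtain ⟨f, h1, h2⟩ := (hC.whiskerLeft h' E).exists_desc a b
  refine ⟨f, ?_, ?_, ?_, ?_⟩ <;> simp only [MonoidalCategory.tensorHom_def, Category.assoc, h1, h2,
    a1, a2, b1, b2]

/-- The canonical morphism `A ⊗ A' ∔ J ⟶ (A ∔ B) ⊗ (A' ∔ B')`, where `J ≅ B ⊗ B'`. -/
lemma PhasedCoprodCat.isPreCoprojection_tensor (hC : PhasedCoprodCat C)
    {A B E A' B' E' J G : C} {κA : A ⟶ E} {κB : B ⟶ E} {κA' : A' ⟶ E'} {κB' : B' ⟶ E'}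
    (h : IsPhasedCoproduct κA κB) (h' : IsPhasedCoproduct κA' κB') (j : J ≅ B ⊗ B')
    {k : A ⊗ A' ⟶ G} {kJ : J ⟶ G} (hG : IsPhasedCoproduct k kJ) (c : G ⟶ E ⊗ E')
    (h1 : k ≫ c = κA ⊗ₘ κA') (h2 : kJ ≫ c = j.hom ≫ (κB ⊗ₘ κB')) : IsPreCoprojection c := by
  -- `c` misses the two mixed summands of `E ⊗ E'`. They are collected in `Z`, and `d` maps all four
  -- summands to `G ∔ Z` so that `c ≫ d` has the components of the coprojection `m`.
  obtain ⟨Z, z₁, z₂, hZ⟩ := hC.finite.exists_binary (A ⊗ B') (B ⊗ A')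
  obtain ⟨T, m, m', hT⟩ := hC.finite.exists_binary G Z
  obtain ⟨d, d1, -, -, d4⟩ := hC.distrib.exists_desc_tensor h h' (k ≫ m) (z₁ ≫ m') (z₂ ≫ m')
    (j.inv ≫ kJ ≫ m)
  exact IsPreCoprojection.of_components hG hT c d (by rw [reassoc_of% h1, d1])
    (by rw [reassoc_of% h2, d4, Iso.hom_inv_id_assoc])

end PreCoprojection

/-! ### The categories `GPCat W` -/

namespace GPCat

variable {B : Type u} [Category.{v} B] [MonoidalCategory B]
  {W : ∀ ⦃A E : B⦄, (A ⟶ E) → (𝟙_ B ⟶ E) → Prop}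

@[simp]
lemma inr_hom {X Y : GPCat W} (f : X ⟶ Y) : X.inr ≫ f.hom = Y.inr := Hom.inr_hom f

@[simp]
lemma inr_hom_assoc {X Y : GPCat W} (f : X ⟶ Y) {T : B} (g : Y.tot ⟶ T) :
    X.inr ≫ f.hom ≫ g = Y.inr ≫ g := by rw [← Category.assoc, inr_hom]

/-- The morphism of `B` over which a morphism of `GPCat W` lies. -/
noncomputable def baseMap {X Y : GPCat W} (f : X ⟶ Y) : X.base ⟶ Y.base := (Hom.diag f).choose

lemma inl_hom {X Y : GPCat W} (f : X ⟶ Y) : X.inl ≫ f.hom = baseMap f ≫ Y.inl :=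
  (Hom.diag f).choose_spec

lemma inl_hom_assoc {X Y : GPCat W} (f : X ⟶ Y) {T : B} (g : Y.tot ⟶ T) :
    X.inl ≫ f.hom ≫ g = baseMap f ≫ Y.inl ≫ g := by
  rw [← Category.assoc, inl_hom, Category.assoc]

variable (W) in
/-- The kinds of phased coproducts for which the objects of `GPCat W` are well behaved. -/
structure Admissible : Prop where
  cat : PhasedCoprodCat B
  coprod : ∀ ⦃A E : B⦄ (κ : A ⟶ E) (κI : 𝟙_ B ⟶ E), W κ κI → IsPhasedCoproduct κ κI
  exists_obj : ∀ A : B, ∃ (E : B) (κ : A ⟶ E) (κI : 𝟙_ B ⟶ E), W κ κI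

lemma _root_.PhasedCoprod.PhasedCoprodCat.admissible (h : PhasedCoprodCat B) :
    Admissible (B := B) fun _ _ inl inr => IsPhasedCoproduct inl inr where
  cat := h
  coprod _ _ _ _ := id
  exists_obj A := h.finite.exists_binary A (𝟙_ B)

namespace Admissible

variable (hW : Admissible W)

include hW

lemma isPhasedCoproduct (X : GPCat W) : IsPhasedCoproduct X.inl X.inr := hW.coprod _ _ X.prop

lemma mono_inl (X : GPCat W) : Mono X.inl := (hW.cat.monic _ _ (hW.isPhasedCoproduct X)).1

lemma mono_inr (X : GPCat W) : Mono X.inr := (hW.cat.monic _ _ (hW.isPhasedCoproduct X)).2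

lemma baseMap_eq {X Y : GPCat W} (f : X ⟶ Y) {g : X.base ⟶ Y.base}
    (h : X.inl ≫ f.hom = g ≫ Y.inl) : baseMap f = g := by
  have := hW.mono_inl Y
  rw [← cancel_mono Y.inl, ← inl_hom, h]

lemma baseMap_id (X : GPCat W) : baseMap (𝟙 X) = 𝟙 X.base :=
  hW.baseMap_eq _ (by simp)

lemma baseMap_comp {X Y Z : GPCat W} (f : X ⟶ Y) (g : Y ⟶ Z) :
    baseMap (f ≫ g) = baseMap f ≫ baseMap g :=
  hW.baseMap_eq _ (by simp [inl_hom, inl_hom_assoc])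

omit hW in
lemma isPhase_of_baseMap {X : GPCat W} {u : X ⟶ X} (h : baseMap u = 𝟙 _) :
    IsPhase X.inl X.inr u.hom :=
  ⟨by rw [inl_hom, h, Category.id_comp], inr_hom u⟩

lemma baseMap_of_isPhase {X : GPCat W} {u : X ⟶ X} (h : IsPhase X.inl X.inr u.hom) :
    baseMap u = 𝟙 _ := hW.baseMap_eq _ (by rw [h.1, Category.id_comp])

/-- Phases as endomorphisms in `GPCat W`. -/
lemma exists_of_isPhase {X : GPCat W} {U : X.tot ⟶ X.tot} (h : IsPhase X.inl X.inr U) :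
    ∃ u : X ⟶ X, u.hom = U ∧ baseMap u = 𝟙 _ := by
  refine ⟨⟨U, ⟨𝟙 _, by rw [h.1, Category.id_comp]⟩, h.2⟩, rfl, ?_⟩
  exact hW.baseMap_of_isPhase h

/-- Lifting along a monomorphism out of the total object. -/
lemma exists_lift {X Y : GPCat W} {F : B} (m : Y.tot ⟶ F) (f : X.tot ⟶ F)
    (g : X.base ⟶ Y.base) (h1 : X.inl ≫ f = g ≫ Y.inl ≫ m) (h2 : X.inr ≫ f = Y.inr ≫ m) :
    ∃ k : X ⟶ Y, k.hom ≫ m = f ∧ baseMap k = g := by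
  obtain ⟨k, k1, k2⟩ := (hW.isPhasedCoproduct X).exists_desc (g ≫ Y.inl) Y.inr
  -- A phase of the source turns `k ≫ m` into `f`, and `U ≫ k` is still diagonal over `g`. Monicity
  -- of `m` is not needed for existence.
  obtain ⟨U, hU, e⟩ := (hW.isPhasedCoproduct X).exists_phase (k ≫ m) f
    (by rw [reassoc_of% k1, h1]) (by rw [reassoc_of% k2, h2])
  have h3 : X.inl ≫ U ≫ k = g ≫ Y.inl := by rw [reassoc_of% hU.1, k1]
  let k' : X ⟶ Y := ⟨U ≫ k, ⟨g, h3⟩, by rw [reassoc_of% hU.2, k2]⟩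
  exact ⟨k', by rw [e, Category.assoc], hW.baseMap_eq k' h3⟩

lemma exists_hom {X Y : GPCat W} (g : X.base ⟶ Y.base) : ∃ f : X ⟶ Y, baseMap f = g := by
  obtain ⟨k, k1, k2⟩ := (hW.isPhasedCoproduct X).exists_desc (g ≫ Y.inl) Y.inr
  obtain ⟨f, -, hf⟩ := hW.exists_lift (𝟙 Y.tot) k g (by simpa using k1) (by simpa using k2)
  exact ⟨f, hf⟩

lemma exists_hom_desc {X : GPCat W} {T : B} (f : X.base ⟶ T) (g : 𝟙_ B ⟶ T) :
    ∃ k : X.tot ⟶ T, X.inl ≫ k = f ∧ X.inr ≫ k = g :=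
  (hW.isPhasedCoproduct X).exists_desc f g

lemma exists_phase {X Y : GPCat W} {f f' : X ⟶ Y} (h : baseMap f = baseMap f') :
    ∃ u : X ⟶ X, baseMap u = 𝟙 _ ∧ f' = u ≫ f := by
  obtain ⟨U, hU, e⟩ := (hW.isPhasedCoproduct X).exists_phase f.hom f'.hom
    (by rw [inl_hom, inl_hom, h]) (by rw [inr_hom, inr_hom])
  obtain ⟨u, rfl, hu⟩ := hW.exists_of_isPhase hU
  exact ⟨u, hu, hom_ext e⟩

/-- This is transitivity of phases, applied to a diagonal morphism whose second component is an
identity. -/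
lemma exists_comm_phase {X Y : GPCat W} (f : X ⟶ Y) (u : X ⟶ X) (hu : baseMap u = 𝟙 _) :
    ∃ v : Y ⟶ Y, baseMap v = 𝟙 _ ∧ u ≫ f = f ≫ v := by
  obtain ⟨V, hV, e⟩ := hW.cat.transitive _ _ _ _ (hW.isPhasedCoproduct X)
    (hW.isPhasedCoproduct Y) f.hom (Hom.diag f) ⟨𝟙 _, by rw [inr_hom, Category.id_comp]⟩
    u.hom (isPhase_of_baseMap hu)
  obtain ⟨v, rfl, hv⟩ := hW.exists_of_isPhase hV
  exact ⟨v, hv, hom_ext e⟩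

lemma exists_phase_comp {X Y : GPCat W} {f f' : X ⟶ Y} (h : baseMap f = baseMap f') :
    ∃ v : Y ⟶ Y, baseMap v = 𝟙 _ ∧ f' = f ≫ v := by
  obtain ⟨u, hu, rfl⟩ := hW.exists_phase h
  exact hW.exists_comm_phase f u hu

lemma isIso_hom {X Y : GPCat W} (f : X ⟶ Y) [IsIso (baseMap f)] : IsIso f.hom :=
  (hW.isPhasedCoproduct X).isIso_of_diagonal (hW.isPhasedCoproduct Y) f.hom (baseMap f) (𝟙 _)
    (inl_hom f) (by rw [inr_hom, Category.id_comp])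

/-- A diagonal morphism with invertible components is invertible in `B`, and its inverse is again
diagonal and fixes `κ_I`. -/
lemma isIso_of_baseMap {X Y : GPCat W} (f : X ⟶ Y) (h : IsIso (baseMap f)) : IsIso f := by
  have := hW.isIso_hom f
  refine ⟨⟨inv f.hom, ⟨inv (baseMap f), ?_⟩, ?_⟩, hom_ext ?_, hom_ext ?_⟩
  · rw [IsIso.comp_inv_eq, Category.assoc, inl_hom, IsIso.inv_hom_id_assoc]
  · rw [IsIso.comp_inv_eq, inr_hom]
  · exact IsIso.hom_inv_id _
  · exact IsIso.inv_hom_id _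

lemma isIso_phase {X : GPCat W} {u : X ⟶ X} (h : baseMap u = 𝟙 _) : IsIso u :=
  hW.isIso_of_baseMap u (by rw [h]; infer_instance)

lemma isIso_baseMap {X Y : GPCat W} (f : X ⟶ Y) [IsIso f] : IsIso (baseMap f) :=
  ⟨baseMap (inv f), by rw [← hW.baseMap_comp, IsIso.hom_inv_id, hW.baseMap_id],
    by rw [← hW.baseMap_comp, IsIso.inv_hom_id, hW.baseMap_id]⟩

omit hW in
lemma mono_of_mono_hom {X Y : GPCat W} (f : X ⟶ Y) (h : Mono f.hom) : Mono f :=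
  ⟨fun _ _ e => hom_ext ((cancel_mono f.hom).1 (congrArg Hom.hom e))⟩

end Admissible

end GPCat

/-! ### Composites of tensors of morphisms with whiskerings -/

section

variable {C : Type u} [Category.{v} C] [MonoidalCategory C]

lemma tensorHom_comp_whiskerLeft' {X Y X' Y' Z : C} (f : X ⟶ Y) (g : X' ⟶ Y') (h : Y' ⟶ Z) :
    (f ⊗ₘ g) ≫ Y ◁ h = (f ⊗ₘ g ≫ h) := by
  simp [MonoidalCategory.tensorHom_def]

lemma tensorHom_comp_whiskerRight' {X Y X' Y' Z : C} (f : X ⟶ Y) (g : X' ⟶ Y') (h : Y ⟶ Z) :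
    (f ⊗ₘ g) ≫ h ▷ Y' = (f ≫ h ⊗ₘ g) := by
  simp [MonoidalCategory.tensorHom_def']

lemma tensorHom_comp_whiskerRight_assoc' {X Y X' Y' Z T : C} (f : X ⟶ Y) (g : X' ⟶ Y')
    (h : Y ⟶ Z) (k : Z ⊗ Y' ⟶ T) : (f ⊗ₘ g) ≫ h ▷ Y' ≫ k = (f ≫ h ⊗ₘ g) ≫ k := by
  rw [← Category.assoc, tensorHom_comp_whiskerRight']

lemma whiskerLeft_comp_tensorHom' {X Y Z X' Y' : C} (h : Z ⟶ X') (f : X ⟶ Y) (g : X' ⟶ Y') :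
    X ◁ h ≫ (f ⊗ₘ g) = (f ⊗ₘ h ≫ g) := by
  simp [MonoidalCategory.tensorHom_def']

lemma whiskerRight_comp_tensorHom_assoc' {X Y Z X' Y' T : C} (h : Z ⟶ X) (f : X ⟶ Y)
    (g : X' ⟶ Y') (k : Y ⊗ Y' ⟶ T) : h ▷ X' ≫ (f ⊗ₘ g) ≫ k = (h ≫ f ⊗ₘ g) ≫ k := by
  simp [MonoidalCategory.tensorHom_def]

end

namespace GPCat

/-! ### Existence of the monoidal structure on `GPCat W` -/

namespace Admissible

variable {B : Type u} [Category.{v} B] [MonoidalCategory B]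
  {W : ∀ ⦃A E : B⦄, (A ⟶ E) → (𝟙_ B ⟶ E) → Prop} (hW : Admissible W)

/-- A chosen object of `GPCat W` over `A`. -/
noncomputable def obj (A : B) : GPCat W :=
  ⟨A, (hW.exists_obj A).choose, (hW.exists_obj A).choose_spec.choose,
    (hW.exists_obj A).choose_spec.choose_spec.choose,
    (hW.exists_obj A).choose_spec.choose_spec.choose_spec⟩

/-- The chosen tensor product of objects of `GPCat W`. -/
noncomputable def tensorObj (X Y : GPCat W) : GPCat W := hW.obj (X.base ⊗ Y.base)

lemma base_tensorObj (X Y : GPCat W) : (hW.tensorObj X Y).base = X.base ⊗ Y.base := rfl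

/-- The chosen unit object of `GPCat W`. -/
noncomputable def tensorUnit : GPCat W := hW.obj (𝟙_ B)

lemma base_tensorUnit : hW.tensorUnit.base = 𝟙_ B := rfl

lemma exists_c (X Y : GPCat W) : ∃ c : (hW.tensorObj X Y).tot ⟶ X.tot ⊗ Y.tot,
    (hW.tensorObj X Y).inl ≫ c = eqToHom (hW.base_tensorObj X Y) ≫ (X.inl ⊗ₘ Y.inl) ∧
    (hW.tensorObj X Y).inr ≫ c = (ρ_ (𝟙_ B)).inv ≫ (X.inr ⊗ₘ Y.inr) :=
  hW.exists_hom_desc _ _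

/-- The comparison from the tensor in `GPCat W` to the tensor in `B`. -/
noncomputable def c (X Y : GPCat W) :
    (hW.tensorObj X Y).tot ⟶ X.tot ⊗ Y.tot := (hW.exists_c X Y).choose

lemma inl_c (X Y : GPCat W) : (hW.tensorObj X Y).inl ≫ hW.c X Y =
    eqToHom (hW.base_tensorObj X Y) ≫ (X.inl ⊗ₘ Y.inl) :=
  (hW.exists_c X Y).choose_spec.1

lemma inr_c (X Y : GPCat W) : (hW.tensorObj X Y).inr ≫ hW.c X Y =
    (ρ_ (𝟙_ B)).inv ≫ (X.inr ⊗ₘ Y.inr) := (hW.exists_c X Y).choose_spec.2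

lemma inl_c_assoc (X Y : GPCat W) {T : B} (f : X.tot ⊗ Y.tot ⟶ T) :
    (hW.tensorObj X Y).inl ≫ hW.c X Y ≫ f =
      eqToHom (hW.base_tensorObj X Y) ≫ (X.inl ⊗ₘ Y.inl) ≫ f := by
  rw [← Category.assoc, inl_c, Category.assoc]

lemma inr_c_assoc (X Y : GPCat W) {T : B} (f : X.tot ⊗ Y.tot ⟶ T) :
    (hW.tensorObj X Y).inr ≫ hW.c X Y ≫ f = (ρ_ (𝟙_ B)).inv ≫ (X.inr ⊗ₘ Y.inr) ≫ f := by
  rw [← Category.assoc, hW.inr_c, Category.assoc]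

include hW in
/-- The comparison morphisms are precoprojections. -/
lemma isPreCoprojection_of_components {X Y Z : GPCat W} (t : Z.base ≅ X.base ⊗ Y.base)
    (c : Z.tot ⟶ X.tot ⊗ Y.tot) (h1 : Z.inl ≫ c = t.hom ≫ (X.inl ⊗ₘ Y.inl))
    (h2 : Z.inr ≫ c = (ρ_ (𝟙_ B)).inv ≫ (X.inr ⊗ₘ Y.inr)) : IsPreCoprojection c :=
  hW.cat.isPreCoprojection_tensor (hW.isPhasedCoproduct X) (hW.isPhasedCoproduct Y)
    (ρ_ (𝟙_ B)).symm (k := t.inv ≫ Z.inl) (kJ := Z.inr)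
    (by simpa using (hW.isPhasedCoproduct Z).iso_comp t.inv (𝟙 _)) c
    (by rw [Category.assoc, h1, Iso.inv_hom_id_assoc]) h2

lemma isPreCoprojection_c (X Y : GPCat W) : IsPreCoprojection (hW.c X Y) :=
  hW.isPreCoprojection_of_components (eqToIso (hW.base_tensorObj X Y)) _ (hW.inl_c X Y)
    (hW.inr_c X Y)

instance mono_c (X Y : GPCat W) : Mono (hW.c X Y) :=
  (hW.isPreCoprojection_c X Y).mono hW.cat.monic

instance mono_whiskerLeft_c (F : B) (X Y : GPCat W) : Mono (F ◁ hW.c X Y) :=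
  ((hW.isPreCoprojection_c X Y).whiskerLeft hW.cat.distrib F).mono hW.cat.monic

instance mono_whiskerLeft_whiskerLeft_c (F G : B) (X Y : GPCat W) :
    Mono (F ◁ G ◁ hW.c X Y) :=
  (((hW.isPreCoprojection_c X Y).whiskerLeft hW.cat.distrib G).whiskerLeft
    hW.cat.distrib F).mono hW.cat.monic

lemma exists_tensorHom {X Y X' Y' : GPCat W} (f : X ⟶ Y) (g : X' ⟶ Y') :
    ∃ k : hW.tensorObj X X' ⟶ hW.tensorObj Y Y',
      k.hom ≫ hW.c Y Y' = hW.c X X' ≫ (f.hom ⊗ₘ g.hom) ∧ baseMap k =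
        eqToHom (hW.base_tensorObj _ _) ≫ (baseMap f ⊗ₘ baseMap g) ≫
          eqToHom (hW.base_tensorObj _ _).symm := by
  refine hW.exists_lift (hW.c Y Y') _ _ ?_ ?_
  · simp [inl_c_assoc, inl_c, MonoidalCategory.tensorHom_comp_tensorHom, inl_hom]
  · rw [inr_c_assoc, inr_c, MonoidalCategory.tensorHom_comp_tensorHom, inr_hom, inr_hom]

/-- The tensor of morphisms in `GPCat W`. -/
noncomputable def tensorHom {X Y X' Y' : GPCat W} (f : X ⟶ Y) (g : X' ⟶ Y') :
    hW.tensorObj X X' ⟶ hW.tensorObj Y Y' := (hW.exists_tensorHom f g).choose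

lemma tensorHom_c {X Y X' Y' : GPCat W} (f : X ⟶ Y) (g : X' ⟶ Y') :
    (hW.tensorHom f g).hom ≫ hW.c Y Y' = hW.c X X' ≫ (f.hom ⊗ₘ g.hom) :=
  (hW.exists_tensorHom f g).choose_spec.1

lemma tensorHom_c_assoc {X Y X' Y' : GPCat W} (f : X ⟶ Y) (g : X' ⟶ Y') {T : B}
    (h : Y.tot ⊗ Y'.tot ⟶ T) :
    (hW.tensorHom f g).hom ≫ hW.c Y Y' ≫ h = hW.c X X' ≫ (f.hom ⊗ₘ g.hom) ≫ h := by
  rw [← Category.assoc, tensorHom_c, Category.assoc]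

/-- The right-hand side has the components of the comparison map, transported along the associator
of the bases, so it lifts. The lift is invertible because its base map is. -/
lemma exists_associator (X Y Z : GPCat W) :
    ∃ k : hW.tensorObj (hW.tensorObj X Y) Z ≅ hW.tensorObj X (hW.tensorObj Y Z),
      k.hom.hom ≫ hW.c X (hW.tensorObj Y Z) ≫ X.tot ◁ hW.c Y Z =
        hW.c (hW.tensorObj X Y) Z ≫ hW.c X Y ▷ Z.tot ≫ (α_ X.tot Y.tot Z.tot).hom := by
  obtain ⟨k, hk, hk'⟩ := hW.exists_lift (X := hW.tensorObj (hW.tensorObj X Y) Z)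
    (Y := hW.tensorObj X (hW.tensorObj Y Z))
    (hW.c X (hW.tensorObj Y Z) ≫ X.tot ◁ hW.c Y Z)
    (hW.c (hW.tensorObj X Y) Z ≫ hW.c X Y ▷ Z.tot ≫ (α_ X.tot Y.tot Z.tot).hom)
    (eqToHom (hW.base_tensorObj _ _) ≫ eqToHom (hW.base_tensorObj _ _) ▷ Z.base ≫
      (α_ X.base Y.base Z.base).hom ≫
      X.base ◁ eqToHom (hW.base_tensorObj _ _).symm ≫ eqToHom (hW.base_tensorObj _ _).symm)
    (by
      simp only [inl_c_assoc, Category.assoc, eqToHom_trans_assoc, eqToHom_refl, Category.id_comp]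
      rw [tensorHom_comp_whiskerRight_assoc', tensorHom_comp_whiskerLeft', inl_c, inl_c,
        whiskerLeft_comp_tensorHom', eqToHom_trans_assoc, eqToHom_refl, Category.id_comp,
        ← associator_naturality, ← whiskerRight_comp_tensorHom_assoc'])
    (by
      simp only [inr_c_assoc]
      rw [tensorHom_comp_whiskerRight_assoc', tensorHom_comp_whiskerLeft', inr_c, inr_c]
      simp [MonoidalCategory.tensorHom_def])
  have := hW.isIso_of_baseMap k (by rw [hk']; infer_instance)
  exact ⟨asIso k, hk⟩

/-- The associator of `GPCat W`. -/
noncomputable def associator (X Y Z : GPCat W) :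
    hW.tensorObj (hW.tensorObj X Y) Z ≅ hW.tensorObj X (hW.tensorObj Y Z) :=
  (hW.exists_associator X Y Z).choose

lemma associator_c (X Y Z : GPCat W) : (hW.associator X Y Z).hom.hom ≫
    hW.c X (hW.tensorObj Y Z) ≫ X.tot ◁ hW.c Y Z =
      hW.c (hW.tensorObj X Y) Z ≫ hW.c X Y ▷ Z.tot ≫ (α_ X.tot Y.tot Z.tot).hom :=
  (hW.exists_associator X Y Z).choose_spec

lemma associator_c_assoc (X Y Z : GPCat W) {T : B} (f : X.tot ⊗ Y.tot ⊗ Z.tot ⟶ T) :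
    (hW.associator X Y Z).hom.hom ≫ hW.c X (hW.tensorObj Y Z) ≫ X.tot ◁ hW.c Y Z ≫ f =
      hW.c (hW.tensorObj X Y) Z ≫ hW.c X Y ▷ Z.tot ≫ (α_ X.tot Y.tot Z.tot).hom ≫ f := by
  have := congrArg (· ≫ f) (hW.associator_c X Y Z)
  simpa using this

/-- Folding `I ∔ I` onto `I` produces the unitors. The fold is unique only up to a phase. Building
both unitors from the same choice is what makes the triangle identity hold. -/
lemma exists_codiag : ∃ d : hW.tensorUnit.tot ⟶ 𝟙_ B,
    hW.tensorUnit.inl ≫ d = eqToHom hW.base_tensorUnit ∧ hW.tensorUnit.inr ≫ d = 𝟙 _ :=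
  hW.exists_hom_desc _ _

/-- A codiagonal of the unit object. -/
noncomputable def codiag : hW.tensorUnit.tot ⟶ 𝟙_ B := hW.exists_codiag.choose

lemma inl_codiag : hW.tensorUnit.inl ≫ hW.codiag = eqToHom hW.base_tensorUnit :=
  hW.exists_codiag.choose_spec.1

lemma inr_codiag : hW.tensorUnit.inr ≫ hW.codiag = 𝟙 _ := hW.exists_codiag.choose_spec.2

lemma inl_leftUnitor (X : GPCat W) : (hW.tensorObj hW.tensorUnit X).inl ≫
    hW.c hW.tensorUnit X ≫ hW.codiag ▷ X.tot ≫ (λ_ X.tot).hom =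
      (eqToHom (hW.base_tensorObj _ _) ≫ eqToHom hW.base_tensorUnit ▷ X.base ≫
        (λ_ X.base).hom) ≫ X.inl := by
  rw [hW.inl_c_assoc, ← tensorHom_id, tensorHom_comp_tensorHom_assoc, inl_codiag]
  simp [MonoidalCategory.tensorHom_def]

lemma inl_rightUnitor (X : GPCat W) : (hW.tensorObj X hW.tensorUnit).inl ≫
    hW.c X hW.tensorUnit ≫ X.tot ◁ hW.codiag ≫ (ρ_ X.tot).hom =
      (eqToHom (hW.base_tensorObj _ _) ≫ X.base ◁ eqToHom hW.base_tensorUnit ≫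
        (ρ_ X.base).hom) ≫ X.inl := by
  rw [hW.inl_c_assoc, ← id_tensorHom, tensorHom_comp_tensorHom_assoc, inl_codiag]
  simp [MonoidalCategory.tensorHom_def']

/-- The left unitor of `GPCat W`, as a morphism. -/
noncomputable def leftUnitorHom (X : GPCat W) : hW.tensorObj hW.tensorUnit X ⟶ X :=
  ⟨hW.c hW.tensorUnit X ≫ hW.codiag ▷ X.tot ≫ (λ_ X.tot).hom, ⟨_, hW.inl_leftUnitor X⟩, by
    rw [inr_c_assoc, ← tensorHom_id, tensorHom_comp_tensorHom_assoc, inr_codiag, Category.comp_id,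
      id_tensorHom, leftUnitor_naturality, unitors_equal, Iso.inv_hom_id_assoc]⟩

/-- The right unitor of `GPCat W`, as a morphism. -/
noncomputable def rightUnitorHom (X : GPCat W) : hW.tensorObj X hW.tensorUnit ⟶ X :=
  ⟨hW.c X hW.tensorUnit ≫ X.tot ◁ hW.codiag ≫ (ρ_ X.tot).hom, ⟨_, hW.inl_rightUnitor X⟩, by
    rw [inr_c_assoc, ← id_tensorHom, tensorHom_comp_tensorHom_assoc, inr_codiag, Category.comp_id,
      tensorHom_id, rightUnitor_naturality, Iso.inv_hom_id_assoc]⟩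

lemma leftUnitorHom_hom (X : GPCat W) : (hW.leftUnitorHom X).hom =
    hW.c hW.tensorUnit X ≫ hW.codiag ▷ X.tot ≫ (λ_ X.tot).hom := rfl

lemma rightUnitorHom_hom (X : GPCat W) : (hW.rightUnitorHom X).hom =
    hW.c X hW.tensorUnit ≫ X.tot ◁ hW.codiag ≫ (ρ_ X.tot).hom := rfl

instance isIso_leftUnitorHom (X : GPCat W) : IsIso (hW.leftUnitorHom X) :=
  hW.isIso_of_baseMap _ (by
    rw [hW.baseMap_eq _ (hW.inl_leftUnitor X)]; infer_instance)

instance isIso_rightUnitorHom (X : GPCat W) : IsIso (hW.rightUnitorHom X) :=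
  hW.isIso_of_baseMap _ (by
    rw [hW.baseMap_eq _ (hW.inl_rightUnitor X)]; infer_instance)

/-- Since `c` is monic, the laws for morphisms into a tensor product can be verified in `B` after
composing with `c`. -/
lemma hom_ext_c {X Y Z : GPCat W} {f g : X ⟶ hW.tensorObj Y Z}
    (h : f.hom ≫ hW.c Y Z = g.hom ≫ hW.c Y Z) : f = g :=
  hom_ext ((cancel_mono _).1 h)

lemma tensorHom_comp {X Y Z X' Y' Z' : GPCat W} (f : X ⟶ Y) (g : Y ⟶ Z) (f' : X' ⟶ Y')
    (g' : Y' ⟶ Z') : hW.tensorHom f f' ≫ hW.tensorHom g g' = hW.tensorHom (f ≫ g) (f' ≫ g') := by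
  apply hW.hom_ext_c
  rw [comp_hom, Category.assoc, tensorHom_c, tensorHom_c_assoc, tensorHom_c,
    tensorHom_comp_tensorHom, comp_hom, comp_hom]

lemma tensorHom_id_id (X Y : GPCat W) : hW.tensorHom (𝟙 X) (𝟙 Y) = 𝟙 _ := by
  apply hW.hom_ext_c
  rw [tensorHom_c, id_hom, id_hom, id_tensorHom_id, Category.comp_id, id_hom, Category.id_comp]

lemma associator_naturality {X Y Z X' Y' Z' : GPCat W} (f : X ⟶ X') (g : Y ⟶ Y') (h : Z ⟶ Z') :
    hW.tensorHom (hW.tensorHom f g) h ≫ (hW.associator X' Y' Z').hom =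
      (hW.associator X Y Z).hom ≫ hW.tensorHom f (hW.tensorHom g h) := by
  apply hW.hom_ext_c
  -- The defining equation of the associator involves this second comparison map, so it has to be
  -- cancelled as well.
  rw [← cancel_mono (X'.tot ◁ hW.c Y' Z')]
  simp only [comp_hom, Category.assoc, associator_c, tensorHom_c_assoc]
  have e1 : (hW.tensorHom f g).hom ▷ Z.tot ≫ hW.c X' Y' ▷ Z.tot =
      hW.c X Y ▷ Z.tot ≫ (f.hom ⊗ₘ g.hom) ▷ Z.tot := by
    rw [← comp_whiskerRight, tensorHom_c, comp_whiskerRight]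
  have e2 : X.tot ◁ (hW.tensorHom g h).hom ≫ X.tot ◁ hW.c Y' Z' =
      X.tot ◁ hW.c Y Z ≫ X.tot ◁ (g.hom ⊗ₘ h.hom) := by
    rw [← MonoidalCategory.whiskerLeft_comp, tensorHom_c, MonoidalCategory.whiskerLeft_comp]
  rw [MonoidalCategory.tensorHom_def ((hW.tensorHom f g).hom), Category.assoc,
    whisker_exchange_assoc, reassoc_of% e1, MonoidalCategory.tensorHom_def' f.hom (hW.tensorHom g h).hom, Category.assoc,
    ← whisker_exchange, reassoc_of% e2, associator_c_assoc]
  have e3 := MonoidalCategory.associator_naturality f.hom g.hom h.hom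
  simp only [MonoidalCategory.tensorHom_def', MonoidalCategory.whiskerLeft_comp, Category.assoc,
    comp_whiskerRight] at e3 ⊢
  rw [← whisker_exchange_assoc, ← whisker_exchange_assoc, e3]

lemma leftUnitor_naturality {X Y : GPCat W} (f : X ⟶ Y) :
    hW.tensorHom (𝟙 hW.tensorUnit) f ≫ hW.leftUnitorHom Y = hW.leftUnitorHom X ≫ f := by
  apply hom_ext
  simp only [comp_hom, leftUnitorHom_hom, tensorHom_c_assoc, Category.assoc, id_hom,
    id_tensorHom, whisker_exchange_assoc, MonoidalCategory.leftUnitor_naturality]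

lemma rightUnitor_naturality {X Y : GPCat W} (f : X ⟶ Y) :
    hW.tensorHom f (𝟙 hW.tensorUnit) ≫ hW.rightUnitorHom Y = hW.rightUnitorHom X ≫ f := by
  apply hom_ext
  simp only [comp_hom, rightUnitorHom_hom, tensorHom_c_assoc, Category.assoc, id_hom,
    tensorHom_id, ← whisker_exchange_assoc, MonoidalCategory.rightUnitor_naturality]

lemma triangle (X Y : GPCat W) :
    (hW.associator X hW.tensorUnit Y).hom ≫ hW.tensorHom (𝟙 X) (hW.leftUnitorHom Y) =
      hW.tensorHom (hW.rightUnitorHom X) (𝟙 Y) := by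
  apply hW.hom_ext_c
  simp only [comp_hom, Category.assoc, tensorHom_c, leftUnitorHom_hom, rightUnitorHom_hom, id_hom,
    id_tensorHom, tensorHom_id, MonoidalCategory.whiskerLeft_comp, associator_c_assoc,
    comp_whiskerRight]
  simp

/-- After composition with three monic comparison maps both sides become sides of the pentagon in
`B`, preceded by the same comparison maps. -/
lemma pentagon (X Y Z T : GPCat W) :
    hW.tensorHom (hW.associator X Y Z).hom (𝟙 T) ≫ (hW.associator X (hW.tensorObj Y Z) T).hom ≫
      hW.tensorHom (𝟙 X) (hW.associator Y Z T).hom =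
    (hW.associator (hW.tensorObj X Y) Z T).hom ≫ (hW.associator X Y (hW.tensorObj Z T)).hom := by
  apply hW.hom_ext_c
  rw [← cancel_mono (X.tot ◁ hW.c Y (hW.tensorObj Z T)),
    ← cancel_mono (X.tot ◁ Y.tot ◁ hW.c Z T)]
  simp only [comp_hom, Category.assoc, tensorHom_c_assoc, id_hom, id_tensorHom]
  have e1 : X.tot ◁ (hW.associator Y Z T).hom.hom ≫ X.tot ◁ hW.c Y (hW.tensorObj Z T) ≫
      X.tot ◁ Y.tot ◁ hW.c Z T = X.tot ◁ hW.c (hW.tensorObj Y Z) T ≫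
        X.tot ◁ hW.c Y Z ▷ T.tot ≫ X.tot ◁ (α_ Y.tot Z.tot T.tot).hom := by
    simp only [← MonoidalCategory.whiskerLeft_comp, associator_c]
  have e2 : (hW.associator X Y Z).hom.hom ▷ T.tot ≫ hW.c X (hW.tensorObj Y Z) ▷ T.tot ≫
      (X.tot ◁ hW.c Y Z) ▷ T.tot = hW.c (hW.tensorObj X Y) Z ▷ T.tot ≫
        hW.c X Y ▷ Z.tot ▷ T.tot ≫ (α_ X.tot Y.tot Z.tot).hom ▷ T.tot := by
    simp only [← comp_whiskerRight, associator_c]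
  rw [e1, associator_c_assoc, associator_c_assoc, ← associator_naturality_middle_assoc,
    tensorHom_c_assoc, id_hom, tensorHom_id, reassoc_of% e2]
  have e3 : hW.c X Y ▷ (hW.tensorObj Z T).tot ≫ (X.tot ⊗ Y.tot) ◁ hW.c Z T =
      (hW.tensorObj X Y).tot ◁ hW.c Z T ≫ hW.c X Y ▷ (Z.tot ⊗ T.tot) :=
    (whisker_exchange _ _).symm
  rw [← associator_naturality_right, reassoc_of% e3, associator_c_assoc]
  simp

/-- The tensor product of `GPCat W`. -/
noncomputable abbrev monoidalStruct : MonoidalCategoryStruct (GPCat W) where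
  tensorObj X Y := hW.tensorObj X Y
  tensorHom f g := hW.tensorHom f g
  whiskerLeft X _ _ f := hW.tensorHom (𝟙 X) f
  whiskerRight f X := hW.tensorHom f (𝟙 X)
  tensorUnit := hW.tensorUnit
  associator := hW.associator
  leftUnitor X := asIso (hW.leftUnitorHom X)
  rightUnitor X := asIso (hW.rightUnitorHom X)

/-- The monoidal category `GPCat W`. -/
noncomputable abbrev monoidal : MonoidalCategory (GPCat W) :=
  letI := hW.monoidalStruct
  MonoidalCategory.ofTensorHom
    (id_tensorHom_id := hW.tensorHom_id_id)
    (tensorHom_comp_tensorHom := fun f f' g g' => hW.tensorHom_comp f g f' g')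
    (id_tensorHom := fun _ _ _ _ => rfl)
    (tensorHom_id := fun _ _ => rfl)
    (associator_naturality := hW.associator_naturality)
    (leftUnitor_naturality := hW.leftUnitor_naturality)
    (rightUnitor_naturality := hW.rightUnitor_naturality)
    (pentagon := hW.pentagon)
    (triangle := hW.triangle)

include hW in
theorem exists_tensorStructure :
    ∃ _ : MonoidalCategory (GPCat W), Nonempty (TensorStructure W) :=
  ⟨hW.monoidal, ⟨letI := hW.monoidal
  { base_tensor := hW.base_tensorObj
    base_unit := hW.base_tensorUnit
    c := hW.c
    inl_c := hW.inl_c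
    inr_c := hW.inr_c
    tensorHom_c := hW.tensorHom_c
    associator_c := hW.associator_c
    inl_leftUnitor := fun X => by
      refine (hW.inl_leftUnitor X).trans ?_
      simp
    inl_rightUnitor := fun X => by
      refine (hW.inl_rightUnitor X).trans ?_
      simp }⟩⟩

end Admissible

end GPCat

/-! ### Coproducts in `GPCat W` -/

section

variable {C : Type u} [Category.{v} C] [MonoidalCategory C]

/-- A phase of `A ∔ B ∔ I` which fixes `A ∔ I` and `B ∔ I` is the identity. -/
lemma PhasedCoprodCat.eq_id_of_fixes (hC : PhasedCoprodCat C) {A B X Y Z : C}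
    {a : A ⟶ X} {xI : 𝟙_ C ⟶ X} {b : B ⟶ Y} {yI : 𝟙_ C ⟶ Y} {i : X ⟶ Z} {j : Y ⟶ Z}
    (hX : IsPhasedCoproduct a xI) (hY : IsPhasedCoproduct b yI) (hZ : IsPhasedCoproduct i (b ≫ j))
    (hI : xI ≫ i = yI ≫ j) {R : Z ⟶ Z} (hi : i ≫ R = i) (hj : j ≫ R = j) : R = 𝟙 Z := by
  have hXY := hC.distrib.whiskerLeft hY X
  -- `Z = X ∔ B` is mapped to `X ⊗ Y`, with `X` going to `X ⊗ I` and `B` going through `I ⊗ B`. Here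
  -- both `A ∔ I` and `B ∔ I` occur as factors.
  obtain ⟨d, d1, d2⟩ := hZ.exists_desc ((ρ_ X).inv ≫ X ◁ yI) ((λ_ B).inv ≫ xI ▷ B ≫ X ◁ b)
  -- Only the summand `A ⊗ B` of `X ⊗ Y` is missed by `d`. Sending it to a fresh summand of `T`
  -- gives `e` such that `d ≫ e` has the components of the coprojection `k`.
  have hd : Mono d := by
    obtain ⟨T, k, m, hT⟩ := hC.finite.exists_binary Z (A ⊗ B)
    obtain ⟨e₀, -, e2⟩ := (hC.distrib.whiskerRight hX B).exists_desc m ((λ_ B).hom ≫ b ≫ j ≫ k)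
    obtain ⟨e, e3, e4⟩ := hXY.exists_desc e₀ ((ρ_ X).hom ≫ i ≫ k)
    have := (hC.monic _ _ hT).1
    refine hZ.mono_of_extension d e k ?_ ?_
    · rw [reassoc_of% d1, e4, Iso.inv_hom_id_assoc]
    · rw [← Category.assoc, d2]
      simp only [Category.assoc]
      rw [e3, e2, Iso.inv_hom_id_assoc]
  -- Transitivity carries `R` across `d` to a phase of `X ⊗ Y`, and distributivity says that this
  -- phase has the form `X ◁ V`.
  obtain ⟨V, hV, eV⟩ := hC.transitive _ _ _ _ hZ hXY.swap d ⟨(ρ_ X).inv, d1⟩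
    ⟨(λ_ B).inv ≫ xI ▷ B, by rw [d2, Category.assoc]⟩ R ⟨hi, by rw [Category.assoc, hj]⟩
  obtain ⟨V, hV', rfl⟩ := ((hC.distrib X).1 _ _ hY).2 V hV.swap
  have eV : R ≫ d = d ≫ X ◁ V := eV
  -- On `Y` the embedding `d` agrees, up to the phase `S`, with the inclusion of `I ⊗ Y`. As `R`
  -- fixes `j`, the phase `V` fixes this inclusion, and the inclusion is monic.
  obtain ⟨S, hS, eS⟩ := hY.exists_phase (j ≫ d) ((λ_ Y).inv ≫ xI ▷ Y)
    (by
      rw [← Category.assoc, d2, leftUnitor_inv_naturality_assoc, whisker_exchange])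
    (by
      rw [← reassoc_of% hI, d1, leftUnitor_inv_naturality_assoc, whisker_exchange,
        rightUnitor_inv_naturality_assoc, unitors_inv_equal])
  have e1 : j ≫ d ≫ X ◁ V = j ≫ d := by rw [← eV, reassoc_of% hj]
  have e2 : V ≫ (λ_ Y).inv ≫ xI ▷ Y = (λ_ Y).inv ≫ xI ▷ Y := by
    rw [leftUnitor_inv_naturality_assoc, whisker_exchange, ← Category.assoc, eS]
    simp only [Category.assoc, e1]
  have hm := (hC.monic _ _ (hC.distrib.whiskerRight hX Y)).2
  have hVid : V = 𝟙 Y := by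
    rw [← Category.assoc, cancel_mono] at e2
    simpa using congrArg (· ≫ (λ_ Y).hom) e2
  rw [hVid, whiskerLeft_id, Category.comp_id] at eV
  rw [← cancel_mono d, eV, Category.id_comp]

end

namespace GPCat

namespace Admissible

variable {B : Type u} [Category.{v} B] [MonoidalCategory B]
  {W : ∀ ⦃A E : B⦄, (A ⟶ E) → (𝟙_ B ⟶ E) → Prop} (hW : Admissible W)

include hW

/-- The total object of `Z` is `(A ∔ B) ∔ I`, which is regrouped as `(A ∔ I) ∔ B`. With `i` and `j`
exchanged this gives the other grouping, and both are used below. -/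
lemma isPhasedCoproduct_hom {X Y Z : GPCat W} (i : X ⟶ Z) (j : Y ⟶ Z)
    (h : IsPhasedCoproduct (baseMap i) (baseMap j)) :
    IsPhasedCoproduct i.hom (Y.inl ≫ j.hom) := by
  obtain ⟨G, γ, β, hG⟩ := hW.cat.finite.exists_binary X.tot Y.base
  rw [inl_hom]
  exact h.assoc (hW.isPhasedCoproduct Z) (hW.isPhasedCoproduct X) i.hom (inl_hom i) (inr_hom i) hG

lemma exists_desc {X Y Z T : GPCat W} (i : X ⟶ Z) (j : Y ⟶ Z)
    (h : IsPhasedCoproduct (baseMap i) (baseMap j)) (f : X ⟶ T) (g : Y ⟶ T) :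
    ∃ k : Z ⟶ T, i ≫ k = f ∧ j ≫ k = g := by
  have hZ := hW.isPhasedCoproduct_hom i j h
  obtain ⟨k, k1, k2⟩ := hZ.exists_desc f.hom (Y.inl ≫ g.hom)
  rw [Category.assoc] at k2
  have k3 : Z.inr ≫ k = T.inr := by rw [← inr_hom i, Category.assoc, k1, inr_hom]
  -- `k` is correct on all of `X` but on `Y` only up to the phase `U`. Transitivity along `j`
  -- replaces `U` by a phase `V` of `Z` that leaves `i` fixed.
  obtain ⟨U, hU, eU⟩ := (hW.isPhasedCoproduct Y).exists_phase (j.hom ≫ k) g.hom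
    k2 (by rw [inr_hom_assoc, k3, inr_hom])
  obtain ⟨V, hV, eV⟩ := hW.cat.transitive Y.inl Y.inr _ _ (hW.isPhasedCoproduct Y) hZ.swap j.hom
    ⟨𝟙 _, by rw [Category.id_comp]⟩ ⟨X.inr, by rw [inr_hom, inr_hom]⟩ U hU
  have e1 : i.hom ≫ V ≫ k = f.hom := by rw [reassoc_of% hV.2, k1]
  have e2 : j.hom ≫ V ≫ k = g.hom := by rw [eU, reassoc_of% eV]
  -- It remains to see that `V ≫ k` is diagonal. Its restriction to `Z.base` has the components of
  -- `q ≫ T.inl`, hence equals it up to a phase `S` of the bases.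
  obtain ⟨q, q1, q2⟩ := h.exists_desc (baseMap f) (baseMap g)
  obtain ⟨S, -, eS⟩ := h.exists_phase (q ≫ T.inl) (Z.inl ≫ V ≫ k)
    (by rw [reassoc_of% q1, ← inl_hom_assoc, e1, inl_hom])
    (by rw [reassoc_of% q2, ← inl_hom_assoc, e2, inl_hom])
  exact ⟨⟨V ≫ k, ⟨S ≫ q, by rw [eS, Category.assoc]⟩,
    by rw [← inr_hom i, Category.assoc, e1, inr_hom]⟩, hom_ext e1, hom_ext e2⟩

/-- Write `k' = U ≫ k` with `U` a phase for `X ∔ B`, where `B` is the base of `Y`. To show that `U`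
acts trivially, `k` is factored as `m ≫ l` with `m` monic on `X`. Then `U` can be replaced by a
phase `R` that fixes both `X` and `Y`, and `eq_id_of_fixes` applies. -/
lemma desc_unique {X Y Z T : GPCat W} (i : X ⟶ Z) (j : Y ⟶ Z)
    (h : IsPhasedCoproduct (baseMap i) (baseMap j)) (k k' : Z ⟶ T) (hi : i ≫ k = i ≫ k')
    (hj : j ≫ k = j ≫ k') : k = k' := by
  have hi' : i.hom ≫ k.hom = i.hom ≫ k'.hom := congrArg Hom.hom hi
  have hj' : j.hom ≫ k.hom = j.hom ≫ k'.hom := congrArg Hom.hom hj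
  have hZ := hW.isPhasedCoproduct_hom i j h
  have hZ' := hW.isPhasedCoproduct_hom j i h.swap
  obtain ⟨U, hU, eU⟩ := hZ.exists_phase k.hom k'.hom hi' (by rw [Category.assoc, hj',
    Category.assoc])
  have hU2 : Y.inl ≫ j.hom ≫ U = Y.inl ≫ j.hom := by simpa using hU.2
  have hUr : Z.inr ≫ U = Z.inr := by rw [← inr_hom i, Category.assoc, hU.1]
  obtain ⟨V, hV, eV⟩ := (hW.isPhasedCoproduct Y).exists_phase j.hom (j.hom ≫ U) hU2.symm
    (by rw [inr_hom_assoc, hUr, inr_hom])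
  have hVk : V ≫ j.hom ≫ k.hom = j.hom ≫ k.hom := by
    rw [← reassoc_of% eV, ← eU, hj']
  -- Adding a free copy of `X.base` to the target makes the restriction to `X` monic, even though
  -- nothing is known about `k`. The map `l` folds the copy back, and the phase `S` makes the
  -- factorization of `k` through `l` exact.
  obtain ⟨N, nA, nT, hN⟩ := hW.cat.finite.exists_binary X.base T.tot
  obtain ⟨m₀, m1, m2⟩ := hZ'.exists_desc (j.hom ≫ k.hom ≫ nT) nA
  obtain ⟨l, l1, l2⟩ := hN.exists_desc (X.inl ≫ i.hom ≫ k.hom) (𝟙 _)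
  obtain ⟨S, hS, eS⟩ := hZ'.exists_phase (m₀ ≫ l) k.hom
    (by rw [reassoc_of% m1, l2, Category.comp_id])
    (by rw [← Category.assoc, m2, l1, Category.assoc])
  obtain ⟨m, rfl⟩ : ∃ m, m = S ≫ m₀ := ⟨_, rfl⟩
  have m1' : j.hom ≫ S ≫ m₀ = j.hom ≫ k.hom ≫ nT := by rw [reassoc_of% hS.1, m1]
  have m2' : X.inl ≫ i.hom ≫ S ≫ m₀ = nA := by
    have := hS.2
    rw [Category.assoc] at this m2
    rw [reassoc_of% this, m2]
  have hU3 : X.inl ≫ i.hom ≫ U = X.inl ≫ i.hom := by rw [hU.1]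
  -- `U` and `R` have the same effect on `m = S ≫ m₀`, but `R` fixes all of `Y` by construction,
  -- while `U` fixes all of `X`.
  obtain ⟨R, hR, eR⟩ := hZ'.exists_phase (S ≫ m₀) (U ≫ S ≫ m₀)
    (by rw [reassoc_of% eV, m1', reassoc_of% hVk])
    (by simp only [Category.assoc]; rw [reassoc_of% hU3])
  have hR2 : X.inl ≫ i.hom ≫ R = X.inl ≫ i.hom := by simpa using hR.2
  have hRr : Z.inr ≫ R = Z.inr := by rw [← inr_hom j, Category.assoc, hR.1]
  obtain ⟨r, -, er⟩ := (hW.isPhasedCoproduct X).exists_phase i.hom (i.hom ≫ R) hR2.symm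
    (by rw [inr_hom_assoc, hRr, inr_hom])
  -- On `X = A ∔ I` the map `m` is `nA` on `A` and sends `I` into `T`. A morphism from `N` to `X ∔
  -- T.base` sends these to the two parts of the coprojection of `X`.
  have hmono : Mono (i.hom ≫ S ≫ m₀) := by
    obtain ⟨M, mX, mC, hM⟩ := hW.cat.finite.exists_binary X.tot T.base
    obtain ⟨d₀, d1, d2⟩ := (hW.isPhasedCoproduct T).exists_desc mC (X.inr ≫ mX)
    obtain ⟨d, d3, d4⟩ := hN.exists_desc (X.inl ≫ mX) d₀
    have := (hW.cat.monic _ _ hM).1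
    refine (hW.isPhasedCoproduct X).mono_of_extension _ d mX ?_ ?_
    · have := congrArg (· ≫ d) m2'
      simp only [Category.assoc] at this ⊢
      rw [this, d3]
    · have := congrArg (· ≫ d) m1'
      simp only [Category.assoc, inr_hom_assoc] at this ⊢
      rw [← inr_hom_assoc j, this, inr_hom_assoc, inr_hom_assoc, d4, d2]
  -- `U` fixes `i`, so `R` fixes `i ≫ m`. As this is monic, `R` restricts to the identity on `X`.
  have hr : r = 𝟙 _ := by
    rw [← cancel_mono (i.hom ≫ S ≫ m₀), ← reassoc_of% er, ← eR, Category.id_comp,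
      reassoc_of% hU.1]
  have hRid := hW.cat.eq_id_of_fixes (hW.isPhasedCoproduct X) (hW.isPhasedCoproduct Y) hZ
    (by rw [inr_hom, inr_hom]) (R := R) (by rw [er, hr, Category.id_comp]) hR.1
  rw [hRid, Category.id_comp] at eR
  apply hom_ext
  rw [eU, eS]
  have := congrArg (· ≫ l) eR
  simp only [Category.assoc] at this
  exact this.symm

/-- A cofan in `GPCat W` over a phased coproduct is a coproduct. -/
theorem nonempty_isColimit {X Y Z : GPCat W} (i : X ⟶ Z) (j : Y ⟶ Z)
    (h : IsPhasedCoproduct (baseMap i) (baseMap j)) :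
    Nonempty (IsColimit (BinaryCofan.mk i j)) := by
  choose d hd using fun (T : GPCat W) (f : X ⟶ T) (g : Y ⟶ T) => hW.exists_desc i j h f g
  exact ⟨BinaryCofan.IsColimit.mk _ (fun f g => d _ f g) (fun f g => (hd _ f g).1)
    (fun f g => (hd _ f g).2) (fun f g m h1 h2 => hW.desc_unique i j h _ _
      (h1.trans (hd _ f g).1.symm) (h2.trans (hd _ f g).2.symm))⟩

lemma exists_over (A : B) : ∃ X : GPCat W, X.base = A := ⟨hW.obj A, rfl⟩

lemma exists_binaryCofan (X Y : GPCat W) : ∃ (Z : GPCat W) (i : X ⟶ Z) (j : Y ⟶ Z),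
    IsPhasedCoproduct (baseMap i) (baseMap j) := by
  obtain ⟨E, κ, κ', h⟩ := hW.cat.finite.exists_binary X.base Y.base
  obtain ⟨Z, rfl⟩ := hW.exists_over E
  obtain ⟨i, rfl⟩ := hW.exists_hom κ
  obtain ⟨j, rfl⟩ := hW.exists_hom κ'
  exact ⟨Z, i, j, h⟩

lemma hasBinaryCoproducts : HasBinaryCoproducts (GPCat W) :=
  have : ∀ {X Y : GPCat W}, HasColimit (pair X Y) := fun {X Y} => by
    obtain ⟨Z, i, j, h⟩ := hW.exists_binaryCofan X Y
    exact ⟨⟨_, (hW.nonempty_isColimit i j h).some⟩⟩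
  hasBinaryCoproducts_of_hasColimit_pair _

lemma exists_isInitial : ∃ Z : GPCat W, Nonempty (IsInitial Z) ∧ ∀ (T : B) (f g : Z.base ⟶ T),
    f = g := by
  obtain ⟨Z₀, h1, h2⟩ := hW.cat.finite.exists_initial
  obtain ⟨Z, rfl⟩ := hW.exists_over Z₀
  have key : ∀ (T : GPCat W) (f g : Z ⟶ T), f = g := by
    intro T f g
    -- Since the base is initial, `p ≫ Z.inr` is a phase and hence invertible. A morphism out of `Z`
    -- is thus determined by its composite with `Z.inr`, which is prescribed.
    obtain ⟨p, p1, p2⟩ := hW.exists_hom_desc (X := Z) (h1 (𝟙_ B)).some (𝟙 _)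
    have := hW.mono_inr Z
    have hp : IsIso (p ≫ Z.inr) := (hW.isPhasedCoproduct Z).isIso_phase
      ⟨h2 _ _ _, by rw [reassoc_of% p2]⟩
    apply hom_ext
    have e : (p ≫ Z.inr) ≫ f.hom = (p ≫ Z.inr) ≫ g.hom := by
      rw [Category.assoc, Category.assoc, inr_hom, inr_hom]
    exact (cancel_epi _).1 e
  refine ⟨Z, ⟨IsInitial.ofUniqueHom (fun T => (hW.exists_hom (h1 T.base).some).choose)
    (fun T f => key T _ _)⟩, h2⟩

lemma hasFiniteCoproducts : HasFiniteCoproducts (GPCat W) := by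
  have := hW.hasBinaryCoproducts
  obtain ⟨Z, ⟨hZ⟩, -⟩ := hW.exists_isInitial
  have := hZ.hasInitial
  exact hasFiniteCoproducts_of_has_binary_and_initial

lemma monoCoprod : MonoCoprod (GPCat W) := by
  refine MonoCoprod.mk' fun X Y => ?_
  obtain ⟨Z, i, j, h⟩ := hW.exists_binaryCofan X Y
  exact ⟨_, (hW.nonempty_isColimit i j h).some,
    mono_of_mono_hom i (hW.cat.monic _ _ (hW.isPhasedCoproduct_hom i j h)).1⟩

end Admissible

end GPCat

/-! ### Preservation of binary coproducts -/

section

variable {C : Type u} [Category.{v} C] {D : Type u'} [Category.{v'} D]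

lemma preservesColimitsOfShape_pair (F : C ⥤ D) (h : ∀ X Y : C, ∃ (Z : C) (i : X ⟶ Z) (j : Y ⟶ Z),
    Nonempty (IsColimit (BinaryCofan.mk i j)) ∧
    Nonempty (IsColimit (BinaryCofan.mk (F.map i) (F.map j)))) :
    PreservesColimitsOfShape (Discrete WalkingPair) F where
  preservesColimit {K} := by
    obtain ⟨Z, i, j, ⟨h1⟩, ⟨h2⟩⟩ := h (K.obj ⟨.left⟩) (K.obj ⟨.right⟩)
    have : PreservesColimit (pair (K.obj ⟨.left⟩) (K.obj ⟨.right⟩)) F :=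
      preservesColimit_of_preserves_colimit_cocone h1
        ((isColimitMapCoconeBinaryCofanEquiv F i j).symm h2)
    exact preservesColimit_of_iso_diagram F (diagramIsoPair K).symm

lemma nonempty_isColimit_map (F : C ⥤ D) [PreservesColimitsOfShape (Discrete WalkingPair) F]
    {X Y Z : C} {i : X ⟶ Z} {j : Y ⟶ Z} (h : Nonempty (IsColimit (BinaryCofan.mk i j))) :
    Nonempty (IsColimit (BinaryCofan.mk (F.map i) (F.map j))) :=
  h.map fun h => isColimitMapCoconeBinaryCofanEquiv F i j (isColimitOfPreserves F h)

end

/-! ### Scalar multiplication on the right -/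

section

variable {C : Type u} [Category.{v} C] [MonoidalCategory C]

lemma homSmul_eq {X Y : C} (f : X ⟶ Y) (s : 𝟙_ C ⟶ 𝟙_ C) :
    homSmul f s = homSmul (𝟙 X) s ≫ f := by
  simp only [homSmul, MonoidalCategory.tensorHom_def, id_whiskerRight, Category.id_comp,
    Category.assoc, ← rightUnitor_naturality, whisker_exchange_assoc]

lemma homSmul_eq' {X Y : C} (f : X ⟶ Y) (s : 𝟙_ C ⟶ 𝟙_ C) :
    homSmul f s = f ≫ homSmul (𝟙 Y) s := by
  simp only [homSmul, MonoidalCategory.tensorHom_def, id_whiskerRight, Category.id_comp,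
    Category.assoc, rightUnitor_inv_naturality_assoc]

lemma homSmul_id {X Y : C} (f : X ⟶ Y) : homSmul f (𝟙 (𝟙_ C)) = f := by
  simp [homSmul]

lemma smulHom_unit (s : 𝟙_ C ⟶ 𝟙_ C) : smulHom s (𝟙 (𝟙_ C)) = s := by
  simp [smulHom, unitors_equal, unitors_inv_equal]

lemma homSmul_unit (s : 𝟙_ C ⟶ 𝟙_ C) : homSmul (𝟙 (𝟙_ C)) s = s := by
  simp [homSmul, ← unitors_equal, ← unitors_inv_equal]

lemma isCentralScalar_of_id {s : 𝟙_ C ⟶ 𝟙_ C}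
    (h : ∀ X : C, smulHom s (𝟙 X) = homSmul (𝟙 X) s) : IsCentralScalar s := fun X Y f => by
  rw [smulHom_eq, homSmul_eq, h]

end

/-! ### Base maps for a given tensor structure, and distributivity -/

namespace GPCat

variable {B : Type u} [Category.{v} B] [MonoidalCategory B]
  {W : ∀ ⦃A E : B⦄, (A ⟶ E) → (𝟙_ B ⟶ E) → Prop}

namespace TensorStructure

variable [MonoidalCategory (GPCat W)] (τ : TensorStructure W)

/-- The identification of the base of a tensor product. -/
def baseIso (X Y : GPCat W) : (X ⊗ Y).base ≅ X.base ⊗ Y.base := eqToIso (τ.base_tensor X Y)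

/-- The identification of the base of the unit object. -/
def unitIso : (𝟙_ (GPCat W)).base ≅ 𝟙_ B := eqToIso τ.base_unit

lemma inl_c' (X Y : GPCat W) : (X ⊗ Y).inl ≫ τ.c X Y = (τ.baseIso X Y).hom ≫ (X.inl ⊗ₘ Y.inl) :=
  τ.inl_c X Y

lemma inl_c_assoc (X Y : GPCat W) {T : B} (f : X.tot ⊗ Y.tot ⟶ T) : (X ⊗ Y).inl ≫ τ.c X Y ≫ f =
    (τ.baseIso X Y).hom ≫ (X.inl ⊗ₘ Y.inl) ≫ f := by
  rw [← Category.assoc, inl_c', Category.assoc]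

lemma inr_c_assoc (X Y : GPCat W) {T : B} (f : X.tot ⊗ Y.tot ⟶ T) : (X ⊗ Y).inr ≫ τ.c X Y ≫ f =
    (ρ_ (𝟙_ B)).inv ≫ (X.inr ⊗ₘ Y.inr) ≫ f := by
  rw [← Category.assoc, inr_c, Category.assoc]

lemma whiskerLeft_c (X : GPCat W) {Y Y' : GPCat W} (f : Y ⟶ Y') :
    (X ◁ f).hom ≫ τ.c X Y' = τ.c X Y ≫ X.tot ◁ f.hom := by
  rw [← id_tensorHom, τ.tensorHom_c, id_hom, id_tensorHom]

lemma whiskerRight_c (X : GPCat W) {Y Y' : GPCat W} (f : Y ⟶ Y') :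
    (f ▷ X).hom ≫ τ.c Y' X = τ.c Y X ≫ f.hom ▷ X.tot := by
  rw [← tensorHom_id, τ.tensorHom_c, id_hom, tensorHom_id]

variable (hW : Admissible W)

include hW

lemma isPreCoprojection_c (X Y : GPCat W) : IsPreCoprojection (τ.c X Y) :=
  hW.isPreCoprojection_of_components (τ.baseIso X Y) _ (τ.inl_c' X Y) (τ.inr_c X Y)

lemma mono_c (X Y : GPCat W) : Mono (τ.c X Y) :=
  (τ.isPreCoprojection_c hW X Y).mono hW.cat.monic

lemma mono_whiskerLeft_c (F : B) (X Y : GPCat W) : Mono (F ◁ τ.c X Y) :=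
  ((τ.isPreCoprojection_c hW X Y).whiskerLeft hW.cat.distrib F).mono hW.cat.monic

omit [MonoidalCategory (GPCat W)] in
lemma mono_whiskerLeft_inl (F : B) (X : GPCat W) : Mono (F ◁ X.inl) :=
  (hW.cat.monic _ _ (hW.cat.distrib.whiskerLeft (hW.isPhasedCoproduct X) F)).1

omit [MonoidalCategory (GPCat W)] in
lemma mono_whiskerRight_inl (F : B) (X : GPCat W) : Mono (X.inl ▷ F) :=
  (hW.cat.monic _ _ (hW.cat.distrib.whiskerRight (hW.isPhasedCoproduct X) F)).1

omit [MonoidalCategory (GPCat W)] in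
lemma mono_inl_tensor_inl (X Y : GPCat W) : Mono (X.inl ⊗ₘ Y.inl) := by
  rw [MonoidalCategory.tensorHom_def]
  have := mono_whiskerRight_inl hW Y.base X
  have := mono_whiskerLeft_inl hW X.tot Y
  exact mono_comp _ _

omit [MonoidalCategory (GPCat W)] in
lemma mono_inl_tensor_inl_tensor_inl (X Y Z : GPCat W) : Mono (X.inl ⊗ₘ (Y.inl ⊗ₘ Z.inl)) := by
  rw [MonoidalCategory.tensorHom_def, MonoidalCategory.tensorHom_def Y.inl,
    MonoidalCategory.whiskerLeft_comp]
  have h1 := mono_whiskerRight_inl hW (Y.base ⊗ Z.base) X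
  have h2 := ((((hW.isPhasedCoproduct Y).isPreCoprojection).whiskerRight hW.cat.distrib
    Z.base).whiskerLeft hW.cat.distrib X.tot).mono hW.cat.monic
  have h3 := ((((hW.isPhasedCoproduct Z).isPreCoprojection).whiskerLeft hW.cat.distrib
    Y.tot).whiskerLeft hW.cat.distrib X.tot).mono hW.cat.monic
  exact mono_comp _ _

lemma hom_ext_c {X Y Z : GPCat W} {f g : X ⟶ Y ⊗ Z}
    (h : f.hom ≫ τ.c Y Z = g.hom ≫ τ.c Y Z) : f = g := by
  have := τ.mono_c hW Y Z
  exact hom_ext ((cancel_mono _).1 h)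

lemma baseMap_tensorHom {X Y X' Y' : GPCat W} (f : X ⟶ Y) (g : X' ⟶ Y') :
    baseMap (f ⊗ₘ g) ≫ (τ.baseIso Y Y').hom =
      (τ.baseIso X X').hom ≫ (baseMap f ⊗ₘ baseMap g) := by
  have := mono_inl_tensor_inl hW Y Y'
  rw [← cancel_mono (Y.inl ⊗ₘ Y'.inl), Category.assoc, ← inl_c', ← inl_hom_assoc, τ.tensorHom_c,
    inl_c_assoc, tensorHom_comp_tensorHom, inl_hom, inl_hom, Category.assoc,
    tensorHom_comp_tensorHom]

lemma baseMap_whiskerLeft (X : GPCat W) {Y Y' : GPCat W} (f : Y ⟶ Y') :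
    baseMap (X ◁ f) ≫ (τ.baseIso X Y').hom = (τ.baseIso X Y).hom ≫ X.base ◁ baseMap f := by
  rw [← id_tensorHom, baseMap_tensorHom τ hW, hW.baseMap_id, id_tensorHom]

lemma baseMap_whiskerRight (X : GPCat W) {Y Y' : GPCat W} (f : Y ⟶ Y') :
    baseMap (f ▷ X) ≫ (τ.baseIso Y' X).hom = (τ.baseIso Y X).hom ≫ baseMap f ▷ X.base := by
  rw [← tensorHom_id, baseMap_tensorHom τ hW, hW.baseMap_id, tensorHom_id]

lemma baseMap_associator (X Y Z : GPCat W) : baseMap (α_ X Y Z).hom ≫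
    (τ.baseIso X (Y ⊗ Z)).hom ≫ X.base ◁ (τ.baseIso Y Z).hom =
      (τ.baseIso (X ⊗ Y) Z).hom ≫ (τ.baseIso X Y).hom ▷ Z.base ≫
        (α_ X.base Y.base Z.base).hom := by
  have := mono_inl_tensor_inl_tensor_inl hW X Y Z
  have e := congrArg (((X ⊗ Y) ⊗ Z).inl ≫ ·) (τ.associator_c X Y Z)
  rw [inl_hom_assoc, inl_c_assoc, inl_c_assoc, tensorHom_comp_whiskerLeft',
    tensorHom_comp_whiskerRight_assoc', inl_c', inl_c', ← whiskerLeft_comp_tensorHom',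
    ← whiskerRight_comp_tensorHom_assoc', associator_naturality] at e
  rw [← cancel_mono (X.inl ⊗ₘ (Y.inl ⊗ₘ Z.inl))]
  simpa only [Category.assoc] using e

lemma baseMap_leftUnitor (X : GPCat W) : baseMap (λ_ X).hom =
    (τ.baseIso _ X).hom ≫ τ.unitIso.hom ▷ X.base ≫ (λ_ X.base).hom := by
  refine hW.baseMap_eq _ ((τ.inl_leftUnitor X).trans ?_)
  simp [baseIso, unitIso]

lemma baseMap_rightUnitor (X : GPCat W) : baseMap (ρ_ X).hom =
    (τ.baseIso X _).hom ≫ X.base ◁ τ.unitIso.hom ≫ (ρ_ X.base).hom := by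
  refine hW.baseMap_eq _ ((τ.inl_rightUnitor X).trans ?_)
  simp [baseIso, unitIso]

include τ

/-- By `nonempty_isColimit`, being a coproduct can be read off the base maps. The base of a tensored
cofan is, up to `baseIso`, the tensored cofan of the bases. -/
lemma distributiveCoproducts : DistributiveCoproducts (GPCat W) := by
  refine fun X => ⟨preservesColimitsOfShape_pair _ fun Y Z => ?_,
    preservesColimitsOfShape_pair _ fun Y Z => ?_⟩
  · obtain ⟨T, i, j, h⟩ := hW.exists_binaryCofan Y Z
    refine ⟨T, i, j, hW.nonempty_isColimit i j h, hW.nonempty_isColimit _ _ ?_⟩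
    have h1 := ((hW.cat.distrib.whiskerLeft h X.base).comp_iso (τ.baseIso X T).inv).iso_comp
      (τ.baseIso X Y).hom (τ.baseIso X Z).hom
    rwa [← reassoc_of% (τ.baseMap_whiskerLeft hW X i), ← reassoc_of% (τ.baseMap_whiskerLeft hW X j),
      Iso.hom_inv_id, Category.comp_id, Category.comp_id] at h1
  · obtain ⟨T, i, j, h⟩ := hW.exists_binaryCofan Y Z
    refine ⟨T, i, j, hW.nonempty_isColimit i j h, hW.nonempty_isColimit _ _ ?_⟩
    have h1 := ((hW.cat.distrib.whiskerRight h X.base).comp_iso (τ.baseIso T X).inv).iso_comp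
      (τ.baseIso Y X).hom (τ.baseIso Z X).hom
    rwa [← reassoc_of% (τ.baseMap_whiskerRight hW X i),
      ← reassoc_of% (τ.baseMap_whiskerRight hW X j),
      Iso.hom_inv_id, Category.comp_id, Category.comp_id] at h1

theorem coprodCat : CoprodCat (GPCat W) where
  finite := hW.hasFiniteCoproducts
  monic := hW.monoCoprod
  distrib := τ.distributiveCoproducts hW

/-! ### The scalars which are phases -/

lemma baseMap_tensorHom_congr {X Y X' Y' : GPCat W} {f f' : X ⟶ Y} {g g' : X' ⟶ Y'}
    (h : baseMap f = baseMap f') (h' : baseMap g = baseMap g') :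
    baseMap (f ⊗ₘ g) = baseMap (f' ⊗ₘ g') := by
  rw [← cancel_mono (τ.baseIso Y Y').hom, baseMap_tensorHom τ hW, baseMap_tensorHom τ hW, h, h']

/-- The base map of a tensor depends only on the base maps of its factors, so the scalar can be
replaced by the identity. -/
lemma baseMap_smulHom {p : 𝟙_ (GPCat W) ⟶ 𝟙_ (GPCat W)} (hp : baseMap p = 𝟙 _)
    {X Y : GPCat W} (f : X ⟶ Y) : baseMap (smulHom p f) = baseMap f := by
  conv_rhs => rw [← smulHom_id f]
  simp only [smulHom, hW.baseMap_comp]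
  rw [τ.baseMap_tensorHom_congr hW (hp.trans (hW.baseMap_id _).symm) rfl]

lemma baseMap_homSmul {p : 𝟙_ (GPCat W) ⟶ 𝟙_ (GPCat W)} (hp : baseMap p = 𝟙 _)
    {X Y : GPCat W} (f : X ⟶ Y) : baseMap (homSmul f p) = baseMap f := by
  conv_rhs => rw [← homSmul_id f]
  simp only [homSmul, hW.baseMap_comp]
  rw [τ.baseMap_tensorHom_congr hW rfl (hp.trans (hW.baseMap_id _).symm)]

/-- Move `u` to `𝟙_ ⊗ X` with the unitor, then along `c` by transitivity. Its target `(I ∔ I) ⊗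
X.tot` is a phased coproduct of two copies of `I ⊗ X.tot`, up to the unit object's base. By
distributivity each of its phases comes from a phase of `I ∔ I`, and that phase is the required
scalar. -/
lemma exists_smulHom {X : GPCat W} (u : X ⟶ X) (hu : baseMap u = 𝟙 _) :
    ∃ p : 𝟙_ (GPCat W) ⟶ 𝟙_ (GPCat W), baseMap p = 𝟙 _ ∧ u = smulHom p (𝟙 X) := by
  have hv : baseMap ((λ_ X).hom ≫ u ≫ (λ_ X).inv) = 𝟙 _ := by
    rw [hW.baseMap_comp, hW.baseMap_comp, hu, Category.id_comp, ← hW.baseMap_comp,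
      Iso.hom_inv_id, hW.baseMap_id]
  have h1 := hW.cat.distrib.whiskerRight (hW.isPhasedCoproduct (𝟙_ (GPCat W))) X.tot
  obtain ⟨V, hV, e⟩ := hW.cat.transitive _ _ _ _ (hW.isPhasedCoproduct (𝟙_ (GPCat W) ⊗ X)) h1
    (τ.c _ X) ⟨(τ.baseIso _ X).hom ≫ _ ◁ X.inl, by
      rw [inl_c', MonoidalCategory.tensorHom_def', Category.assoc]⟩
    ⟨(ρ_ _).inv ≫ _ ◁ X.inr, by
      rw [inr_c, MonoidalCategory.tensorHom_def', Category.assoc]⟩ _ (Admissible.isPhase_of_baseMap hv)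
  obtain ⟨V, hV', rfl⟩ := ((hW.cat.distrib X.tot).2 _ _
    (hW.isPhasedCoproduct (𝟙_ (GPCat W)))).2 V hV
  obtain ⟨p, rfl, hp⟩ := hW.exists_of_isPhase hV'
  refine ⟨p, hp, ?_⟩
  have h2 : (λ_ X).hom ≫ u ≫ (λ_ X).inv = p ⊗ₘ 𝟙 X := by
    apply τ.hom_ext_c hW
    rw [e, τ.tensorHom_c, id_hom, tensorHom_id]
    rfl
  rw [smulHom, ← h2]
  simp

/-- The two actions of `p` on an object differ by a phase, which is a scalar `q`. On the unit the
two actions agree, so `q` is trivial on any object admitting a suitable monomorphism from the unit.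
Every `X` embeds into such an object, namely one lying over `X.tot = X.base ∔ I`. -/
lemma smulHom_eq_homSmul {p : 𝟙_ (GPCat W) ⟶ 𝟙_ (GPCat W)} (hp : baseMap p = 𝟙 _)
    (X : GPCat W) : smulHom p (𝟙 X) = homSmul (𝟙 X) p := by
  obtain ⟨Z, hZ⟩ := hW.exists_over X.tot
  obtain ⟨i, hi⟩ := hW.exists_hom (X := X) (Y := Z) (X.inl ≫ eqToHom hZ.symm)
  obtain ⟨j, hj⟩ := hW.exists_hom (X := 𝟙_ (GPCat W)) (Y := Z)
    (τ.unitIso.hom ≫ X.inr ≫ eqToHom hZ.symm)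
  have h : IsPhasedCoproduct (baseMap i) (baseMap j) := by
    rw [hi, hj]
    simpa using ((hW.isPhasedCoproduct X).comp_iso (eqToHom hZ.symm)).iso_comp (𝟙 _) τ.unitIso.hom
  have mi : Mono i := Admissible.mono_of_mono_hom _ (hW.cat.monic _ _ (hW.isPhasedCoproduct_hom i j h)).1
  have mj : Mono j := Admissible.mono_of_mono_hom _ (hW.cat.monic _ _ (hW.isPhasedCoproduct_hom j i h.swap)).1
  have key : smulHom p (𝟙 Z) = homSmul (𝟙 Z) p := by
    have b1 : baseMap (smulHom p (𝟙 Z)) = 𝟙 _ := by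
      rw [τ.baseMap_smulHom hW hp, hW.baseMap_id]
    have b2 : baseMap (homSmul (𝟙 Z) p) = 𝟙 _ := by
      rw [τ.baseMap_homSmul hW hp, hW.baseMap_id]
    obtain ⟨u, hu, eu⟩ := hW.exists_phase (b1.trans b2.symm)
    obtain ⟨q, hq, rfl⟩ := τ.exists_smulHom hW u hu
    have : q ≫ p ≫ j = p ≫ j := by
      have e1 : j ≫ homSmul (𝟙 Z) p = p ≫ j := by
        rw [← homSmul_eq', homSmul_eq, homSmul_unit]
      have e2 : ∀ s, j ≫ smulHom s (𝟙 Z) = s ≫ j := fun s => by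
        rw [← smulHom_eq', smulHom_eq, smulHom_unit]
      rw [← e2, ← reassoc_of% (e2 q), ← eu, e1, e2]
    have hp' := hW.isIso_phase hp
    have hq1 : q = 𝟙 _ := by
      rw [← cancel_mono (p ≫ j), this, Category.id_comp]
    rw [eu, hq1, smulHom_id, Category.id_comp]
  rw [← cancel_mono i, ← smulHom_eq, smulHom_eq', key, ← homSmul_eq', homSmul_eq]

/-- The global phases of `GPCat W`. -/
def globalPhases : GlobalPhases (GPCat W) where
  carrier := phases W
  central _ hp := isCentralScalar_of_id fun X =>
    τ.smulHom_eq_homSmul hW (hW.baseMap_of_isPhase hp) X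

omit τ in
lemma mem_phases_iff (p : Aut (𝟙_ (GPCat W))) : p ∈ phases W ↔ baseMap p.hom = 𝟙 _ :=
  ⟨fun h => hW.baseMap_of_isPhase h, fun h => Admissible.isPhase_of_baseMap h⟩

/-- Equality of bases means equality up to a phase of the source, and by `exists_smulHom` such a
phase is a global one. -/
lemma rel_iff {Q : GlobalPhases (GPCat W)} (hQ : Q.carrier = phases W) {X Y : GPCat W}
    (f g : X ⟶ Y) : Q.rel f g ↔ baseMap f = baseMap g := by
  constructor
  · rintro ⟨p, hp, rfl⟩
    rw [hQ, mem_phases_iff hW] at hp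
    exact τ.baseMap_smulHom hW hp g
  · intro h
    obtain ⟨u, hu, rfl⟩ := hW.exists_phase h.symm
    obtain ⟨p, hp, rfl⟩ := τ.exists_smulHom hW u hu
    have := hW.isIso_phase hp
    exact ⟨asIso p, by rw [hQ]; exact (mem_phases_iff hW (asIso p)).2 hp, (smulHom_eq _ _).symm⟩

end TensorStructure

end GPCat

/-! ### Monoidal functors from tensorators -/

section

variable {C : Type u} [Category.{v} C] [MonoidalCategory C]

/-- Multiplication by `s` can be carried out before or after a morphism; here that morphism is
itself a scalar. -/
lemma scalar_comm (s t : 𝟙_ C ⟶ 𝟙_ C) : s ≫ t = t ≫ s := by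
  have h := (smulHom_eq s t).symm.trans (smulHom_eq' s t)
  rwa [smulHom_unit] at h

lemma tensor_scalar_leftUnitor (s : 𝟙_ C ⟶ 𝟙_ C) :
    𝟙_ C ◁ s ≫ s ▷ 𝟙_ C ≫ (λ_ (𝟙_ C)).hom = (λ_ (𝟙_ C)).hom ≫ s ≫ s := by
  rw [unitors_equal, rightUnitor_naturality, ← unitors_equal, leftUnitor_naturality_assoc]

end

section Tensorator

variable {C : Type u} [Category.{v} C] [MonoidalCategory C]
  {D : Type u'} [Category.{v'} D] [MonoidalCategory D]

/-- A tensorator for the functor `F`: the data of a monoidal functor without the unit. -/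
structure Tensorator (F : C ⥤ D) where
  iso : ∀ X Y : C, F.obj X ⊗ F.obj Y ≅ F.obj (X ⊗ Y)
  natural_left : ∀ {X Y : C} (f : X ⟶ Y) (Z : C),
    F.map f ▷ F.obj Z ≫ (iso Y Z).hom = (iso X Z).hom ≫ F.map (f ▷ Z)
  natural_right : ∀ {X Y : C} (Z : C) (f : X ⟶ Y),
    F.obj Z ◁ F.map f ≫ (iso Z Y).hom = (iso Z X).hom ≫ F.map (Z ◁ f)
  assoc : ∀ X Y Z : C, (iso X Y).hom ▷ F.obj Z ≫ (iso (X ⊗ Y) Z).hom ≫ F.map (α_ X Y Z).hom =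
    (α_ (F.obj X) (F.obj Y) (F.obj Z)).hom ≫ F.obj X ◁ (iso Y Z).hom ≫ (iso X (Y ⊗ Z)).hom

namespace Tensorator

variable {F : C ⥤ D} (T : Tensorator F)

/-- The action of `F 1` on the left. -/
def actLeft (X : C) : F.obj (𝟙_ C) ⊗ F.obj X ≅ F.obj X := T.iso _ _ ≪≫ F.mapIso (λ_ X)

/-- The action of `F 1` on the right. -/
def actRight (X : C) : F.obj X ⊗ F.obj (𝟙_ C) ≅ F.obj X := T.iso _ _ ≪≫ F.mapIso (ρ_ X)

lemma actLeft_unit : T.actLeft (𝟙_ C) = T.actRight (𝟙_ C) := by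
  simp only [actLeft, actRight]
  congr 2
  ext
  exact unitors_equal

lemma actLeft_actLeft (X : C) : F.obj (𝟙_ C) ◁ (T.actLeft X).hom ≫ (T.actLeft X).hom =
    (α_ _ _ _).inv ≫ (T.actLeft (𝟙_ C)).hom ▷ F.obj X ≫ (T.actLeft X).hom := by
  rw [Iso.eq_inv_comp]
  simp only [actLeft, Iso.trans_hom, Functor.mapIso_hom, MonoidalCategory.whiskerLeft_comp,
    comp_whiskerRight, Category.assoc]
  rw [reassoc_of% T.natural_right, reassoc_of% T.natural_left, ← reassoc_of% T.assoc,
    ← F.map_comp, ← F.map_comp, ← F.map_comp, triangle_assoc, unitors_equal]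

lemma actRight_actRight (X : C) : (T.actRight X).hom ▷ F.obj (𝟙_ C) ≫ (T.actRight X).hom =
    (α_ _ _ _).hom ≫ F.obj X ◁ (T.actRight (𝟙_ C)).hom ≫ (T.actRight X).hom := by
  simp only [actRight, Iso.trans_hom, Functor.mapIso_hom, MonoidalCategory.whiskerLeft_comp,
    comp_whiskerRight, Category.assoc]
  rw [reassoc_of% T.natural_right, reassoc_of% T.natural_left, ← reassoc_of% T.assoc,
    ← F.map_comp, ← F.map_comp, ← F.map_comp, ← unitors_equal, triangle_assoc]

/-- Read through `e`, the multiplication of `F.obj (𝟙_ C)` is an invertible scalar `s` of `D`.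
Dividing `e` by `s` normalizes it to a genuine unit. -/
lemma exists_unit (e : 𝟙_ D ≅ F.obj (𝟙_ C)) : ∃ ε : 𝟙_ D ≅ F.obj (𝟙_ C),
    𝟙_ D ◁ ε.hom ≫ ε.hom ▷ F.obj (𝟙_ C) ≫ (T.actLeft (𝟙_ C)).hom = (λ_ (𝟙_ D)).hom ≫ ε.hom := by
  let s : 𝟙_ D ≅ 𝟙_ D := (λ_ (𝟙_ D)).symm ≪≫ (e ⊗ᵢ e) ≪≫ T.actLeft (𝟙_ C) ≪≫ e.symm
  have hs : 𝟙_ D ◁ e.hom ≫ e.hom ▷ F.obj (𝟙_ C) ≫ (T.actLeft (𝟙_ C)).hom =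
      (λ_ (𝟙_ D)).hom ≫ s.hom ≫ e.hom := by
    simp [s, MonoidalCategory.tensorHom_def']
  refine ⟨s.symm ≪≫ e, ?_⟩
  simp only [Iso.trans_hom, Iso.symm_hom, MonoidalCategory.whiskerLeft_comp, comp_whiskerRight,
    Category.assoc]
  rw [whisker_exchange_assoc, hs, reassoc_of% (tensor_scalar_leftUnitor s.inv),
    Iso.inv_hom_id_assoc]

variable {ε : 𝟙_ D ≅ F.obj (𝟙_ C)} (hε : 𝟙_ D ◁ ε.hom ≫ ε.hom ▷ F.obj (𝟙_ C) ≫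
  (T.actLeft (𝟙_ C)).hom = (λ_ (𝟙_ D)).hom ≫ ε.hom)

include hε

/-- Let `l` be the composite on the left, which is invertible. Associativity of the action together
with `hε` gives `𝟙_ D ◁ l ≫ l = 𝟙_ D ◁ λ ≫ l`. Cancel `l`, then the whiskering by the unit. -/
lemma left_unitality (X : C) : ε.hom ▷ F.obj X ≫ (T.actLeft X).hom = (λ_ (F.obj X)).hom := by
  have h : 𝟙_ D ◁ (ε.hom ▷ F.obj X ≫ (T.actLeft X).hom) ≫
      (ε.hom ▷ F.obj X ≫ (T.actLeft X).hom) =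
      𝟙_ D ◁ (λ_ (F.obj X)).hom ≫ (ε.hom ▷ F.obj X ≫ (T.actLeft X).hom) := by
    rw [MonoidalCategory.whiskerLeft_comp, Category.assoc, whisker_exchange_assoc,
      T.actLeft_actLeft]
    have h1 := congrArg (fun k => (α_ _ _ _).inv ≫ k ▷ F.obj X ≫ (T.actLeft X).hom) hε
    simp only [comp_whiskerRight, Category.assoc] at h1
    have h2 : 𝟙_ D ◁ (λ_ (F.obj X)).hom = (α_ _ _ _).inv ≫ (λ_ (𝟙_ D)).hom ▷ F.obj X := by
      rw [unitors_equal, Iso.eq_inv_comp, MonoidalCategory.triangle]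
    rw [h2, Category.assoc, ← h1, associator_inv_naturality_left_assoc,
      associator_inv_naturality_middle_assoc]
  rw [cancel_mono] at h
  exact (whiskerLeft_iff _ _).1 h

lemma right_unitality (X : C) : F.obj X ◁ ε.hom ≫ (T.actRight X).hom = (ρ_ (F.obj X)).hom := by
  have h : (F.obj X ◁ ε.hom ≫ (T.actRight X).hom) ▷ 𝟙_ D ≫
      (F.obj X ◁ ε.hom ≫ (T.actRight X).hom) =
      (ρ_ (F.obj X)).hom ▷ 𝟙_ D ≫ (F.obj X ◁ ε.hom ≫ (T.actRight X).hom) := by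
    rw [comp_whiskerRight, Category.assoc, ← whisker_exchange_assoc,
      T.actRight_actRight]
    have h1 := congrArg (fun k => (α_ _ _ _).hom ≫ F.obj X ◁ k ≫ (T.actRight X).hom) hε
    simp only [MonoidalCategory.whiskerLeft_comp, Category.assoc] at h1
    have h2 : (ρ_ (F.obj X)).hom ▷ 𝟙_ D = (α_ _ _ _).hom ≫ F.obj X ◁ (λ_ (𝟙_ D)).hom := by
      rw [MonoidalCategory.triangle]
    rw [h2, Category.assoc, ← h1, ← T.actLeft_unit]
    rw [associator_naturality_right_assoc, associator_naturality_middle_assoc,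
      ← MonoidalCategory.whiskerLeft_comp_assoc, ← whisker_exchange,
      MonoidalCategory.whiskerLeft_comp_assoc]
  rw [cancel_mono] at h
  exact (whiskerRight_iff _ _).1 h

omit hε in
/-- A functor with a tensorator whose value at the unit is isomorphic to the unit is monoidal. -/
theorem exists_monoidal (e : 𝟙_ D ≅ F.obj (𝟙_ C)) :
    ∃ _ : F.Monoidal, ∀ X Y, Functor.Monoidal.μIso F X Y = T.iso X Y := by
  obtain ⟨ε, hε⟩ := T.exists_unit e
  let M : F.CoreMonoidal :=
    { εIso := ε
      μIso := T.iso
      μIso_hom_natural_left := T.natural_left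
      μIso_hom_natural_right := T.natural_right
      associativity := T.assoc
      left_unitality := fun X => (T.left_unitality hε X).symm
      right_unitality := fun X => (T.right_unitality hε X).symm }
  exact ⟨M.toMonoidal, fun X Y => by ext; rfl⟩

end Tensorator

end Tensorator

/-! ### Inverses and composites of equivalences -/

section Inverse

variable {C : Type u} [Category.{v} C] {D : Type u'} [Category.{v'} D]

section

variable (F : C ⥤ D) [F.Full] [F.Faithful] (g : D → C) (e : ∀ Y, F.obj (g Y) ≅ Y)

/-- The inverse of a fully faithful functor, for a choice of preimages. -/
noncomputable def inverseOfIso : D ⥤ C where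
  obj := g
  map {X Y} f := F.preimage ((e X).hom ≫ f ≫ (e Y).inv)
  map_id X := F.map_injective (by simp)
  map_comp f g := F.map_injective (by simp)

/-- The isomorphisms exhibiting `inverseOfIso` as a right inverse. -/
noncomputable def inverseCounit (X : D) : F.obj ((inverseOfIso F g e).obj X) ≅ X := e X

@[simp]
lemma map_inverseOfIso {X Y : D} (f : X ⟶ Y) : F.map ((inverseOfIso F g e).map f) =
    (inverseCounit F g e X).hom ≫ f ≫ (inverseCounit F g e Y).inv := F.map_preimage _

instance : (inverseOfIso F g e).Faithful where
  map_injective {X Y f f'} h := by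
    have := congrArg F.map h
    simpa using this

instance : (inverseOfIso F g e).Full where
  map_surjective {X Y} f := ⟨(inverseCounit F g e X).inv ≫ F.map f ≫ (inverseCounit F g e Y).hom,
    F.map_injective (by rw [map_inverseOfIso]; simp)⟩

lemma exists_inverseOfIso_iso (X : C) : ∃ k : (inverseOfIso F g e).obj (F.obj X) ≅ X,
    F.map k.hom = (inverseCounit F g e (F.obj X)).hom :=
  ⟨F.preimageIso (inverseCounit F g e (F.obj X)), F.map_preimage _⟩

instance : (inverseOfIso F g e).EssSurj where
  mem_essImage X := ⟨F.obj X, ⟨(exists_inverseOfIso_iso F g e X).choose⟩⟩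

end

variable [MonoidalCategory C] [MonoidalCategory D] (F : C ⥤ D) [F.Full] [F.Faithful]
  (g : D → C) (e : ∀ Y, F.obj (g Y) ≅ Y) [F.Monoidal]

open Functor.Monoidal Functor.LaxMonoidal Functor.OplaxMonoidal

/-- The tensorator of `inverseOfIso`. -/
noncomputable def inverseμ (X Y : D) : (inverseOfIso F g e).obj X ⊗ (inverseOfIso F g e).obj Y ≅
    (inverseOfIso F g e).obj (X ⊗ Y) :=
  F.preimageIso ((μIso F _ _).symm ≪≫ (inverseCounit F g e X ⊗ᵢ inverseCounit F g e Y) ≪≫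
    (inverseCounit F g e (X ⊗ Y)).symm)

lemma map_inverseμ (X Y : D) : F.map (inverseμ F g e X Y).hom =
    δ F _ _ ≫ ((inverseCounit F g e X).hom ⊗ₘ (inverseCounit F g e Y).hom) ≫
      (inverseCounit F g e (X ⊗ Y)).inv := F.map_preimage _

/-- The inverse of a monoidal functor has a tensorator. -/
noncomputable def inverseTensorator : Tensorator (inverseOfIso F g e) where
  iso := inverseμ F g e
  natural_left f Z := F.map_injective (by
    simp [map_inverseμ, map_whiskerRight, MonoidalCategory.tensorHom_def, whisker_exchange_assoc])
  natural_right Z f := F.map_injective (by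
    simp [map_inverseμ, map_whiskerLeft, MonoidalCategory.tensorHom_def', whisker_exchange_assoc])
  assoc X Y Z := F.map_injective (by
    have e1 := associator_naturality (inverseCounit F g e X).hom (inverseCounit F g e Y).hom
      (inverseCounit F g e Z).hom
    have e2 : ((inverseCounit F g e X).hom ⊗ₘ (inverseCounit F g e Y).hom) ▷ F.obj _ ≫
        (𝟙 _ ⊗ₘ (inverseCounit F g e Z).hom) =
        (((inverseCounit F g e X).hom ⊗ₘ (inverseCounit F g e Y).hom) ⊗ₘ
          (inverseCounit F g e Z).hom) := by
      rw [← tensorHom_id, tensorHom_comp_tensorHom, Category.comp_id, Category.id_comp]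
    have e3 : F.obj _ ◁ ((inverseCounit F g e Y).hom ⊗ₘ (inverseCounit F g e Z).hom) ≫
        ((inverseCounit F g e X).hom ⊗ₘ 𝟙 _) =
        ((inverseCounit F g e X).hom ⊗ₘ (inverseCounit F g e Y).hom ⊗ₘ
          (inverseCounit F g e Z).hom) := by
      rw [whiskerLeft_comp_tensorHom', Category.comp_id]
    have e4 := Functor.OplaxMonoidal.associativity F ((inverseOfIso F g e).obj X)
      ((inverseOfIso F g e).obj Y) ((inverseOfIso F g e).obj Z)
    simp only [map_inverseμ, map_whiskerLeft, map_whiskerRight, Functor.map_comp, Category.assoc,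
      map_inverseOfIso, MonoidalCategory.whiskerLeft_comp, comp_whiskerRight, μ_δ_assoc,
      Iso.inv_hom_id_assoc]
    rw [whiskerRight_comp_tensorHom_assoc', Iso.inv_hom_id, reassoc_of% e2, reassoc_of% e1,
      reassoc_of% e4, ← e3]
    simp only [Category.assoc]
    rw [← Iso.inv_hom_id (inverseCounit F g e (Y ⊗ Z)), ← whiskerLeft_comp_tensorHom',
      Category.assoc])

end Inverse

open Functor.Monoidal Functor.LaxMonoidal Functor.OplaxMonoidal

universe v'' u''

/-! ### Unitary isomorphisms -/

section Unitary

variable {C : Type u} [Category.{v} C] [Dagger C]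

lemma isUnitary_iff {X Y : C} (e : X ≅ Y) : IsUnitary e ↔ e.hom ≫ dag e.hom = 𝟙 X := by
  constructor
  · intro h
    rw [IsUnitary] at h
    rw [h, Iso.hom_inv_id]
  · intro h
    rw [IsUnitary, ← Iso.inv_hom_id_assoc e (dag e.hom), h, Category.comp_id]

lemma isUnitary_refl (X : C) : IsUnitary (Iso.refl X) := Dagger.dag_id X

lemma IsUnitary.dag_inv {X Y : C} {e : X ≅ Y} (h : IsUnitary e) : dag e.inv = e.hom := by
  rw [IsUnitary] at h
  rw [← h, Dagger.dag_dag]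

lemma IsUnitary.symm {X Y : C} {e : X ≅ Y} (h : IsUnitary e) : IsUnitary e.symm := h.dag_inv

lemma IsUnitary.trans {X Y Z : C} {e : X ≅ Y} {e' : Y ≅ Z} (h : IsUnitary e)
    (h' : IsUnitary e') : IsUnitary (e ≪≫ e') := by
  rw [IsUnitary] at *
  rw [Iso.trans_hom, Dagger.dag_comp, h, h', Iso.trans_inv]

lemma isUnitary_eqToIso {X Y : C} (h : X = Y) : IsUnitary (eqToIso h) := by
  subst h
  exact isUnitary_refl X

lemma IsUnitary.tensor [MonoidalCategory C] [DaggerMonoidal C] {X Y X' Y' : C} {e : X ≅ Y}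
    {e' : X' ≅ Y'} (h : IsUnitary e) (h' : IsUnitary e') : IsUnitary (e ⊗ᵢ e') := by
  rw [IsUnitary] at *
  rw [tensorIso_hom, DaggerMonoidal.dag_tensor, h, h', tensorIso_inv]

lemma dag_whiskerRight [MonoidalCategory C] [DaggerMonoidal C] (X : C) {Y Z : C} (f : Y ⟶ Z) :
    dag (f ▷ X) = dag f ▷ X := by
  rw [← tensorHom_id, DaggerMonoidal.dag_tensor, Dagger.dag_id, tensorHom_id]

variable {D : Type u'} [Category.{v'} D] [Dagger D]

lemma IsUnitary.map {F : C ⥤ D} (hF : ∀ {X Y : C} (f : X ⟶ Y), F.map (dag f) = dag (F.map f))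
    {X Y : C} {e : X ≅ Y} (h : IsUnitary e) : IsUnitary (F.mapIso e) := by
  rw [IsUnitary] at *
  rw [Functor.mapIso_hom, ← hF, h, Functor.mapIso_inv]

lemma isUnitary_of_map {F : C ⥤ D} [F.Faithful]
    (hF : ∀ {X Y : C} (f : X ⟶ Y), F.map (dag f) = dag (F.map f))
    {X Y : C} {e : X ≅ Y} (h : F.map e.hom ≫ dag (F.map e.hom) = 𝟙 _) : IsUnitary e := by
  rw [isUnitary_iff]
  exact F.map_injective (by rw [Functor.map_comp, hF, h, CategoryTheory.Functor.map_id])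

variable [MonoidalCategory C] [DaggerMonoidal C] [MonoidalCategory D] [DaggerMonoidal D]

/-- The unit of a monoidal dagger functor with unitary tensorator is unitary. -/
lemma isUnitary_εIso (F : C ⥤ D) [F.Monoidal]
    (hF : ∀ {X Y : C} (f : X ⟶ Y), F.map (dag f) = dag (F.map f))
    (hμ : ∀ X Y, IsUnitary (μIso F X Y)) : IsUnitary (εIso F) := by
  -- By left unitality `ε F ▷ F.obj (𝟙_ C)` is this composite of unitaries. Interchange with the
  -- invertible `𝟙_ D ◁ ε F` then replaces the second factor by the unit, which can be removed.
  let e : 𝟙_ D ⊗ F.obj (𝟙_ C) ≅ F.obj (𝟙_ C) ⊗ F.obj (𝟙_ C) :=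
    λ_ _ ≪≫ (F.mapIso (λ_ (𝟙_ C))).symm ≪≫ (μIso F _ _).symm
  have he : IsUnitary e := (DaggerMonoidal.leftUnitor_unitary _).trans
    (((DaggerMonoidal.leftUnitor_unitary _).map hF).symm.trans (hμ _ _).symm)
  have h1 : ε F ▷ F.obj (𝟙_ C) = e.hom := by
    simp [e]
  rw [isUnitary_iff, ← h1, dag_whiskerRight, ← comp_whiskerRight] at he
  have h2 : (ε F ≫ dag (ε F)) ▷ 𝟙_ D = 𝟙 _ ▷ 𝟙_ D := by
    rw [← cancel_mono (𝟙_ D ◁ ε F), ← whisker_exchange, he, id_whiskerRight, Category.comp_id,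
      Category.id_comp]
  rw [isUnitary_iff]
  exact (whiskerRight_iff _ _).1 h2

end Unitary

/-! ### Inverses and composites of equivalences -/

section Equivalences

variable {C : Type u} [Category.{v} C] [MonoidalCategory C]
  {D : Type u'} [Category.{v'} D] [MonoidalCategory D]
  {E : Type u''} [Category.{v''} E] [MonoidalCategory E]

omit [MonoidalCategory C] [MonoidalCategory D] in
lemma isEquivalence_of (F : C ⥤ D) (h1 : F.Full) (h2 : F.Faithful) (h3 : F.EssSurj) :
    F.IsEquivalence := { faithful := h2, full := h1, essSurj := h3 }

/-- The scalar of `D` induced by a scalar of `C`. -/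
def mapScalar (F : C ⥤ D) [F.Monoidal] (s : 𝟙_ C ⟶ 𝟙_ C) : 𝟙_ D ⟶ 𝟙_ D := ε F ≫ F.map s ≫ η F

lemma map_smulHom (F : C ⥤ D) [F.Monoidal] (s : 𝟙_ C ⟶ 𝟙_ C) {X Y : C} (f : X ⟶ Y) :
    F.map (smulHom s f) = smulHom (mapScalar F s) (F.map f) := by
  rw [smulHom_eq, smulHom_eq (mapScalar F s), Functor.map_comp]
  congr 1
  simp only [smulHom, mapScalar, tensorHom_id, Functor.map_comp, map_leftUnitor_inv,
    map_leftUnitor, map_whiskerRight, Category.assoc, μ_δ_assoc, comp_whiskerRight]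

/-- Two isomorphisms from the unit to `F.obj (𝟙_ C)` differ by a scalar, and scalars commute, so
conjugation does not see the difference. Hence the unit isomorphism produced by `exists_monoidal`
need not be known. -/
lemma matchesPhases_iff (F : C ⥤ D) [F.Monoidal] (P : GlobalPhases C) (Q : GlobalPhases D)
    (e : 𝟙_ D ≅ F.obj (𝟙_ C)) : MatchesPhases F P Q ↔
      ∀ s : 𝟙_ C ≅ 𝟙_ C, s ∈ P.carrier ↔ (e ≪≫ F.mapIso s ≪≫ e.symm) ∈ Q.carrier := by
  have key : ∀ s : 𝟙_ C ≅ 𝟙_ C,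
      e ≪≫ F.mapIso s ≪≫ e.symm = εIso F ≪≫ F.mapIso s ≪≫ (εIso F).symm := by
    intro s
    ext
    have := scalar_comm (e.hom ≫ F.map s.hom ≫ e.inv) (e.hom ≫ (εIso F).inv)
    simp only [Category.assoc, Iso.inv_hom_id_assoc] at this
    simp only [Iso.trans_hom, Functor.mapIso_hom, Iso.symm_hom]
    rw [← cancel_mono (e.hom ≫ (εIso F).inv)]
    simp only [Category.assoc, Iso.inv_hom_id_assoc]
    have h2 := scalar_comm ((εIso F).hom ≫ F.map s.hom ≫ (εIso F).inv) (e.hom ≫ (εIso F).inv)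
    simp only [Category.assoc, Iso.inv_hom_id_assoc] at h2
    rw [h2]
  simp only [MatchesPhases, key]

section

variable (F : C ⥤ D) [F.Full] [F.Faithful] (g : D → C) (e : ∀ Y, F.obj (g Y) ≅ Y) [F.Monoidal]

lemma exists_inverse_unit : Nonempty (𝟙_ C ≅ (inverseOfIso F g e).obj (𝟙_ D)) :=
  ⟨F.preimageIso ((εIso F).symm ≪≫ (inverseCounit F g e (𝟙_ D)).symm)⟩

/-- Conjugating `t` through both functors gives `t` up to conjugation by a scalar, that is, `t`
itself. -/
lemma matchesPhases_inverse [(inverseOfIso F g e).Monoidal] {P : GlobalPhases C}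
    {Q : GlobalPhases D} (h : MatchesPhases F P Q) : MatchesPhases (inverseOfIso F g e) Q P := by
  intro t
  rw [h]
  have key : εIso F ≪≫ F.mapIso (εIso (inverseOfIso F g e) ≪≫ (inverseOfIso F g e).mapIso t ≪≫
      (εIso (inverseOfIso F g e)).symm) ≪≫ (εIso F).symm = t := by
    ext
    have := scalar_comm ((εIso F).hom ≫ F.map (εIso (inverseOfIso F g e)).hom ≫
      (inverseCounit F g e _).hom) t.hom
    rw [← cancel_mono ((εIso F).hom ≫ F.map (εIso (inverseOfIso F g e)).hom ≫
      (inverseCounit F g e _).hom), ← this]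
    simp only [Iso.trans_hom, Functor.mapIso_hom, Functor.map_comp, map_inverseOfIso,
      Category.assoc, Iso.symm_hom, Iso.inv_hom_id_assoc]
    rw [← F.map_comp_assoc, Iso.inv_hom_id, F.map_id, Category.id_comp, Iso.inv_hom_id,
      Category.comp_id]
  rw [key]

lemma isDaggerMonoidalEquivalence_inverse [Dagger C] [Dagger D] [DaggerMonoidal C]
    [DaggerMonoidal D] (hF : IsDaggerMonoidalEquivalence F) (he : ∀ Y, IsUnitary (e Y))
    [(inverseOfIso F g e).Monoidal]
    (hμ : ∀ X Y, μIso (inverseOfIso F g e) X Y = inverseμ F g e X Y) :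
    IsDaggerMonoidalEquivalence (inverseOfIso F g e) := by
  have he' : ∀ Y, IsUnitary (inverseCounit F g e Y) := he
  have h1 : ∀ {X Y : D} (f : X ⟶ Y), (inverseOfIso F g e).map (dag f) =
      dag ((inverseOfIso F g e).map f) := fun f => F.map_injective (by
    rw [hF.map_dag, map_inverseOfIso, map_inverseOfIso, Dagger.dag_comp, Dagger.dag_comp,
      (he' _).dag_inv, he' _, Category.assoc])
  have h2 : ∀ X Y, IsUnitary (μIso (inverseOfIso F g e) X Y) := fun X Y => by
    rw [hμ]
    refine isUnitary_of_map hF.map_dag ?_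
    have := (((hF.μ_unitary _ _).symm).trans (((he' X).tensor (he' Y)).trans (he' (X ⊗ Y)).symm))
    rw [isUnitary_iff] at this
    rw [map_inverseμ]
    exact this
  exact
    { map_dag := h1
      μ_unitary := h2
      ε_unitary := isUnitary_εIso _ h1 h2
      full := inferInstance
      faithful := inferInstance
      unitarily_surj := fun X => by
        obtain ⟨k, hk⟩ := exists_inverseOfIso_iso F g e X
        refine ⟨F.obj X, k, isUnitary_of_map hF.map_dag ?_⟩
        rw [hk]
        exact (isUnitary_iff _).1 (he' _) }

end

theorem MonEquiv.symm (h : MonEquiv C D) : MonEquiv D C := by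
  obtain ⟨F, _, _⟩ := h
  obtain ⟨e₀⟩ := exists_inverse_unit F F.objPreimage F.objObjPreimageIso
  obtain ⟨M, -⟩ := (inverseTensorator F F.objPreimage F.objObjPreimageIso).exists_monoidal e₀
  exact ⟨_, M, isEquivalence_of _ inferInstance inferInstance inferInstance⟩

theorem PhaseMonEquiv.symm {P : GlobalPhases C} {Q : GlobalPhases D} (h : PhaseMonEquiv P Q) :
    PhaseMonEquiv Q P := by
  obtain ⟨F, _, _, hF⟩ := h
  obtain ⟨e₀⟩ := exists_inverse_unit F F.objPreimage F.objObjPreimageIso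
  obtain ⟨M, -⟩ := (inverseTensorator F F.objPreimage F.objObjPreimageIso).exists_monoidal e₀
  exact ⟨_, M, isEquivalence_of _ inferInstance inferInstance inferInstance,
    matchesPhases_inverse F _ _ hF⟩

theorem MonEquiv.trans (h : MonEquiv C D) (h' : MonEquiv D E) : MonEquiv C E := by
  obtain ⟨F, _, _⟩ := h
  obtain ⟨G, _, _⟩ := h'
  exact ⟨F ⋙ G, inferInstance, inferInstance⟩

lemma MatchesPhases.comp {F : C ⥤ D} [F.Monoidal] {G : D ⥤ E} [G.Monoidal] {P : GlobalPhases C}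
    {Q : GlobalPhases D} {R : GlobalPhases E} (h : MatchesPhases F P Q)
    (h' : MatchesPhases G Q R) : MatchesPhases (F ⋙ G) P R := by
  intro s
  rw [h, h']
  have key : εIso G ≪≫ G.mapIso (εIso F ≪≫ F.mapIso s ≪≫ (εIso F).symm) ≪≫ (εIso G).symm =
      εIso (F ⋙ G) ≪≫ (F ⋙ G).mapIso s ≪≫ (εIso (F ⋙ G)).symm := by
    ext
    simp
  rw [key]

theorem PhaseMonEquiv.trans {P : GlobalPhases C} {Q : GlobalPhases D} {R : GlobalPhases E}
    (h : PhaseMonEquiv P Q) (h' : PhaseMonEquiv Q R) : PhaseMonEquiv P R := by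
  obtain ⟨F, _, _, hF⟩ := h
  obtain ⟨G, _, _, hG⟩ := h'
  exact ⟨F ⋙ G, inferInstance, inferInstance, hF.comp hG⟩

variable [Dagger C] [DaggerMonoidal C] [Dagger D] [DaggerMonoidal D] [Dagger E] [DaggerMonoidal E]

theorem DaggerMonEquiv.symm (h : DaggerMonEquiv C D) : DaggerMonEquiv D C := by
  obtain ⟨F, _, hF⟩ := h
  have := hF.full
  have := hF.faithful
  choose g e he using hF.unitarily_surj
  obtain ⟨e₀⟩ := exists_inverse_unit F g e
  obtain ⟨M, hM⟩ := (inverseTensorator F g e).exists_monoidal e₀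
  exact ⟨_, M, isDaggerMonoidalEquivalence_inverse F g e hF he hM⟩

theorem PhaseDaggerMonEquiv.symm {P : GlobalPhases C} {Q : GlobalPhases D}
    (h : PhaseDaggerMonEquiv P Q) : PhaseDaggerMonEquiv Q P := by
  obtain ⟨F, _, hF, hP⟩ := h
  have := hF.full
  have := hF.faithful
  choose g e he using hF.unitarily_surj
  obtain ⟨e₀⟩ := exists_inverse_unit F g e
  obtain ⟨M, hM⟩ := (inverseTensorator F g e).exists_monoidal e₀
  exact ⟨_, M, isDaggerMonoidalEquivalence_inverse F g e hF he hM,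
    matchesPhases_inverse F _ _ hP⟩

omit [DaggerMonoidal D] in
lemma IsDaggerMonoidalEquivalence.comp {F : C ⥤ D} [F.Monoidal] {G : D ⥤ E} [G.Monoidal]
    (h : IsDaggerMonoidalEquivalence F) (h' : IsDaggerMonoidalEquivalence G) :
    IsDaggerMonoidalEquivalence (F ⋙ G) := by
  have := h.full
  have := h.faithful
  have := h'.full
  have := h'.faithful
  have h1 : ∀ {X Y : C} (f : X ⟶ Y), (F ⋙ G).map (dag f) = dag ((F ⋙ G).map f) := fun f => by
    rw [Functor.comp_map, Functor.comp_map, h.map_dag, h'.map_dag]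
  have h2 : ∀ X Y, IsUnitary (μIso (F ⋙ G) X Y) := fun X Y => by
    have := (h'.μ_unitary (F.obj X) (F.obj Y)).trans ((h.μ_unitary X Y).map h'.map_dag)
    rw [isUnitary_iff] at this ⊢
    exact this
  exact
    { map_dag := h1
      μ_unitary := h2
      ε_unitary := isUnitary_εIso _ h1 h2
      full := inferInstance
      faithful := inferInstance
      unitarily_surj := fun Y => by
        obtain ⟨X, e, he⟩ := h'.unitarily_surj Y
        obtain ⟨Z, e', he'⟩ := h.unitarily_surj X
        exact ⟨Z, G.mapIso e' ≪≫ e, (he'.map h'.map_dag).trans he⟩ }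

omit [DaggerMonoidal D] in
theorem DaggerMonEquiv.trans (h : DaggerMonEquiv C D) (h' : DaggerMonEquiv D E) :
    DaggerMonEquiv C E := by
  obtain ⟨F, _, hF⟩ := h
  obtain ⟨G, _, hG⟩ := h'
  exact ⟨F ⋙ G, inferInstance, hF.comp hG⟩

omit [DaggerMonoidal D] in
theorem PhaseDaggerMonEquiv.trans {P : GlobalPhases C} {Q : GlobalPhases D} {R : GlobalPhases E}
    (h : PhaseDaggerMonEquiv P Q) (h' : PhaseDaggerMonEquiv Q R) : PhaseDaggerMonEquiv P R := by
  obtain ⟨F, _, hF, hP⟩ := h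
  obtain ⟨G, _, hG, hQ⟩ := h'
  exact ⟨F ⋙ G, inferInstance, hF.comp hG, hP.comp hQ⟩

end Equivalences

/-! ### The equivalence between `GP(B)/P` and `B` -/

namespace GPCat

variable {B : Type u} [Category.{v} B] [MonoidalCategory B]
  {W : ∀ ⦃A E : B⦄, (A ⟶ E) → (𝟙_ B ⟶ E) → Prop}

/-- The functor sending `A ∔ I` to `A`. -/
noncomputable def Admissible.baseFunctor (hW : Admissible W) : GPCat W ⥤ B where
  obj X := X.base
  map f := baseMap f
  map_id X := hW.baseMap_id X
  map_comp f g := hW.baseMap_comp f g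

namespace TensorStructure

variable [MonoidalCategory (GPCat W)] (τ : TensorStructure W) (hW : Admissible W)
  {Q : GlobalPhases (GPCat W)} (hQ : Q.carrier = phases W)

/-- The functor induced on the quotient by the global phases. -/
noncomputable def quotientBase : Q.Quotient ⥤ B :=
  CategoryTheory.Quotient.lift Q.rel hW.baseFunctor fun _ _ f g h => (τ.rel_iff hW hQ f g).1 h

instance : (τ.quotientBase hW hQ).Full where
  map_surjective {X Y} g := by
    obtain ⟨f, hf⟩ := hW.exists_hom (X := X.as) (Y := Y.as) g
    exact ⟨Q.proj.map f, hf⟩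

instance : (τ.quotientBase hW hQ).Faithful where
  map_injective {X Y} := by
    rintro ⟨f⟩ ⟨g⟩ h
    exact CategoryTheory.Quotient.sound _ ((τ.rel_iff hW hQ f g).2 h)

instance : (τ.quotientBase hW hQ).EssSurj where
  mem_essImage A := by
    obtain ⟨X, rfl⟩ := hW.exists_over A
    exact ⟨Q.proj.obj X, ⟨Iso.refl _⟩⟩

/-- The tensorator of the base functor. -/
noncomputable def quotientBaseTensorator : Tensorator (τ.quotientBase hW hQ) where
  iso X Y := (τ.baseIso X.as Y.as).symm
  natural_left := by
    rintro X Y ⟨f⟩ Z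
    have e := τ.baseMap_whiskerRight hW Z.as f
    rw [← Iso.eq_comp_inv, Category.assoc, ← Iso.inv_comp_eq] at e
    exact e.symm
  natural_right := by
    rintro X Y Z ⟨f⟩
    have e := τ.baseMap_whiskerLeft hW Z.as f
    rw [← Iso.eq_comp_inv, Category.assoc, ← Iso.inv_comp_eq] at e
    exact e.symm
  assoc X Y Z := by
    change (τ.baseIso X.as Y.as).inv ▷ Z.as.base ≫ (τ.baseIso (X.as ⊗ Y.as) Z.as).inv ≫
      baseMap (α_ X.as Y.as Z.as).hom = (α_ X.as.base Y.as.base Z.as.base).hom ≫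
      X.as.base ◁ (τ.baseIso Y.as Z.as).inv ≫ (τ.baseIso X.as (Y.as ⊗ Z.as)).inv
    have e := τ.baseMap_associator hW X.as Y.as Z.as
    rw [← cancel_mono ((τ.baseIso X.as (Y.as ⊗ Z.as)).hom ≫ X.as.base ◁ (τ.baseIso Y.as Z.as).hom)]
    simp only [Category.assoc]
    rw [e]
    simp

include τ hW hQ

theorem monEquiv_quotient : MonEquiv B Q.Quotient := by
  obtain ⟨M, -⟩ := (τ.quotientBaseTensorator hW hQ).exists_monoidal τ.unitIso.symm
  exact MonEquiv.symm ⟨_, M, isEquivalence_of _ inferInstance inferInstance inferInstance⟩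

end TensorStructure

theorem daggerMonEquiv_quotient [Dagger B] [DaggerMonoidal B] [MonoidalCategory (GPDag B)]
    [DaggerMonoidal (GPDag B)] (τ : GPDagTensor B)
    (hW : Admissible (B := B) fun _ _ inl inr => IsPhasedDaggerBiproduct inl inr)
    {Q : GlobalPhases (GPDag B)} [Q.AllUnitary] (hQ : Q.carrier = phases _)
    [DaggerMonoidal Q.Quotient] : DaggerMonEquiv B Q.Quotient := by
  obtain ⟨M, hM⟩ := (τ.quotientBaseTensorator hW hQ).exists_monoidal τ.unitIso.symm
  have h1 : ∀ {X Y : Q.Quotient} (f : X ⟶ Y), (τ.quotientBase hW hQ).map (dag f) =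
      dag ((τ.quotientBase hW hQ).map f) := by
    rintro ⟨X⟩ ⟨Y⟩ ⟨f⟩
    exact hW.baseMap_eq (dag (C := GPDag B) f)
      (X.prop.dag_diag Y.prop f.hom (baseMap f) (inl_hom f) (inr_hom f)).1
  have h2 : ∀ X Y, IsUnitary (Functor.Monoidal.μIso (τ.quotientBase hW hQ) X Y) := fun X Y => by
    rw [hM]
    exact (isUnitary_eqToIso (τ.base_tensor X.as Y.as)).symm
  refine DaggerMonEquiv.symm ⟨_, M,
    { map_dag := h1
      μ_unitary := h2
      ε_unitary := isUnitary_εIso _ h1 h2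
      full := inferInstance
      faithful := inferInstance
      unitarily_surj := fun A => ?_ }⟩
  obtain ⟨X, rfl⟩ := hW.exists_over A
  exact ⟨Q.proj.obj X, Iso.refl _, isUnitary_refl _⟩

end GPCat

section QuotientFunctor

open Functor.Monoidal Functor.LaxMonoidal Functor.OplaxMonoidal

variable {C : Type u} [Category.{v} C] [MonoidalCategory C]
  {D : Type u'} [Category.{v'} D] [MonoidalCategory D]

/-! ### Functoriality of the quotient `A/P` -/

namespace GlobalPhases

variable {P : GlobalPhases C} {P' : GlobalPhases D}

lemma proj_map_eq_iff {X Y : C} {f g : X ⟶ Y} : P.proj.map f = P.proj.map g ↔ P.rel f g :=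
  CategoryTheory.Quotient.functor_map_eq_iff _ _ _

/-- Fullness pulls a global phase of `D` back to a scalar of `C`, which belongs to `P` by `hF`. -/
lemma rel_map_iff (F : C ⥤ D) [F.Monoidal] [F.Full] [F.Faithful] (hF : MatchesPhases F P P')
    {X Y : C} (f g : X ⟶ Y) : P'.rel (F.map f) (F.map g) ↔ P.rel f g := by
  constructor
  · rintro ⟨q, hq, e⟩
    let s : 𝟙_ C ≅ 𝟙_ C := F.preimageIso ((εIso F).symm ≪≫ q ≪≫ εIso F)
    have hs : F.map s.hom = (εIso F).inv ≫ q.hom ≫ (εIso F).hom := F.map_preimage _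
    refine ⟨s, (hF s).2 ?_, F.map_injective ?_⟩
    · have : εIso F ≪≫ F.mapIso s ≪≫ (εIso F).symm = q := by
        ext
        simp [hs, -εIso_hom, -εIso_inv]
      rwa [this]
    · rw [e, map_smulHom, mapScalar, hs]
      congr 1
      simp
  · rintro ⟨p, hp, rfl⟩
    exact ⟨_, (hF p).1 hp, map_smulHom F p.hom g⟩

instance [Dagger C] [DaggerMonoidal C] [P.AllUnitary] : DaggerMonoidal P.Quotient where
  dag_tensor := by
    rintro _ _ _ _ ⟨f⟩ ⟨g⟩
    change dag (P.proj.map f ⊗ₘ P.proj.map g) = P.proj.map (dag f) ⊗ₘ P.proj.map (dag g)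
    rw [proj_tensorHom, proj_tensorHom, ← DaggerMonoidal.dag_tensor]
    rfl
  associator_unitary X Y Z :=
    congrArg P.proj.map (DaggerMonoidal.associator_unitary X.as Y.as Z.as)
  leftUnitor_unitary X := congrArg P.proj.map (DaggerMonoidal.leftUnitor_unitary X.as)
  rightUnitor_unitary X := congrArg P.proj.map (DaggerMonoidal.rightUnitor_unitary X.as)

variable (F : C ⥤ D) [F.Monoidal] [F.Full] [F.Faithful] (hF : MatchesPhases F P P')

/-- The functor induced on the quotients by the global phases. -/
def quotientMap : P.Quotient ⥤ P'.Quotient :=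
  CategoryTheory.Quotient.lift P.rel (F ⋙ P'.proj) fun _ _ f g h =>
    CategoryTheory.Quotient.sound _ ((rel_map_iff F hF f g).2 h)

instance : (quotientMap F hF).Full where
  map_surjective {X Y} := by
    rintro ⟨g⟩
    exact ⟨P.proj.map (F.preimage g), congrArg P'.proj.map (F.map_preimage g)⟩

instance : (quotientMap F hF).Faithful where
  map_injective {X Y} := by
    rintro ⟨f⟩ ⟨g⟩ h
    exact CategoryTheory.Quotient.sound _ ((rel_map_iff F hF f g).1 (proj_map_eq_iff.1 h))

instance [F.EssSurj] : (quotientMap F hF).EssSurj where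
  mem_essImage Y := ⟨P.proj.obj (F.objPreimage Y.as),
    ⟨P'.proj.mapIso (F.objObjPreimageIso Y.as)⟩⟩

/-- The tensorator of the functor induced on the quotients. -/
def quotientMapTensorator : Tensorator (quotientMap F hF) where
  iso X Y := P'.proj.mapIso (μIso F X.as Y.as)
  natural_left := by
    rintro X Y ⟨f⟩ Z
    exact congrArg P'.proj.map (μ_natural_left F f Z.as)
  natural_right := by
    rintro X Y Z ⟨f⟩
    exact congrArg P'.proj.map (μ_natural_right F Z.as f)
  assoc X Y Z := congrArg P'.proj.map (associativity F X.as Y.as Z.as)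

end GlobalPhases

theorem PhaseMonEquiv.quotient {P : GlobalPhases C} {P' : GlobalPhases D}
    (h : PhaseMonEquiv P P') : MonEquiv P.Quotient P'.Quotient := by
  obtain ⟨F, _, _, hF⟩ := h
  obtain ⟨M, -⟩ := (GlobalPhases.quotientMapTensorator F hF).exists_monoidal
    (P'.proj.mapIso (εIso F))
  exact ⟨_, M, isEquivalence_of _ inferInstance inferInstance inferInstance⟩

theorem PhaseDaggerMonEquiv.quotient [Dagger C] [DaggerMonoidal C] [Dagger D] [DaggerMonoidal D]
    {P : GlobalPhases C} {P' : GlobalPhases D} [P.AllUnitary] [P'.AllUnitary]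
    (h : PhaseDaggerMonEquiv P P') : DaggerMonEquiv P.Quotient P'.Quotient := by
  obtain ⟨F, _, hF, hP⟩ := h
  have := hF.full
  have := hF.faithful
  obtain ⟨M, hM⟩ := (GlobalPhases.quotientMapTensorator F hP).exists_monoidal
    (P'.proj.mapIso (εIso F))
  have h1 : ∀ {X Y : P.Quotient} (f : X ⟶ Y), (GlobalPhases.quotientMap F hP).map (dag f) =
      dag ((GlobalPhases.quotientMap F hP).map f) := by
    rintro ⟨X⟩ ⟨Y⟩ ⟨f⟩
    exact congrArg P'.proj.map (hF.map_dag f)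
  have h2 : ∀ X Y, IsUnitary (μIso (GlobalPhases.quotientMap F hP) X Y) := fun X Y => by
    rw [hM]
    exact congrArg P'.proj.map (hF.μ_unitary X.as Y.as)
  refine ⟨_, M,
    { map_dag := h1
      μ_unitary := h2
      ε_unitary := isUnitary_εIso _ h1 h2
      full := inferInstance
      faithful := inferInstance
      unitarily_surj := fun Y => ?_ }⟩
  obtain ⟨X, e, he⟩ := hF.unitarily_surj Y.as
  exact ⟨P.proj.obj X, P'.proj.mapIso e, congrArg P'.proj.map he⟩

end QuotientFunctor

/-! ### Functoriality of `GP(B)` -/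

section

variable {C : Type u} [Category.{v} C] {D : Type u'} [Category.{v'} D]

lemma IsPhasedCoproduct.map (F : C ⥤ D) [F.IsEquivalence] {A B E : C} {κA : A ⟶ E} {κB : B ⟶ E}
    (h : IsPhasedCoproduct κA κB) : IsPhasedCoproduct (F.map κA) (F.map κB) where
  exists_desc {T} f g := by
    obtain ⟨k, h1, h2⟩ := h.exists_desc (F.preimage (f ≫ (F.objObjPreimageIso T).inv))
      (F.preimage (g ≫ (F.objObjPreimageIso T).inv))
    refine ⟨F.map k ≫ (F.objObjPreimageIso T).hom, ?_, ?_⟩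
    · rw [← F.map_comp_assoc, h1, F.map_preimage]
      simp
    · rw [← F.map_comp_assoc, h2, F.map_preimage]
      simp
  exists_phase {T} k k' h1 h2 := by
    obtain ⟨U, hU, e⟩ := h.exists_phase (F.preimage (k ≫ (F.objObjPreimageIso T).inv))
      (F.preimage (k' ≫ (F.objObjPreimageIso T).inv))
      (F.map_injective (by simp only [F.map_comp, F.map_preimage, reassoc_of% h1]))
      (F.map_injective (by simp only [F.map_comp, F.map_preimage, reassoc_of% h2]))
    refine ⟨F.map U, ⟨by rw [← F.map_comp, hU.1], by rw [← F.map_comp, hU.2]⟩, ?_⟩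
    rw [← cancel_mono (F.objObjPreimageIso T).inv, Category.assoc]
    simpa only [F.map_comp, F.map_preimage] using congrArg F.map e

/-- A tensorator given in the opposite direction. -/
def Tensorator.ofInv [MonoidalCategory C] [MonoidalCategory D] {F : C ⥤ D}
    (m : ∀ X Y : C, F.obj (X ⊗ Y) ≅ F.obj X ⊗ F.obj Y)
    (natural_left : ∀ {X Y : C} (f : X ⟶ Y) (Z : C),
      F.map (f ▷ Z) ≫ (m Y Z).hom = (m X Z).hom ≫ F.map f ▷ F.obj Z)
    (natural_right : ∀ {X Y : C} (Z : C) (f : X ⟶ Y),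
      F.map (Z ◁ f) ≫ (m Z Y).hom = (m Z X).hom ≫ F.obj Z ◁ F.map f)
    (assoc : ∀ X Y Z : C, F.map (α_ X Y Z).hom ≫ (m X (Y ⊗ Z)).hom ≫ F.obj X ◁ (m Y Z).hom =
      (m (X ⊗ Y) Z).hom ≫ (m X Y).hom ▷ F.obj Z ≫ (α_ _ _ _).hom) : Tensorator F where
  iso X Y := (m X Y).symm
  natural_left f Z := by
    rw [Iso.symm_hom, Iso.symm_hom, Iso.eq_inv_comp, ← Category.assoc, Iso.comp_inv_eq,
      natural_left]
  natural_right Z f := by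
    rw [Iso.symm_hom, Iso.symm_hom, Iso.eq_inv_comp, ← Category.assoc, Iso.comp_inv_eq,
      natural_right]
  assoc X Y Z := by
    rw [← cancel_mono ((m X (Y ⊗ Z)).hom ≫ F.obj X ◁ (m Y Z).hom)]
    simp only [Category.assoc, assoc]
    simp

end

namespace GPCat

open Functor.Monoidal Functor.LaxMonoidal Functor.OplaxMonoidal

variable {B : Type u} [Category.{v} B] [MonoidalCategory B]
  {W : ∀ ⦃A E : B⦄, (A ⟶ E) → (𝟙_ B ⟶ E) → Prop}
  {B' : Type u'} [Category.{v'} B'] [MonoidalCategory B']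
  {W' : ∀ ⦃A E : B'⦄, (A ⟶ E) → (𝟙_ B' ⟶ E) → Prop}
  (F : B ⥤ B') [F.Monoidal]
  (hF : ∀ ⦃A E : B⦄ (κ : A ⟶ E) (κI : 𝟙_ B ⟶ E), W κ κI → W' (F.map κ) (ε F ≫ F.map κI))

/-- The functor induced by a monoidal functor. -/
noncomputable abbrev mapFunctor : GPCat W ⥤ GPCat W' where
  obj X := ⟨F.obj X.base, F.obj X.tot, F.map X.inl, ε F ≫ F.map X.inr, hF _ _ X.prop⟩
  map f := ⟨F.map f.hom, ⟨F.map (baseMap f), by rw [← F.map_comp, inl_hom, F.map_comp]⟩, by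
    rw [Category.assoc, ← F.map_comp, inr_hom]⟩
  map_id X := hom_ext (F.map_id X.tot)
  map_comp f g := hom_ext (F.map_comp f.hom g.hom)

instance [F.Faithful] : (mapFunctor F hF).Faithful where
  map_injective h := hom_ext (F.map_injective (congrArg Hom.hom h))

instance [F.Full] [F.Faithful] : (mapFunctor F hF).Full where
  map_surjective {X Y} g := by
    refine ⟨⟨F.preimage g.hom, ⟨F.preimage (baseMap g), F.map_injective ?_⟩,
      F.map_injective ?_⟩, hom_ext (F.map_preimage _)⟩
    · rw [F.map_comp, F.map_comp, F.map_preimage, F.map_preimage]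
      exact inl_hom g
    · rw [F.map_comp, F.map_preimage, ← cancel_epi (ε F), ← Category.assoc]
      exact inr_hom g

variable (hW : Admissible W) (hW' : Admissible W')

include hW' in
lemma baseMap_mapFunctor {X Y : GPCat W} (f : X ⟶ Y) :
    baseMap ((mapFunctor F hF).map f) = F.map (baseMap f) :=
  hW'.baseMap_eq _ (by simp only [mapFunctor, ← F.map_comp, inl_hom])

include hW' in
lemma Admissible.exists_iso_over {X Y : GPCat W'} (e : X.base ≅ Y.base) :
    ∃ k : X ≅ Y, baseMap k.hom = e.hom := by
  obtain ⟨k, hk⟩ := hW'.exists_hom e.hom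
  have := hW'.isIso_of_baseMap k (by rw [hk]; infer_instance)
  exact ⟨asIso k, hk⟩

include hW hW' in
lemma essSurj_mapFunctor [F.EssSurj] : (mapFunctor F hF).EssSurj where
  mem_essImage Y := by
    obtain ⟨X, hX⟩ := hW.exists_over (F.objPreimage Y.base)
    obtain ⟨k, -⟩ := hW'.exists_iso_over (X := (mapFunctor F hF).obj X) (Y := Y)
      (F.mapIso (eqToIso hX) ≪≫ F.objObjPreimageIso Y.base)
    exact ⟨X, ⟨k⟩⟩

namespace TensorStructure

variable [MonoidalCategory (GPCat W)] (τ : TensorStructure W)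
  [MonoidalCategory (GPCat W')] (τ' : TensorStructure W')

include hW' in
-- The image of `c` under `F`, followed by the comparison of `F`, has the components of `c` in `B'`
-- up to the isomorphism of bases, so it lifts through the latter.
lemma exists_mapμ (X Y : GPCat W) :
    ∃ m : (mapFunctor F hF).obj (X ⊗ Y) ≅ (mapFunctor F hF).obj X ⊗ (mapFunctor F hF).obj Y,
      m.hom.hom ≫ τ'.c _ _ = F.map (τ.c X Y) ≫ δ F X.tot Y.tot ∧
      baseMap m.hom = (F.mapIso (τ.baseIso X Y) ≪≫ (μIso F _ _).symm ≪≫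
        (τ'.baseIso ((mapFunctor F hF).obj X) ((mapFunctor F hF).obj Y)).symm).hom := by
  obtain ⟨m, h1, h2⟩ := hW'.exists_lift (X := (mapFunctor F hF).obj (X ⊗ Y))
    (τ'.c ((mapFunctor F hF).obj X) ((mapFunctor F hF).obj Y)) (F.map (τ.c X Y) ≫ δ F X.tot Y.tot)
    (F.mapIso (τ.baseIso X Y) ≪≫ (μIso F _ _).symm ≪≫
        (τ'.baseIso ((mapFunctor F hF).obj X) ((mapFunctor F hF).obj Y)).symm).hom
    (by
      rw [inl_c']
      simp only [Iso.trans_hom, Iso.symm_hom, Category.assoc,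
        Iso.inv_hom_id_assoc, Functor.mapIso_hom, μIso_inv, δ_natural]
      rw [← F.map_comp_assoc, inl_c', F.map_comp_assoc])
    (by
      rw [inr_c]
      simp only [Category.assoc]
      rw [← F.map_comp_assoc, inr_c, F.map_comp_assoc, ← δ_natural, map_rightUnitor_inv]
      simp [MonoidalCategory.tensorHom_def])
  have := hW'.isIso_of_baseMap m (by rw [h2]; infer_instance)
  exact ⟨asIso m, h1, h2⟩

/-- The comparison of tensor products for the functor induced by a monoidal functor. -/
noncomputable def mapμ (X Y : GPCat W) :
    (mapFunctor F hF).obj (X ⊗ Y) ≅ (mapFunctor F hF).obj X ⊗ (mapFunctor F hF).obj Y :=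
  (exists_mapμ F hF hW' τ τ' X Y).choose

lemma mapμ_c (X Y : GPCat W) : (mapμ F hF hW' τ τ' X Y).hom.hom ≫ τ'.c _ _ =
    F.map (τ.c X Y) ≫ δ F X.tot Y.tot :=
  (exists_mapμ F hF hW' τ τ' X Y).choose_spec.1

lemma baseMap_mapμ (X Y : GPCat W) : baseMap (mapμ F hF hW' τ τ' X Y).hom =
    (F.mapIso (τ.baseIso X Y) ≪≫ (μIso F _ _).symm ≪≫
        (τ'.baseIso ((mapFunctor F hF).obj X) ((mapFunctor F hF).obj Y)).symm).hom :=
  (exists_mapμ F hF hW' τ τ' X Y).choose_spec.2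

/-- The tensorator of the functor induced by a monoidal functor. -/
noncomputable def mapTensorator : Tensorator (mapFunctor F hF) :=
  Tensorator.ofInv (mapμ F hF hW' τ τ')
    (fun f Z => by
      apply τ'.hom_ext_c hW'
      rw [comp_hom, comp_hom, Category.assoc, Category.assoc, mapμ_c, whiskerRight_c,
        reassoc_of% mapμ_c, ← F.map_comp_assoc,
        whiskerRight_c, F.map_comp_assoc]
      exact congrArg _ (δ_natural_left F f.hom Z.tot).symm)
    (fun Z f => by
      apply τ'.hom_ext_c hW'
      rw [comp_hom, comp_hom, Category.assoc, Category.assoc, mapμ_c, whiskerLeft_c,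
        reassoc_of% mapμ_c, ← F.map_comp_assoc,
        whiskerLeft_c, F.map_comp_assoc]
      exact congrArg _ (δ_natural_right F Z.tot f.hom).symm)
    (fun X Y Z => by
      apply τ'.hom_ext_c hW'
      have := τ'.mono_whiskerLeft_c hW' ((mapFunctor F hF).obj X).tot ((mapFunctor F hF).obj Y)
        ((mapFunctor F hF).obj Z)
      rw [← cancel_mono (((mapFunctor F hF).obj X).tot ◁ τ'.c ((mapFunctor F hF).obj Y)
        ((mapFunctor F hF).obj Z))]
      simp only [comp_hom, Category.assoc]
      rw [reassoc_of% whiskerLeft_c, ← MonoidalCategory.whiskerLeft_comp, mapμ_c, associator_c,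
        reassoc_of% whiskerRight_c, ← comp_whiskerRight_assoc, mapμ_c, reassoc_of% mapμ_c,
        reassoc_of% mapμ_c]
      simp only [MonoidalCategory.whiskerLeft_comp, comp_whiskerRight,
        Category.assoc]
      rw [δ_natural_right_assoc, δ_natural_left_assoc, ← F.map_comp_assoc, ← F.map_comp_assoc,
        ← F.map_comp_assoc, Category.assoc, associator_c]
      simp only [F.map_comp, Category.assoc, Functor.OplaxMonoidal.oplax_associativity])

include τ τ' hW' in
lemma exists_unit_mapFunctor :
    Nonempty (𝟙_ (GPCat W') ≅ (mapFunctor F hF).obj (𝟙_ (GPCat W))) := by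
  obtain ⟨k, -⟩ := hW'.exists_iso_over (X := 𝟙_ (GPCat W'))
    (Y := (mapFunctor F hF).obj (𝟙_ (GPCat W))) (τ'.unitIso ≪≫ εIso F ≪≫ F.mapIso τ.unitIso.symm)
  exact ⟨k⟩

include hW hW' in
-- Being a phase means having trivial base map. The base map of the conjugated scalar is a conjugate
-- of `F.map (baseMap s)`, and `F` is faithful.
lemma matchesPhases_mapFunctor [F.Faithful] [(mapFunctor F hF).Monoidal]
    {Q : GlobalPhases (GPCat W)}
    {Q' : GlobalPhases (GPCat W')} (hQ : Q.carrier = phases W) (hQ' : Q'.carrier = phases W') :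
    MatchesPhases (mapFunctor F hF) Q Q' := by
  intro s
  rw [hQ, hQ']
  refine (mem_phases_iff hW s).trans (Iff.trans ?_ (mem_phases_iff hW'
    (εIso (mapFunctor F hF) ≪≫ (mapFunctor F hF).mapIso s ≪≫ (εIso (mapFunctor F hF)).symm)).symm)
  have := hW'.isIso_baseMap (εIso (mapFunctor F hF)).hom
  have e : baseMap (εIso (mapFunctor F hF)).hom ≫ baseMap (εIso (mapFunctor F hF)).inv = 𝟙 _ := by
    rw [← hW'.baseMap_comp, Iso.hom_inv_id, hW'.baseMap_id]
  have e' : baseMap (εIso (mapFunctor F hF)).inv ≫ baseMap (εIso (mapFunctor F hF)).hom = 𝟙 _ := by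
    rw [← hW'.baseMap_comp, Iso.inv_hom_id, hW'.baseMap_id]
  rw [Iso.trans_hom, Iso.trans_hom, Functor.mapIso_hom, Iso.symm_hom, hW'.baseMap_comp,
    hW'.baseMap_comp, baseMap_mapFunctor F hF hW']
  constructor
  · intro h
    rw [h, F.map_id, Category.id_comp, e]
  · intro h
    apply F.map_injective
    rw [← cancel_epi (baseMap (εIso (mapFunctor F hF)).hom), F.map_id, Category.comp_id]
    have := congrArg (· ≫ baseMap (εIso (mapFunctor F hF)).hom) h
    simpa only [Category.assoc, e', Category.comp_id, Category.id_comp] using this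

end TensorStructure

theorem phaseMonEquiv_of_monEquiv (h : MonEquiv B B') (hB : PhasedCoprodCat B)
    (hB' : PhasedCoprodCat B') [MonoidalCategory (GP B)] (τ : GPTensor B)
    [MonoidalCategory (GP B')] (τ' : GPTensor B') {Q : GlobalPhases (GP B)}
    {Q' : GlobalPhases (GP B')} (hQ : Q.carrier = phases _) (hQ' : Q'.carrier = phases _) :
    PhaseMonEquiv Q Q' := by
  obtain ⟨F, _, _⟩ := h
  have hF : ∀ ⦃A E : B⦄ (κ : A ⟶ E) (κI : 𝟙_ B ⟶ E), IsPhasedCoproduct κ κI →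
      IsPhasedCoproduct (F.map κ) (ε F ≫ F.map κI) := fun A E κ κI h => by
    simpa using (h.map F).iso_comp (𝟙 _) (ε F)
  obtain ⟨e⟩ := TensorStructure.exists_unit_mapFunctor F hF hB'.admissible τ τ'
  obtain ⟨M, -⟩ := (TensorStructure.mapTensorator F hF hB'.admissible τ τ').exists_monoidal e
  exact ⟨_, M, isEquivalence_of _ inferInstance inferInstance
    (essSurj_mapFunctor F hF hB.admissible hB'.admissible),
    TensorStructure.matchesPhases_mapFunctor F hF hB.admissible hB'.admissible hQ hQ'⟩

end GPCat

/-! ### Coproducts and isomorphisms -/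

section

variable {C : Type u} [Category.{v} C]

lemma nonempty_isColimit_iff {A B E : C} (i : A ⟶ E) (j : B ⟶ E) :
    Nonempty (IsColimit (BinaryCofan.mk i j)) ↔
      (∀ (T : C) (f : A ⟶ T) (g : B ⟶ T), ∃ h : E ⟶ T, i ≫ h = f ∧ j ≫ h = g) ∧
      ∀ (T : C) (h h' : E ⟶ T), i ≫ h = i ≫ h' → j ≫ h = j ≫ h' → h = h' := by
  constructor
  · rintro ⟨hc⟩
    exact ⟨fun T f g => ⟨hc.desc (BinaryCofan.mk f g), hc.fac _ ⟨.left⟩, hc.fac _ ⟨.right⟩⟩,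
      fun T h h' h1 h2 => BinaryCofan.IsColimit.hom_ext hc h1 h2⟩
  · rintro ⟨h1, h2⟩
    choose d hd using h1
    exact ⟨BinaryCofan.IsColimit.mk _ (fun f g => d _ f g) (fun f g => (hd _ f g).1)
      (fun f g => (hd _ f g).2) (fun f g m e1 e2 => h2 _ _ _
        (e1.trans (hd _ f g).1.symm) (e2.trans (hd _ f g).2.symm))⟩

lemma nonempty_isColimit_of_isIso {A B E : C} {i : A ⟶ E} {j : B ⟶ E}
    (h : Nonempty (IsColimit (BinaryCofan.mk i j))) {A' B' E' : C} (a : A' ⟶ A) (b : B' ⟶ B)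
    (e : E ⟶ E') [IsIso a] [IsIso b] [IsIso e] :
    Nonempty (IsColimit (BinaryCofan.mk (a ≫ i ≫ e) (b ≫ j ≫ e))) := by
  rw [nonempty_isColimit_iff] at h ⊢
  refine ⟨fun T f g => ?_, fun T k k' h1 h2 => ?_⟩
  · obtain ⟨k, h1, h2⟩ := h.1 T (inv a ≫ f) (inv b ≫ g)
    exact ⟨inv e ≫ k, by simp [h1], by simp [h2]⟩
  · rw [← cancel_epi e]
    refine h.2 T _ _ ?_ ?_
    · simpa [cancel_epi] using h1
    · simpa [cancel_epi] using h2

end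

/-! ### Phased coproducts in `A/P` -/

namespace GlobalPhases

variable {C : Type u} [Category.{v} C] [MonoidalCategory C] {P : GlobalPhases C}

lemma isIso_smulHom_id {p : Aut (𝟙_ C)} (X : C) : IsIso (smulHom p.hom (𝟙 X)) := by
  refine ⟨⟨smulHom p.inv (𝟙 X), ?_, ?_⟩⟩
  · rw [smulHom_comp_left, Category.id_comp, smulHom_smulHom]
    exact (congrArg (fun t => smulHom t (𝟙 X)) (Iso.hom_inv_id p)).trans (smulHom_id _)
  · rw [smulHom_comp_left, Category.id_comp, smulHom_smulHom]
    exact (congrArg (fun t => smulHom t (𝟙 X)) (Iso.inv_hom_id p)).trans (smulHom_id _)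

lemma proj_smulHom {p : Aut (𝟙_ C)} (hp : p ∈ P.carrier) {X Y : C} (f : X ⟶ Y) :
    P.proj.map (smulHom p.hom f) = P.proj.map f :=
  proj_map_eq_iff.2 ⟨p, hp, rfl⟩

/-- A representative of the inverse is an inverse up to scalars `p` and `q`, which act invertibly.
-/
lemma isIso_of_proj {X Y : C} (f : X ⟶ Y) (h : IsIso (P.proj.map f)) : IsIso f := by
  obtain ⟨⟨⟨g⟩, h1, h2⟩⟩ := h
  obtain ⟨p, hp, e1⟩ := proj_map_eq_iff (f := f ≫ g) (g := 𝟙 X).1 h1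
  obtain ⟨q, hq, e2⟩ := proj_map_eq_iff (f := g ≫ f) (g := 𝟙 Y).1 h2
  have i1 := isIso_smulHom_id (p := p) X
  have i2 := isIso_smulHom_id (p := q) Y
  rw [← e1] at i1
  rw [← e2] at i2
  have h3 : IsSplitMono f := ⟨⟨⟨g ≫ inv (f ≫ g), by rw [← Category.assoc, IsIso.hom_inv_id]⟩⟩⟩
  have h4 : IsSplitEpi f := ⟨⟨⟨inv (g ≫ f) ≫ g, by rw [Category.assoc, IsIso.inv_hom_id]⟩⟩⟩
  exact isIso_of_mono_of_isSplitEpi f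

lemma mono_proj {X Y : C} (f : X ⟶ Y) [Mono f] : Mono (P.proj.map f) where
  right_cancellation := by
    rintro ⟨Z⟩ ⟨g⟩ ⟨h⟩ e
    obtain ⟨p, hp, e⟩ := proj_map_eq_iff (f := g ≫ f) (g := h ≫ f).1 e
    refine proj_map_eq_iff (f := g) (g := h).2 ⟨p, hp, ?_⟩
    rwa [← cancel_mono f, smulHom_comp_left]

lemma smulHom_whiskerLeft {p : Aut (𝟙_ C)} (hp : p ∈ P.carrier) {X Y : C} (f : X ⟶ Y) (Z : C) :
    Z ◁ smulHom p.hom f = smulHom p.hom (Z ◁ f) := by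
  rw [P.central p hp, homSmul_whiskerLeft, ← P.central p hp]

/-- Coproducts become phased coproducts in the quotient. -/
lemma isPhasedCoproduct_proj {A B E : C} {i : A ⟶ E} {j : B ⟶ E}
    (h : Nonempty (IsColimit (BinaryCofan.mk i j))) :
    IsPhasedCoproduct (P.proj.map i) (P.proj.map j) := by
  rw [nonempty_isColimit_iff] at h
  refine ⟨?_, ?_⟩
  · rintro ⟨T⟩ ⟨f⟩ ⟨g⟩
    obtain ⟨k, h1, h2⟩ := h.1 T f g
    exact ⟨P.proj.map k, congrArg P.proj.map h1, congrArg P.proj.map h2⟩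
  · rintro ⟨T⟩ ⟨k⟩ ⟨k'⟩ h1 h2
    obtain ⟨p, hp, e1⟩ := proj_map_eq_iff (f := i ≫ k') (g := i ≫ k).1 h1.symm
    obtain ⟨q, hq, e2⟩ := proj_map_eq_iff (f := j ≫ k') (g := j ≫ k).1 h2.symm
    -- The two discrepancies `p` and `q` may differ. Together they define `U`, which is a phase only
    -- after passing to the quotient.
    obtain ⟨U, hU1, hU2⟩ := h.1 E (smulHom p.hom i) (smulHom q.hom j)
    have e : k' = U ≫ k := by
      refine h.2 _ _ _ ?_ ?_
      · rw [reassoc_of% hU1, smulHom_comp_left, e1]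
      · rw [reassoc_of% hU2, smulHom_comp_left, e2]
    exact ⟨P.proj.map U, ⟨(congrArg P.proj.map hU1).trans (proj_smulHom hp i),
      (congrArg P.proj.map hU2).trans (proj_smulHom hq j)⟩, congrArg P.proj.map e⟩

/-- Representatives of the coprojections of a phased coproduct in the quotient are the
coprojections of a coproduct. -/
lemma nonempty_isColimit_of_proj [HasFiniteCoproducts C] {A B E : C} {i : A ⟶ E} {j : B ⟶ E}
    (h : IsPhasedCoproduct (P.proj.map i) (P.proj.map j)) :
    Nonempty (IsColimit (BinaryCofan.mk i j)) := by
  have h' : Nonempty (IsColimit (BinaryCofan.mk (coprod.inl : A ⟶ A ⨿ B) coprod.inr)) :=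
    ⟨coprodIsCoprod A B⟩
  -- The comparison with an actual coproduct lifts to an isomorphism `e`. The leftover scalars on
  -- `i` and `j` are invertible and become changes of the summands.
  obtain ⟨⟨e⟩, he, e1, e2⟩ := (isPhasedCoproduct_proj (P := P) h').exists_iso h
  have : IsIso e := isIso_of_proj e he
  obtain ⟨p, hp, e1⟩ := proj_map_eq_iff (f := i) (g := coprod.inl ≫ e).1 e1.symm
  obtain ⟨q, hq, e2⟩ := proj_map_eq_iff (f := j) (g := coprod.inr ≫ e).1 e2.symm
  have i1 := isIso_smulHom_id (p := p) A
  have i2 := isIso_smulHom_id (p := q) B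
  rw [e1, e2, smulHom_eq, smulHom_eq q.hom]
  exact nonempty_isColimit_of_isIso h' _ _ e

theorem hasFinitePhasedCoproducts_quotient [HasFiniteCoproducts C] :
    HasFinitePhasedCoproducts P.Quotient := by
  intro n X
  refine ⟨P.proj.obj (∐ fun i => (X i).as), fun i => P.proj.map (Sigma.ι (fun i => (X i).as) i),
    ?_, ?_⟩
  · rintro ⟨T⟩ f
    choose g hg using fun i => P.proj.map_surjective (f i)
    exact ⟨P.proj.map (Sigma.desc g), fun i => (congrArg P.proj.map (Sigma.ι_desc g i)).trans (hg i)⟩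
  · rintro ⟨T⟩ ⟨k⟩ ⟨k'⟩ h
    choose p hp e using fun i => proj_map_eq_iff (f := Sigma.ι (fun i => (X i).as) i ≫ k')
      (g := Sigma.ι (fun i => (X i).as) i ≫ k).1 (h i).symm
    obtain ⟨U, hU⟩ : ∃ U : (∐ fun i => (X i).as) ⟶ ∐ fun i => (X i).as,
        ∀ i, Sigma.ι (fun i => (X i).as) i ≫ U =
          smulHom (p i).hom (Sigma.ι (fun i => (X i).as) i) :=
      ⟨Sigma.desc fun i => smulHom (p i).hom (Sigma.ι (fun i => (X i).as) i),
        fun i => Sigma.ι_desc _ i⟩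
    have e' : k' = U ≫ k := Sigma.hom_ext _ _ fun i => by
      rw [reassoc_of% hU i, smulHom_comp_left]
      exact e i
    exact ⟨P.proj.map U, fun i => (congrArg P.proj.map (hU i)).trans (proj_smulHom (hp i) _),
      congrArg P.proj.map e'⟩

theorem monicPhasedCoproducts_quotient [HasFiniteCoproducts C] [MonoCoprod C] :
    MonicPhasedCoproducts P.Quotient := by
  have key : ∀ {A B E : C} (i : A ⟶ E) (j : B ⟶ E),
      Nonempty (IsColimit (BinaryCofan.mk i j)) → Mono i := fun i j h =>
    MonoCoprod.binaryCofan_inl _ h.some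
  rintro ⟨A⟩ ⟨B⟩ ⟨E⟩ ⟨i⟩ ⟨j⟩ h
  have := key i j (nonempty_isColimit_of_proj h)
  have := key j i (nonempty_isColimit_of_proj h.swap)
  exact ⟨mono_proj i, mono_proj j⟩

/-- A phase of a tensored coproduct acts by scalars `p` and `q` on the two summands, and the same
scalars define the phase of the original coproduct from which it comes. -/
theorem distributivePhasedCoproducts_quotient [HasFiniteCoproducts C]
    (hC : DistributiveCoproducts C) : DistributivePhasedCoproducts P.Quotient := by
  rintro ⟨X⟩
  have := (hC X).1
  have := (hC X).2
  refine ⟨?_, ?_⟩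
  · rintro ⟨A⟩ ⟨B⟩ ⟨E⟩ ⟨i⟩ ⟨j⟩ h
    have h1 := nonempty_isColimit_of_proj h
    have h2 := nonempty_isColimit_map (tensorLeft X) h1
    refine ⟨isPhasedCoproduct_proj h2, ?_⟩
    rw [nonempty_isColimit_iff] at h1 h2
    rintro ⟨V⟩ ⟨hV1, hV2⟩
    obtain ⟨p, hp, e1⟩ := proj_map_eq_iff (f := X ◁ i ≫ V) (g := X ◁ i).1 hV1
    obtain ⟨q, hq, e2⟩ := proj_map_eq_iff (f := X ◁ j ≫ V) (g := X ◁ j).1 hV2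
    obtain ⟨U, hU1, hU2⟩ := h1.1 E (smulHom p.hom i) (smulHom q.hom j)
    refine ⟨P.proj.map U, ⟨(congrArg P.proj.map hU1).trans (proj_smulHom hp i),
      (congrArg P.proj.map hU2).trans (proj_smulHom hq j)⟩,
      congrArg P.proj.map (h2.2 _ (X ◁ U) V ?_ ?_)⟩
    · exact (MonoidalCategory.whiskerLeft_comp _ _ _).symm.trans ((congrArg (X ◁ ·) hU1).trans
        ((smulHom_whiskerLeft hp _ _).trans e1.symm))
    · exact (MonoidalCategory.whiskerLeft_comp _ _ _).symm.trans ((congrArg (X ◁ ·) hU2).trans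
        ((smulHom_whiskerLeft hq _ _).trans e2.symm))
  · rintro ⟨A⟩ ⟨B⟩ ⟨E⟩ ⟨i⟩ ⟨j⟩ h
    have h1 := nonempty_isColimit_of_proj h
    have h2 := nonempty_isColimit_map (tensorRight X) h1
    refine ⟨isPhasedCoproduct_proj h2, ?_⟩
    rw [nonempty_isColimit_iff] at h1 h2
    rintro ⟨V⟩ ⟨hV1, hV2⟩
    obtain ⟨p, hp, e1⟩ := proj_map_eq_iff (f := i ▷ X ≫ V) (g := i ▷ X).1 hV1
    obtain ⟨q, hq, e2⟩ := proj_map_eq_iff (f := j ▷ X ≫ V) (g := j ▷ X).1 hV2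
    obtain ⟨U, hU1, hU2⟩ := h1.1 E (smulHom p.hom i) (smulHom q.hom j)
    refine ⟨P.proj.map U, ⟨(congrArg P.proj.map hU1).trans (proj_smulHom hp i),
      (congrArg P.proj.map hU2).trans (proj_smulHom hq j)⟩,
      congrArg P.proj.map (h2.2 _ (U ▷ X) V ?_ ?_)⟩
    · exact (comp_whiskerRight _ _ _).symm.trans ((congrArg (· ▷ X) hU1).trans
        ((smulHom_whiskerRight _ _ _).trans e1.symm))
    · exact (comp_whiskerRight _ _ _).symm.trans ((congrArg (· ▷ X) hU2).trans
        ((smulHom_whiskerRight _ _ _).trans e2.symm))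

/-- A phase is a pair of scalars `p`, `q` on the summands. The same pair on the target works, since
`p` and `q` commute with the scalars `r` and `s` by which the representative of `f` fails to be
diagonal. -/
theorem transitivePhases_quotient [HasFiniteCoproducts C] : TransitivePhases P.Quotient := by
  rintro ⟨A⟩ ⟨B⟩ ⟨E⟩ ⟨A'⟩ ⟨B'⟩ ⟨E'⟩ ⟨i⟩ ⟨j⟩ ⟨i'⟩ ⟨j'⟩ h h' ⟨f⟩ ⟨⟨a⟩, ha⟩ ⟨⟨b⟩, hb⟩ ⟨U⟩ ⟨hU1, hU2⟩
  obtain ⟨r, hr, ha⟩ := proj_map_eq_iff (f := i ≫ f) (g := a ≫ i').1 ha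
  obtain ⟨s, hs, hb⟩ := proj_map_eq_iff (f := j ≫ f) (g := b ≫ j').1 hb
  obtain ⟨p, hp, e1⟩ := proj_map_eq_iff (f := i ≫ U) (g := i).1 hU1
  obtain ⟨q, hq, e2⟩ := proj_map_eq_iff (f := j ≫ U) (g := j).1 hU2
  have h1 := (nonempty_isColimit_iff i j).1 (nonempty_isColimit_of_proj h)
  have h2 := (nonempty_isColimit_iff i' j').1 (nonempty_isColimit_of_proj h')
  obtain ⟨V, hV1, hV2⟩ := h2.1 E' (smulHom p.hom i') (smulHom q.hom j')
  refine ⟨P.proj.map V, ⟨(congrArg P.proj.map hV1).trans (proj_smulHom hp i'),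
    (congrArg P.proj.map hV2).trans (proj_smulHom hq j')⟩,
    congrArg P.proj.map (h1.2 _ (U ≫ f) (f ≫ V) ?_ ?_)⟩
  · rw [reassoc_of% e1, reassoc_of% ha, smulHom_comp_left, smulHom_comp_left, Category.assoc, hV1,
      smulHom_comp_right, ha, smulHom_smulHom, smulHom_smulHom, scalar_comm]
  · rw [reassoc_of% e2, reassoc_of% hb, smulHom_comp_left, smulHom_comp_left, Category.assoc, hV2,
      smulHom_comp_right, hb, smulHom_smulHom, smulHom_smulHom, scalar_comm]

end GlobalPhases

theorem CoprodCat.quotient {C : Type u} [Category.{v} C] [MonoidalCategory C] (hC : CoprodCat C)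
    (P : GlobalPhases C) : PhasedCoprodCat P.Quotient := by
  have := hC.finite
  have := hC.monic
  exact
    { finite := GlobalPhases.hasFinitePhasedCoproducts_quotient
      monic := GlobalPhases.monicPhasedCoproducts_quotient
      distrib := GlobalPhases.distributivePhasedCoproducts_quotient hC.distrib
      transitive := GlobalPhases.transitivePhases_quotient }

/-! ### The equivalence between `GP(A/P)` and `A` -/

section

variable {C : Type u} [Category.{v} C] [MonoidalCategory C]

/-- Coprojections of binary coproducts. -/
def IsCoprojection {A E : C} (f : A ⟶ E) : Prop :=
  ∃ (B : C) (g : B ⟶ E), Nonempty (IsColimit (BinaryCofan.mk f g))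

omit [MonoidalCategory C] in
lemma IsCoprojection.mono [MonoCoprod C] {A E : C} {f : A ⟶ E} (h : IsCoprojection f) : Mono f := by
  obtain ⟨B, g, ⟨h⟩⟩ := h
  exact MonoCoprod.binaryCofan_inl _ h

lemma IsCoprojection.whiskerLeft (hC : DistributiveCoproducts C) {A E : C} {f : A ⟶ E}
    (h : IsCoprojection f) (X : C) : IsCoprojection (X ◁ f) := by
  obtain ⟨B, g, h⟩ := h
  have := (hC X).1
  exact ⟨_, X ◁ g, nonempty_isColimit_map (tensorLeft X) h⟩

lemma IsCoprojection.whiskerRight (hC : DistributiveCoproducts C) {A E : C} {f : A ⟶ E}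
    (h : IsCoprojection f) (X : C) : IsCoprojection (f ▷ X) := by
  obtain ⟨B, g, h⟩ := h
  have := (hC X).2
  exact ⟨_, g ▷ X, nonempty_isColimit_map (tensorRight X) h⟩

lemma IsCoprojection.mono_tensor (hC : CoprodCat C) {A E A' E' : C} {f : A ⟶ E} {f' : A' ⟶ E'}
    (h : IsCoprojection f) (h' : IsCoprojection f') : Mono (f ⊗ₘ f') := by
  have := hC.monic
  rw [MonoidalCategory.tensorHom_def]
  have := (h.whiskerRight hC.distrib A').mono
  have := (h'.whiskerLeft hC.distrib E).mono
  exact mono_comp _ _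

lemma IsCoprojection.mono_tensor_tensor (hC : CoprodCat C) {A E A' E' A'' E'' : C} {f : A ⟶ E}
    {f' : A' ⟶ E'} {f'' : A'' ⟶ E''} (h : IsCoprojection f) (h' : IsCoprojection f')
    (h'' : IsCoprojection f'') : Mono (f ⊗ₘ (f' ⊗ₘ f'')) := by
  have := hC.monic
  rw [MonoidalCategory.tensorHom_def, MonoidalCategory.tensorHom_def f',
    MonoidalCategory.whiskerLeft_comp]
  have := (h.whiskerRight hC.distrib (A' ⊗ A'')).mono
  have := ((h'.whiskerRight hC.distrib A'').whiskerLeft hC.distrib E).mono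
  have := ((h''.whiskerLeft hC.distrib E').whiskerLeft hC.distrib E).mono
  exact mono_comp _ _

end

namespace GlobalPhases

variable {C : Type u} [Category.{v} C] [MonoidalCategory C] {P : GlobalPhases C}

lemma rel_of_proj {X Y : C} {f g : X ⟶ Y} (h : P.proj.map f = P.proj.map g) : P.rel f g :=
  proj_map_eq_iff.1 h

/-- Equivalent morphisms agreeing on a monic global element are equal. -/
lemma eq_of_rel {X Y : C} {f g : X ⟶ Y} (h : P.rel f g) (k : 𝟙_ C ⟶ X) (hk : k ≫ f = k ≫ g)
    [Mono (k ≫ g)] : f = g := by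
  obtain ⟨p, hp, rfl⟩ := h
  rw [smulHom_comp_right, smulHom_eq, smulHom_unit] at hk
  have : p.hom = 𝟙 _ := by rw [← cancel_mono (k ≫ g), hk, Category.id_comp]
  rw [this, smulHom_id]

/-- A representative can be rescaled to have a given value on a morphism. -/
lemma exists_rescale {X Y Z : C} (f : X ⟶ Y) (k : Z ⟶ X) (l : Z ⟶ Y) (h : P.rel (k ≫ f) l) :
    ∃ f' : X ⟶ Y, P.proj.map f' = P.proj.map f ∧ k ≫ f' = l := by
  obtain ⟨p, hp, e⟩ := h
  refine ⟨smulHom p⁻¹.hom f, proj_smulHom (P.carrier.inv_mem hp) f, ?_⟩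
  rw [smulHom_comp_right, e, smulHom_smulHom]
  exact (congrArg (fun t => smulHom t l) p.inv_hom_id).trans (smulHom_id l)

end GlobalPhases

namespace GPCat

open GlobalPhases

variable {C : Type u} [Category.{v} C] [MonoidalCategory C] {P : GlobalPhases C}
  {W : ∀ ⦃A E : P.Quotient⦄, (A ⟶ E) → (𝟙_ P.Quotient ⟶ E) → Prop}

/-- A representative of the first coprojection. -/
noncomputable def inlRep (X : GPCat W) : X.base.as ⟶ X.tot.as :=
  (P.proj.map_surjective X.inl).choose

lemma proj_inlRep (X : GPCat W) : P.proj.map (inlRep X) = X.inl :=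
  (P.proj.map_surjective X.inl).choose_spec

/-- A representative of the second coprojection. -/
noncomputable def inrRep (X : GPCat W) : 𝟙_ C ⟶ X.tot.as :=
  (P.proj.map_surjective X.inr).choose

lemma proj_inrRep (X : GPCat W) : P.proj.map (inrRep X) = X.inr :=
  (P.proj.map_surjective X.inr).choose_spec

/-- One scalar is spent on making the representative of `f.hom` fix `inrRep`. The scalar still
missing on the first summand is absorbed into `g`. -/
lemma exists_rep {X Y : GPCat W} (f : X ⟶ Y) :
    ∃ (k : X.tot.as ⟶ Y.tot.as) (g : X.base.as ⟶ Y.base.as), P.proj.map k = f.hom ∧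
      inrRep X ≫ k = inrRep Y ∧ inlRep X ≫ k = g ≫ inlRep Y := by
  obtain ⟨k₀, hk₀⟩ := P.proj.map_surjective f.hom
  have h1 : P.proj.map (inrRep X ≫ k₀) = P.proj.map (inrRep Y) :=
    (congrArg₂ (· ≫ ·) (proj_inrRep X) hk₀).trans ((inr_hom f).trans (proj_inrRep Y).symm)
  obtain ⟨k, hk, hk'⟩ := exists_rescale k₀ _ _ (rel_of_proj h1)
  obtain ⟨g₀, hg₀⟩ := P.proj.map_surjective (baseMap f)
  have h2 : P.proj.map (inlRep X ≫ k) = P.proj.map (g₀ ≫ inlRep Y) :=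
    (congrArg₂ (· ≫ ·) (proj_inlRep X) (hk.trans hk₀)).trans ((inl_hom f).trans
      (congrArg₂ (· ≫ ·) hg₀ (proj_inlRep Y)).symm)
  obtain ⟨p, hp, e⟩ := rel_of_proj h2
  exact ⟨k, smulHom p.hom g₀, hk.trans hk₀, hk', by rw [e, smulHom_comp_left]⟩

/-- The representative of a morphism of `GP(A/P)` which preserves the second coprojection. -/
noncomputable def homRep {X Y : GPCat W} (f : X ⟶ Y) : X.tot.as ⟶ Y.tot.as :=
  (exists_rep f).choose

/-- The morphism of `A` induced by a morphism of `GP(A/P)`. -/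
noncomputable def baseRep {X Y : GPCat W} (f : X ⟶ Y) : X.base.as ⟶ Y.base.as :=
  (exists_rep f).choose_spec.choose

lemma proj_homRep {X Y : GPCat W} (f : X ⟶ Y) : P.proj.map (homRep f) = f.hom :=
  (exists_rep f).choose_spec.choose_spec.1

lemma inrRep_homRep {X Y : GPCat W} (f : X ⟶ Y) : inrRep X ≫ homRep f = inrRep Y :=
  (exists_rep f).choose_spec.choose_spec.2.1

lemma inlRep_homRep {X Y : GPCat W} (f : X ⟶ Y) : inlRep X ≫ homRep f = baseRep f ≫ inlRep Y :=
  (exists_rep f).choose_spec.choose_spec.2.2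

variable (hW : Admissible W) (hC : CoprodCat C)

section

include hW hC

lemma nonempty_isColimit_rep (X : GPCat W) :
    Nonempty (IsColimit (BinaryCofan.mk (inlRep X) (inrRep X))) := by
  have := hC.finite
  refine nonempty_isColimit_of_proj (P := P) ?_
  have h := hW.isPhasedCoproduct X
  rw [← proj_inlRep, ← proj_inrRep] at h
  exact h

lemma isCoprojection_inlRep (X : GPCat W) : IsCoprojection (inlRep X) :=
  ⟨_, _, nonempty_isColimit_rep hW hC X⟩

lemma isCoprojection_inrRep (X : GPCat W) : IsCoprojection (inrRep X) := by
  refine ⟨_, inlRep X, ?_⟩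
  have := nonempty_isColimit_rep hW hC X
  rw [nonempty_isColimit_iff] at this ⊢
  refine ⟨fun T f g => ?_, fun T h h' h1 h2 => this.2 T h h' h2 h1⟩
  obtain ⟨h, h1, h2⟩ := this.1 T g f
  exact ⟨h, h2, h1⟩

lemma mono_inlRep (X : GPCat W) : Mono (inlRep X) :=
  have := hC.monic
  (isCoprojection_inlRep hW hC X).mono

lemma mono_inrRep (X : GPCat W) : Mono (inrRep X) :=
  have := hC.monic
  (isCoprojection_inrRep hW hC X).mono

/-- The two representatives differ by a scalar in `P`, which must be the identity since `inrRep Y`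
is monic. -/
lemma homRep_eq {X Y : GPCat W} (f : X ⟶ Y) {k : X.tot.as ⟶ Y.tot.as} (h1 : P.proj.map k = f.hom)
    (h2 : inrRep X ≫ k = inrRep Y) : homRep f = k := by
  have := mono_inrRep hW hC Y
  have hm : Mono (inrRep X ≫ k) := by rwa [h2]
  exact eq_of_rel (rel_of_proj ((proj_homRep f).trans h1.symm)) (inrRep X)
    ((inrRep_homRep f).trans h2.symm)

lemma baseRep_eq {X Y : GPCat W} (f : X ⟶ Y) {g : X.base.as ⟶ Y.base.as}
    (h : inlRep X ≫ homRep f = g ≫ inlRep Y) : baseRep f = g := by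
  have := mono_inlRep hW hC Y
  rw [← cancel_mono (inlRep Y), ← inlRep_homRep, h]

lemma homRep_comp {X Y Z : GPCat W} (f : X ⟶ Y) (g : Y ⟶ Z) :
    homRep (f ≫ g) = homRep f ≫ homRep g :=
  homRep_eq hW hC _ (congrArg₂ (· ≫ ·) (proj_homRep f) (proj_homRep g))
    (by rw [← Category.assoc, inrRep_homRep, inrRep_homRep])

lemma homRep_id (X : GPCat W) : homRep (𝟙 X) = 𝟙 _ :=
  homRep_eq hW hC _ rfl (Category.comp_id _)

end

/-- The functor `GP(A/P) ⥤ A`. -/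
noncomputable def repFunctor : GPCat W ⥤ C where
  obj X := X.base.as
  map f := baseRep f
  map_id X := baseRep_eq hW hC _ (by rw [homRep_id hW hC, Category.comp_id, Category.id_comp])
  map_comp f g := baseRep_eq hW hC _ (by
    rw [homRep_comp hW hC, ← Category.assoc, inlRep_homRep, Category.assoc, inlRep_homRep,
      Category.assoc])

instance : (repFunctor hW hC).Faithful where
  map_injective {X Y} f g h := by
    have h : baseRep f = baseRep g := h
    have e : homRep f = homRep g := ((nonempty_isColimit_iff _ _).1
      (nonempty_isColimit_rep hW hC X)).2 _ _ _ (by rw [inlRep_homRep, inlRep_homRep, h])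
      (by rw [inrRep_homRep, inrRep_homRep])
    exact hom_ext ((proj_homRep f).symm.trans ((congrArg P.proj.map e).trans (proj_homRep g)))

instance : (repFunctor hW hC).Full where
  map_surjective {X Y} g := by
    obtain ⟨k, h1, h2⟩ := ((nonempty_isColimit_iff _ _).1 (nonempty_isColimit_rep hW hC X)).1 _
      (g ≫ inlRep Y) (inrRep Y)
    let f : X ⟶ Y := ⟨P.proj.map k, ⟨P.proj.map g,
      (congrArg (· ≫ P.proj.map k) (proj_inlRep X)).symm.trans ((congrArg P.proj.map h1).trans
        (congrArg (P.proj.map g ≫ ·) (proj_inlRep Y)))⟩,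
      (congrArg (· ≫ P.proj.map k) (proj_inrRep X)).symm.trans ((congrArg P.proj.map h2).trans
        (proj_inrRep Y))⟩
    exact ⟨f, baseRep_eq hW hC f (by rw [homRep_eq hW hC f rfl h2]; exact h1)⟩

instance : (repFunctor hW hC).EssSurj where
  mem_essImage A := by
    obtain ⟨X, hX⟩ := hW.exists_over ⟨A⟩
    exact ⟨X, ⟨eqToIso (congrArg CategoryTheory.Quotient.as hX)⟩⟩

include hW in
lemma proj_baseRep {X Y : GPCat W} (f : X ⟶ Y) : P.proj.map (baseRep f) = baseMap f :=
  (hW.baseMap_eq f ((congrArg₂ (· ≫ ·) (proj_inlRep X) (proj_homRep f)).symm.trans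
    ((congrArg P.proj.map (inlRep_homRep f)).trans
      (congrArg (P.proj.map (baseRep f) ≫ ·) (proj_inlRep Y))))).symm

section Tensor

variable [MonoidalCategory (GPCat W)] (τ : TensorStructure W)

/-- The same normalization as in `exists_rep`: rescale `c` on the second coprojection, and let the
base isomorphism absorb the scalar on the first. -/
lemma exists_cRep (X Y : GPCat W) : ∃ (k : (X ⊗ Y).tot.as ⟶ X.tot.as ⊗ Y.tot.as)
    (m : (X ⊗ Y).base.as ≅ X.base.as ⊗ Y.base.as), P.proj.map k = τ.c X Y ∧
      inrRep (X ⊗ Y) ≫ k = (ρ_ (𝟙_ C)).inv ≫ (inrRep X ⊗ₘ inrRep Y) ∧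
      inlRep (X ⊗ Y) ≫ k = m.hom ≫ (inlRep X ⊗ₘ inlRep Y) ∧
      P.proj.map m.hom = (τ.baseIso X Y).hom := by
  obtain ⟨k₀, hk₀⟩ := P.proj.map_surjective (τ.c X Y)
  have h1 : P.proj.map (inrRep (X ⊗ Y) ≫ k₀) =
      P.proj.map ((ρ_ (𝟙_ C)).inv ≫ (inrRep X ⊗ₘ inrRep Y)) :=
    (congrArg₂ (· ≫ ·) (proj_inrRep (X ⊗ Y)) hk₀).trans ((τ.inr_c X Y).trans
      (congrArg (P.proj.map (ρ_ (𝟙_ C)).inv ≫ ·)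
        ((congrArg₂ (· ⊗ₘ ·) (proj_inrRep X) (proj_inrRep Y)).symm.trans (P.proj_tensorHom _ _))))
  obtain ⟨k, hk, hk'⟩ := exists_rescale k₀ _ _ (rel_of_proj h1)
  obtain ⟨m₀, hm₀⟩ := P.proj.map_surjective (τ.baseIso X Y).hom
  have h2 : P.proj.map (inlRep (X ⊗ Y) ≫ k) = P.proj.map (m₀ ≫ (inlRep X ⊗ₘ inlRep Y)) :=
    (congrArg₂ (· ≫ ·) (proj_inlRep (X ⊗ Y)) (hk.trans hk₀)).trans ((τ.inl_c' X Y).trans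
      (congrArg₂ (· ≫ ·) hm₀.symm
        ((congrArg₂ (· ⊗ₘ ·) (proj_inlRep X) (proj_inlRep Y)).symm.trans (P.proj_tensorHom _ _))))
  obtain ⟨p, hp, e⟩ := rel_of_proj h2
  have hm : P.proj.map (smulHom p.hom m₀) = (τ.baseIso X Y).hom :=
    (proj_smulHom hp m₀).trans hm₀
  have : IsIso (smulHom p.hom m₀) := isIso_of_proj (P := P) _
    (hm ▸ (inferInstance : IsIso (τ.baseIso X Y).hom))
  exact ⟨k, asIso (smulHom p.hom m₀), hk.trans hk₀, hk', by
    rw [e, asIso_hom, smulHom_comp_left], hm⟩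

/-- The representative of `c`. -/
noncomputable def cRep (X Y : GPCat W) : (X ⊗ Y).tot.as ⟶ X.tot.as ⊗ Y.tot.as :=
  (exists_cRep τ X Y).choose

/-- The comparison of tensor products for the functor `GP(A/P) ⥤ A`. -/
noncomputable def repμ (X Y : GPCat W) : (X ⊗ Y).base.as ≅ X.base.as ⊗ Y.base.as :=
  (exists_cRep τ X Y).choose_spec.choose

lemma proj_cRep (X Y : GPCat W) : P.proj.map (cRep τ X Y) = τ.c X Y :=
  (exists_cRep τ X Y).choose_spec.choose_spec.1

lemma inrRep_cRep (X Y : GPCat W) :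
    inrRep (X ⊗ Y) ≫ cRep τ X Y = (ρ_ (𝟙_ C)).inv ≫ (inrRep X ⊗ₘ inrRep Y) :=
  (exists_cRep τ X Y).choose_spec.choose_spec.2.1

lemma inlRep_cRep (X Y : GPCat W) :
    inlRep (X ⊗ Y) ≫ cRep τ X Y = (repμ τ X Y).hom ≫ (inlRep X ⊗ₘ inlRep Y) :=
  (exists_cRep τ X Y).choose_spec.choose_spec.2.2.1

lemma proj_repμ (X Y : GPCat W) : P.proj.map (repμ τ X Y).hom = (τ.baseIso X Y).hom :=
  (exists_cRep τ X Y).choose_spec.choose_spec.2.2.2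

include hW hC

/-- The equation holds in the quotient, hence up to a scalar. Both sides agree on `inrRep (X ⊗ X')`,
where the common value is monic, so the scalar is trivial. -/
lemma homRep_tensorHom_cRep {X Y X' Y' : GPCat W} (f : X ⟶ Y) (g : X' ⟶ Y') :
    homRep (f ⊗ₘ g) ≫ cRep τ Y Y' = cRep τ X X' ≫ (homRep f ⊗ₘ homRep g) := by
  have e : inrRep (X ⊗ X') ≫ cRep τ X X' ≫ (homRep f ⊗ₘ homRep g) =
      (ρ_ (𝟙_ C)).inv ≫ (inrRep Y ⊗ₘ inrRep Y') := by
    rw [← Category.assoc, inrRep_cRep, Category.assoc, tensorHom_comp_tensorHom, inrRep_homRep,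
      inrRep_homRep]
  have := IsCoprojection.mono_tensor hC (isCoprojection_inrRep hW hC Y)
    (isCoprojection_inrRep hW hC Y')
  have hm : Mono (inrRep (X ⊗ X') ≫ cRep τ X X' ≫ (homRep f ⊗ₘ homRep g)) := by
    rw [e]
    infer_instance
  refine eq_of_rel (P := P) (rel_of_proj ?_) (inrRep (X ⊗ X')) ?_
  · exact (congrArg₂ (· ≫ ·) (proj_homRep (f ⊗ₘ g)) (proj_cRep τ Y Y')).trans
      ((τ.tensorHom_c f g).trans (congrArg₂ (· ≫ ·) (proj_cRep τ X X').symm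
        ((congrArg₂ (· ⊗ₘ ·) (proj_homRep f) (proj_homRep g)).symm.trans (P.proj_tensorHom _ _))))
  · rw [e, ← Category.assoc, inrRep_homRep, inrRep_cRep]

lemma baseRep_tensorHom {X Y X' Y' : GPCat W} (f : X ⟶ Y) (g : X' ⟶ Y') :
    baseRep (f ⊗ₘ g) ≫ (repμ τ Y Y').hom = (repμ τ X X').hom ≫ (baseRep f ⊗ₘ baseRep g) := by
  have := IsCoprojection.mono_tensor hC (isCoprojection_inlRep hW hC Y)
    (isCoprojection_inlRep hW hC Y')
  rw [← cancel_mono (inlRep Y ⊗ₘ inlRep Y'), Category.assoc, ← inlRep_cRep, ← Category.assoc,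
    ← inlRep_homRep, Category.assoc, homRep_tensorHom_cRep hW hC, ← Category.assoc, inlRep_cRep,
    Category.assoc, Category.assoc, tensorHom_comp_tensorHom, tensorHom_comp_tensorHom,
    inlRep_homRep, inlRep_homRep]

lemma homRep_associator_cRep (X Y Z : GPCat W) :
    homRep (α_ X Y Z).hom ≫ cRep τ X (Y ⊗ Z) ≫ X.tot.as ◁ cRep τ Y Z =
      cRep τ (X ⊗ Y) Z ≫ cRep τ X Y ▷ Z.tot.as ≫ (α_ X.tot.as Y.tot.as Z.tot.as).hom := by
  have e : inrRep ((X ⊗ Y) ⊗ Z) ≫ cRep τ (X ⊗ Y) Z ≫ cRep τ X Y ▷ Z.tot.as ≫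
      (α_ X.tot.as Y.tot.as Z.tot.as).hom = (ρ_ (𝟙_ C)).inv ≫ (ρ_ (𝟙_ C)).inv ▷ 𝟙_ C ≫
      (α_ _ _ _).hom ≫ (inrRep X ⊗ₘ (inrRep Y ⊗ₘ inrRep Z)) := by
    rw [← Category.assoc, inrRep_cRep, Category.assoc, tensorHom_comp_whiskerRight_assoc',
      inrRep_cRep, ← whiskerRight_comp_tensorHom_assoc', associator_naturality]
  have := IsCoprojection.mono_tensor_tensor hC (isCoprojection_inrRep hW hC X)
    (isCoprojection_inrRep hW hC Y) (isCoprojection_inrRep hW hC Z)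
  have hm : Mono (inrRep ((X ⊗ Y) ⊗ Z) ≫ cRep τ (X ⊗ Y) Z ≫ cRep τ X Y ▷ Z.tot.as ≫
      (α_ X.tot.as Y.tot.as Z.tot.as).hom) := by
    rw [e]
    infer_instance
  refine eq_of_rel (P := P) (rel_of_proj ?_) (inrRep ((X ⊗ Y) ⊗ Z)) ?_
  · exact (congrArg₂ (· ≫ ·) (proj_homRep (α_ X Y Z).hom) (congrArg₂ (· ≫ ·)
      (proj_cRep τ X (Y ⊗ Z)) (congrArg (X.tot ◁ ·) (proj_cRep τ Y Z)))).trans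
      ((τ.associator_c X Y Z).trans (congrArg₂ (· ≫ ·) (proj_cRep τ (X ⊗ Y) Z)
        (congrArg (· ▷ Z.tot ≫ (α_ X.tot Y.tot Z.tot).hom) (proj_cRep τ X Y))).symm)
  · rw [e, ← Category.assoc, inrRep_homRep, ← Category.assoc, inrRep_cRep, Category.assoc,
      tensorHom_comp_whiskerLeft', inrRep_cRep, ← whiskerLeft_comp_tensorHom']
    have h : (ρ_ (𝟙_ C)).inv ≫ 𝟙_ C ◁ (ρ_ (𝟙_ C)).inv =
        (ρ_ (𝟙_ C)).inv ≫ (ρ_ (𝟙_ C)).inv ▷ 𝟙_ C ≫ (α_ _ _ _).hom := by monoidal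
    rw [reassoc_of% h]

lemma baseRep_associator (X Y Z : GPCat W) :
    baseRep (α_ X Y Z).hom ≫ (repμ τ X (Y ⊗ Z)).hom ≫ X.base.as ◁ (repμ τ Y Z).hom =
      (repμ τ (X ⊗ Y) Z).hom ≫ (repμ τ X Y).hom ▷ Z.base.as ≫
        (α_ X.base.as Y.base.as Z.base.as).hom := by
  have := IsCoprojection.mono_tensor_tensor hC (isCoprojection_inlRep hW hC X)
    (isCoprojection_inlRep hW hC Y) (isCoprojection_inlRep hW hC Z)
  have e := congrArg (inlRep ((X ⊗ Y) ⊗ Z) ≫ ·) (homRep_associator_cRep hW hC τ X Y Z)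
  rw [← Category.assoc, inlRep_homRep, Category.assoc, ← Category.assoc (inlRep _), inlRep_cRep,
    ← Category.assoc (inlRep _), inlRep_cRep, Category.assoc, Category.assoc,
    tensorHom_comp_whiskerLeft',
    tensorHom_comp_whiskerRight_assoc', inlRep_cRep, inlRep_cRep, ← whiskerLeft_comp_tensorHom',
    ← whiskerRight_comp_tensorHom_assoc', associator_naturality] at e
  rw [← cancel_mono (inlRep X ⊗ₘ (inlRep Y ⊗ₘ inlRep Z))]
  simpa only [Category.assoc] using e

omit hW hC in
/-- The tensorator of the functor `GP(A/P) ⥤ A`. -/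
noncomputable def repTensorator : Tensorator (repFunctor hW hC) :=
  Tensorator.ofInv (F := repFunctor hW hC) (repμ τ)
    (fun f Z => by
      have := baseRep_tensorHom hW hC τ f (𝟙 Z)
      rw [tensorHom_id] at this
      refine this.trans ?_
      rw [← tensorHom_id]
      exact congrArg (fun t => (repμ τ _ Z).hom ≫ (baseRep f ⊗ₘ t)) ((repFunctor hW hC).map_id Z))
    (fun Z f => by
      have := baseRep_tensorHom hW hC τ (𝟙 Z) f
      rw [id_tensorHom] at this
      refine this.trans ?_
      rw [← id_tensorHom]
      exact congrArg (fun t => (repμ τ Z _).hom ≫ (t ⊗ₘ baseRep f)) ((repFunctor hW hC).map_id Z))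
    (baseRep_associator hW hC τ)

omit hW hC in
include τ in
lemma exists_unit_repFunctor : Nonempty (𝟙_ C ≅ (𝟙_ (GPCat W)).base.as) := by
  obtain ⟨k, hk⟩ := P.proj.map_surjective τ.unitIso.inv
  have : IsIso k := isIso_of_proj (P := P) _ (hk ▸ (inferInstance : IsIso τ.unitIso.inv))
  exact ⟨asIso k⟩

/-- The scalar `s` is a phase exactly when `baseRep s.hom` is a multiple of the identity by some `p`
in `P`. Conjugation by `e` then returns `p` itself. -/
lemma matchesPhases_repFunctor [(repFunctor hW hC).Monoidal] {Q : GlobalPhases (GPCat W)}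
    (hQ : Q.carrier = phases W) (e : 𝟙_ C ≅ (𝟙_ (GPCat W)).base.as) :
    MatchesPhases (repFunctor hW hC) Q P := by
  rw [matchesPhases_iff _ _ _ e]
  intro s
  rw [hQ]
  refine (TensorStructure.mem_phases_iff hW s).trans ?_
  rw [← proj_baseRep hW]
  constructor
  · intro h
    obtain ⟨p, hp, h⟩ := rel_of_proj (P := P) (f := baseRep s.hom) (g := 𝟙 _) h
    have : e ≪≫ (repFunctor hW hC).mapIso s ≪≫ e.symm = p := by
      ext
      change e.hom ≫ baseRep s.hom ≫ e.inv = p.hom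
      rw [h, smulHom_comp_left, Category.id_comp, smulHom_comp_right, Iso.hom_inv_id, smulHom_unit]
    exact (congrArg (fun x : Aut (𝟙_ C) => x ∈ P.carrier) this).mpr hp
  · intro h
    refine proj_map_eq_iff (f := baseRep s.hom) (g := 𝟙 _).2 ⟨_, h, ?_⟩
    change _ = smulHom (e.hom ≫ baseRep s.hom ≫ e.inv) _
    rw [← cancel_epi e.hom, ← cancel_mono e.inv, smulHom_comp_right, smulHom_comp_left,
      Category.comp_id, Iso.hom_inv_id, smulHom_unit, Category.assoc]

include τ in
theorem phaseMonEquiv_quotient {Q : GlobalPhases (GPCat W)} (hQ : Q.carrier = phases W) :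
    PhaseMonEquiv P Q := by
  obtain ⟨e⟩ := exists_unit_repFunctor τ
  obtain ⟨M, -⟩ := (repTensorator hW hC τ).exists_monoidal e
  exact PhaseMonEquiv.symm ⟨_, M, isEquivalence_of _ inferInstance inferInstance inferInstance,
    matchesPhases_repFunctor hW hC hQ e⟩

end Tensor

end GPCat

/-! ### Finite biproducts from binary ones -/

section Biproducts

variable {C : Type u} [Category.{v} C] [HasZeroMorphisms C]

lemma nonempty_isBilimit_iff {ι : Type w} {X : ι → C} (b : Bicone X) : Nonempty b.IsBilimit ↔
    ((∀ (T : C) (f : ∀ i, X i ⟶ T), ∃ h : b.pt ⟶ T, ∀ i, b.ι i ≫ h = f i) ∧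
      ∀ (T : C) (h h' : b.pt ⟶ T), (∀ i, b.ι i ≫ h = b.ι i ≫ h') → h = h') ∧
    ((∀ (T : C) (f : ∀ i, T ⟶ X i), ∃ h : T ⟶ b.pt, ∀ i, h ≫ b.π i = f i) ∧
      ∀ (T : C) (h h' : T ⟶ b.pt), (∀ i, h ≫ b.π i = h' ≫ b.π i) → h = h') := by
  constructor
  · rintro ⟨hl, hc⟩
    exact ⟨⟨fun T f => ⟨hc.desc (Cofan.mk T f), fun i => hc.fac (Cofan.mk T f) ⟨i⟩⟩,
      fun T h h' e => hc.hom_ext fun i => e i.as⟩,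
      ⟨fun T f => ⟨hl.lift (Fan.mk T f), fun i => hl.fac (Fan.mk T f) ⟨i⟩⟩,
      fun T h h' e => hl.hom_ext fun i => e i.as⟩⟩
  · rintro ⟨⟨h1, h2⟩, h3, h4⟩
    choose d hd using h1
    choose l hl using h3
    exact ⟨⟨{ lift := fun s => l s.pt fun i => s.π.app ⟨i⟩
              fac := fun s i => hl _ _ i.as
              uniq := fun s m hm => h4 _ _ _ fun i => (hm ⟨i⟩).trans (hl s.pt (fun i => s.π.app ⟨i⟩) i).symm },
            { desc := fun s => d s.pt fun i => s.ι.app ⟨i⟩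
              fac := fun s i => hd _ _ i.as
              uniq := fun s m hm => h2 _ _ _ fun i => (hm ⟨i⟩).trans (hd s.pt (fun i => s.ι.app ⟨i⟩) i).symm }⟩⟩

/-- `Z` with the given morphisms is a biproduct of `X` and `Y`. -/
structure IsBiproduct {X Y Z : C} (i : X ⟶ Z) (j : Y ⟶ Z) (p : Z ⟶ X) (q : Z ⟶ Y) : Prop where
  inl_fst : i ≫ p = 𝟙 X
  inr_fst : j ≫ p = 0
  inl_snd : i ≫ q = 0
  inr_snd : j ≫ q = 𝟙 Y
  exists_desc : ∀ {T : C} (f : X ⟶ T) (g : Y ⟶ T), ∃ h : Z ⟶ T, i ≫ h = f ∧ j ≫ h = g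
  desc_unique : ∀ {T : C} (h h' : Z ⟶ T), i ≫ h = i ≫ h' → j ≫ h = j ≫ h' → h = h'
  exists_lift : ∀ {T : C} (f : T ⟶ X) (g : T ⟶ Y), ∃ h : T ⟶ Z, h ≫ p = f ∧ h ≫ q = g
  lift_unique : ∀ {T : C} (h h' : T ⟶ Z), h ≫ p = h' ≫ p → h ≫ q = h' ≫ q → h = h'

/-- Finite biproducts from binary biproducts, with a relation between the coprojections and
the projections. -/
theorem exists_finite_isBilimit (R : ∀ {X Y : C}, (X ⟶ Y) → (Y ⟶ X) → Prop)
    (hR : ∀ {X Y Z : C} {i : X ⟶ Y} {j : Y ⟶ Z} {p : Y ⟶ X} {q : Z ⟶ Y}, R i p → R j q →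
      R (i ≫ j) (q ≫ p))
    (h₀ : ∃ Z : C, 𝟙 Z = 0)
    (h₂ : ∀ X Y : C, ∃ (Z : C) (i : X ⟶ Z) (j : Y ⟶ Z) (p : Z ⟶ X) (q : Z ⟶ Y),
      IsBiproduct i j p q ∧ R i p ∧ R j q) (n : ℕ) (X : Fin n → C) :
    ∃ b : Bicone X, Nonempty b.IsBilimit ∧ ∀ i, R (b.ι i) (b.π i) := by
  induction n with
  | zero =>
    obtain ⟨Z, hZ⟩ := h₀
    refine ⟨⟨Z, fun i => i.elim0, fun i => i.elim0, fun i => i.elim0⟩,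
      (nonempty_isBilimit_iff _).2 ⟨⟨fun T f => ⟨0, fun i => i.elim0⟩, fun T h h' _ => ?_⟩,
        fun T f => ⟨0, fun i => i.elim0⟩, fun T h h' _ => ?_⟩, fun i => i.elim0⟩
    · exact (Category.id_comp h).symm.trans (by rw [hZ, zero_comp, ← zero_comp (f := h'), ← hZ,
        Category.id_comp])
    · exact (Category.comp_id h).symm.trans (by rw [hZ, comp_zero, ← comp_zero (f := h'), ← hZ,
        Category.comp_id])
  | succ n ih =>
    obtain ⟨b, hb, hbR⟩ := ih fun i => X i.succ
    rw [nonempty_isBilimit_iff] at hb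
    obtain ⟨⟨b1, b2⟩, b3, b4⟩ := hb
    -- The first object is added to the biproduct of the remaining ones. The other coprojections
    -- become composites with `j`, which is what `hR` handles.
    obtain ⟨Z, i, j, p, q, h, hi, hj⟩ := h₂ (X 0) b.pt
    refine ⟨⟨Z, fun k => Fin.cases p (fun l => q ≫ b.π l) k,
      fun k => Fin.cases i (fun l => b.ι l ≫ j) k, fun k l => ?_⟩,
      (nonempty_isBilimit_iff _).2 ⟨⟨fun T f => ?_, fun T k k' e => ?_⟩,
        fun T f => ?_, fun T k k' e => ?_⟩, fun k => ?_⟩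
    · refine Fin.cases ?_ (fun k => ?_) k <;> refine Fin.cases ?_ (fun l => ?_) l
      · simpa using h.inl_fst
      · rw [dif_neg (Fin.succ_ne_zero l).symm]
        simp [reassoc_of% h.inl_snd]
      · rw [dif_neg (Fin.succ_ne_zero k)]
        simp [h.inr_fst]
      · have e : (b.ι k ≫ j) ≫ q ≫ b.π l = b.ι k ≫ b.π l := by
          rw [Category.assoc, reassoc_of% h.inr_snd]
        refine e.trans ((b.ι_π k l).trans ?_)
        by_cases hkl : k = l
        · subst hkl
          simp
        · rw [dif_neg hkl, dif_neg fun e => hkl (Fin.succ_injective _ e)]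
    · obtain ⟨d, hd⟩ := b1 T fun l => f l.succ
      obtain ⟨k, k1, k2⟩ := h.exists_desc (f 0) d
      refine ⟨k, fun l => ?_⟩
      refine Fin.cases k1 (fun l => ?_) l
      exact (Category.assoc _ _ _).trans ((congrArg (b.ι l ≫ ·) k2).trans (hd l))
    · refine h.desc_unique k k' (e 0) (b2 _ _ _ fun l => ?_)
      have := e l.succ
      simp only [Fin.cases_succ, Category.assoc] at this
      exact this
    · obtain ⟨d, hd⟩ := b3 T fun l => f l.succ
      obtain ⟨k, k1, k2⟩ := h.exists_lift (f 0) d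
      refine ⟨k, fun l => ?_⟩
      refine Fin.cases k1 (fun l => ?_) l
      exact (Category.assoc _ _ _).symm.trans ((congrArg (· ≫ b.π l) k2).trans (hd l))
    · refine h.lift_unique k k' (e 0) (b4 _ _ _ fun l => ?_)
      have := e l.succ
      simp only [Fin.cases_succ] at this
      simpa using this
    · exact Fin.cases hi (fun l => hR (hbR l) hj) k

end Biproducts

/-! ### Phased biproducts -/

section PhasedBiproducts

variable {C : Type u} [Category.{v} C]

section

variable [HasZeroMorphisms C] {A B E : C} {κA : A ⟶ E} {κB : B ⟶ E}

lemma IsPhasedBiproduct.comp_iso {πA : E ⟶ A} {πB : E ⟶ B}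
    (h : IsPhasedBiproduct κA κB πA πB) {E' : C} (e : E ⟶ E') [IsIso e] :
    IsPhasedBiproduct (κA ≫ e) (κB ≫ e) (inv e ≫ πA) (inv e ≫ πB) where
  inl_fst := by simp [h.inl_fst]
  inr_fst := by simp [h.inr_fst]
  inl_snd := by simp [h.inl_snd]
  inr_snd := by simp [h.inr_snd]
  coprod := h.coprod.comp_iso e
  prod :=
    { exists_lift := fun f g => by
        obtain ⟨k, h1, h2⟩ := h.prod.exists_lift f g
        exact ⟨k ≫ e, by simpa using h1, by simpa using h2⟩
      exists_phase := fun k k' h1 h2 => by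
        obtain ⟨U, hU, eU⟩ := h.prod.exists_phase (k ≫ inv e) (k' ≫ inv e) (by simpa using h1)
          (by simpa using h2)
        refine ⟨inv e ≫ U ≫ e, ⟨?_, ?_⟩, ?_⟩
        · simp [hU.1]
        · simp [hU.2]
        · rw [← cancel_mono (inv e), eU]
          simp }
  phases U := by
    have := h.phases (e ≫ U ≫ inv e)
    simp only [IsPhase, Category.assoc, ← cancel_mono e, ← cancel_epi e, IsIso.inv_hom_id,
      Category.comp_id, IsIso.hom_inv_id_assoc] at this ⊢
    exact this

/-- Precomposition with a phase leaves the projection unchanged, so its components determine it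
uniquely. -/
lemma IsPhasedBiproduct.eq_fst {πA : E ⟶ A} {πB : E ⟶ B}
    (h : IsPhasedBiproduct κA κB πA πB) {p : E ⟶ A} (h1 : κA ≫ p = 𝟙 A) (h2 : κB ≫ p = 0) :
    p = πA :=
  h.coprod.eq_of_components (h.inl_fst.trans h1.symm) (h.inr_fst.trans h2.symm)
    fun U hU => ((h.phases U).1 hU).1

lemma IsPhasedBiproduct.eq_snd {πA : E ⟶ A} {πB : E ⟶ B}
    (h : IsPhasedBiproduct κA κB πA πB) {q : E ⟶ B} (h1 : κA ≫ q = 0) (h2 : κB ≫ q = 𝟙 B) :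
    q = πB :=
  h.coprod.eq_of_components (h.inl_snd.trans h1.symm) (h.inr_snd.trans h2.symm)
    fun U hU => ((h.phases U).1 hU).2

lemma IsPhasedBiproductFamily.binary {X : Fin 2 → C} {b : Bicone X}
    (hb : IsPhasedBiproductFamily b) :
    IsPhasedBiproduct (b.ι 0) (b.ι 1) (b.π 0) (b.π 1) := by
  refine ⟨bicone_ι_π_self b 0, bicone_ι_π_ne b (by decide), bicone_ι_π_ne b (by decide), bicone_ι_π_self b 1,
    ⟨fun {T} f g => ?_, fun {T} k k' h1 h2 => ?_⟩,
    ⟨fun {T} f g => ?_, fun {T} k k' h1 h2 => ?_⟩, fun U => ?_⟩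
  · obtain ⟨k, hk⟩ := hb.coprod.exists_desc (T := T) (Fin.cons f (Fin.cons g fun l => l.elim0))
    exact ⟨k, hk 0, hk 1⟩
  · obtain ⟨U, hU, e⟩ := hb.coprod.exists_phase k k' (Fin.forall_fin_two.2 ⟨h1, h2⟩)
    exact ⟨U, ⟨hU 0, hU 1⟩, e⟩
  · obtain ⟨k, hk⟩ := hb.prod.exists_lift (T := T) (Fin.cons f (Fin.cons g fun l => l.elim0))
    exact ⟨k, hk 0, hk 1⟩
  · obtain ⟨U, hU, e⟩ := hb.prod.exists_phase k k' (Fin.forall_fin_two.2 ⟨h1, h2⟩)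
    exact ⟨U, ⟨hU 0, hU 1⟩, e⟩
  · have := hb.phases U
    simp only [Fin.forall_fin_two] at this
    exact this

variable (C) in
/-- Binary phased biproducts exist. -/
def HasBinaryPhasedBiproducts : Prop := ∀ A B : C, ∃ (E : C) (κA : A ⟶ E) (κB : B ⟶ E)
  (πA : E ⟶ A) (πB : E ⟶ B), IsPhasedBiproduct κA κB πA πB

lemma hasBinaryPhasedBiproducts_of_finite (h : ∀ (n : ℕ) (X : Fin n → C),
    ∃ b : Bicone X, IsPhasedBiproductFamily b) : HasBinaryPhasedBiproducts C := by
  intro A B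
  obtain ⟨b, hb⟩ := h 2 ![A, B]
  exact ⟨b.pt, b.ι 0, b.ι 1, b.π 0, b.π 1, hb.binary⟩

namespace HasBinaryPhasedBiproducts

variable (hC : HasBinaryPhasedBiproducts C)

include hC

/-- In the presence of phased biproducts, all phased coproducts are phased biproducts. -/
lemma exists_proj (h : IsPhasedCoproduct κA κB) :
    ∃ (πA : E ⟶ A) (πB : E ⟶ B), IsPhasedBiproduct κA κB πA πB := by
  obtain ⟨E', κA', κB', πA', πB', h'⟩ := hC A B
  obtain ⟨e, _, rfl, rfl⟩ := h'.coprod.exists_iso h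
  exact ⟨_, _, h'.comp_iso e⟩

lemma isPhasedBiproduct (h : IsPhasedCoproduct κA κB) {p : E ⟶ A} {q : E ⟶ B}
    (h1 : κA ≫ p = 𝟙 A) (h2 : κB ≫ p = 0) (h3 : κA ≫ q = 0) (h4 : κB ≫ q = 𝟙 B) :
    IsPhasedBiproduct κA κB p q := by
  obtain ⟨πA, πB, h'⟩ := hC.exists_proj h
  rwa [h'.eq_fst h1 h2, h'.eq_snd h3 h4]

lemma monicPhasedCoproducts : MonicPhasedCoproducts C := fun A B E κA κB h => by
  obtain ⟨πA, πB, h'⟩ := hC.exists_proj h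
  have h1 : Mono (κA ≫ πA) := by rw [h'.inl_fst]; infer_instance
  have h2 : Mono (κB ≫ πB) := by rw [h'.inr_snd]; infer_instance
  exact ⟨mono_of_mono _ πA, mono_of_mono _ πB⟩

/-- A diagonal `f` commutes with the projections. Hence `U ≫ f` and `f` have the same projections
and differ by a phase of the target, because the target is also a phased product with the same
phases. -/
lemma transitivePhases : TransitivePhases C := by
  rintro A B E A' B' E' κA κB κA' κB' h h' f ⟨g, hg⟩ ⟨k, hk⟩ U hU
  obtain ⟨πA, πB, hE⟩ := hC.exists_proj h
  obtain ⟨πA', πB', hE'⟩ := hC.exists_proj h'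
  have e1 : f ≫ πA' = πA ≫ g := h.eq_of_components
    (by rw [reassoc_of% hE.inl_fst, reassoc_of% hg, hE'.inl_fst, Category.comp_id])
    (by rw [reassoc_of% hE.inr_fst, reassoc_of% hk, hE'.inr_fst, zero_comp, comp_zero])
    fun V hV => by rw [reassoc_of% ((hE.phases V).1 hV).1]
  have e2 : f ≫ πB' = πB ≫ k := h.eq_of_components
    (by rw [reassoc_of% hE.inl_snd, reassoc_of% hg, hE'.inl_snd, zero_comp, comp_zero])
    (by rw [reassoc_of% hE.inr_snd, reassoc_of% hk, hE'.inr_snd, Category.comp_id])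
    fun V hV => by rw [reassoc_of% ((hE.phases V).1 hV).2]
  obtain ⟨V, hV, e⟩ := hE'.prod.exists_phase f (U ≫ f)
    (by rw [Category.assoc, e1, reassoc_of% ((hE.phases U).1 hU).1])
    (by rw [Category.assoc, e2, reassoc_of% ((hE.phases U).1 hU).2])
  exact ⟨V, (hE'.phases V).2 hV, e⟩

end HasBinaryPhasedBiproducts

end

theorem PhasedBiprodCat.phasedCoprodCat [MonoidalCategory C] (hC : PhasedBiprodCat C) :
    PhasedCoprodCat C := by
  obtain ⟨⟨_, h⟩, hd⟩ := hC
  have h2 := hasBinaryPhasedBiproducts_of_finite h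
  exact
    { finite := fun n X => by
        obtain ⟨b, hb⟩ := h n X
        exact ⟨b.pt, b.ι, hb.coprod⟩
      monic := h2.monicPhasedCoproducts
      distrib := hd
      transitive := h2.transitivePhases }

theorem BiprodCat.coprodCat [MonoidalCategory C] (hC : BiprodCat C) : CoprodCat C := by
  obtain ⟨⟨_, _⟩, hd⟩ := hC
  exact ⟨inferInstance, inferInstance, hd⟩

end PhasedBiproducts

/-! ### Phased biproducts in `A/P` -/

namespace GlobalPhases

variable {C : Type u} [Category.{v} C] [MonoidalCategory C] {P : GlobalPhases C}
  [HasZeroMorphisms C]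

instance : HasZeroMorphisms P.Quotient where
  zero X Y := ⟨P.proj.map (0 : X.as ⟶ Y.as)⟩
  comp_zero := by
    rintro _ _ ⟨f⟩ Z
    exact congrArg P.proj.map (comp_zero (f := f) (Z := Z.as))
  zero_comp := by
    rintro X _ _ ⟨f⟩
    exact congrArg P.proj.map (zero_comp (f := f) (X := X.as))

lemma smulHom_zero (s : 𝟙_ C ⟶ 𝟙_ C) (X Y : C) : smulHom s (0 : X ⟶ Y) = 0 := by
  rw [smulHom_eq, comp_zero]

/-- The image of a bicone in the quotient. -/
def projBicone {n : ℕ} {X : Fin n → P.Quotient} (b : Bicone fun i => (X i).as) : Bicone X where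
  pt := P.proj.obj b.pt
  π i := P.proj.map (b.π i)
  ι i := P.proj.map (b.ι i)
  ι_π i j := by
    refine (congrArg P.proj.map (b.ι_π i j)).trans ?_
    by_cases h : i = j
    · subst h
      simp only [dif_pos, eqToHom_refl]
      rfl
    · rw [dif_neg h, dif_neg h]
      rfl

lemma isPhasedBiproductFamily_projBicone {n : ℕ} {X : Fin n → P.Quotient}
    {b : Bicone fun i => (X i).as} (hb : Nonempty b.IsBilimit) :
    IsPhasedBiproductFamily (projBicone b) := by
  rw [nonempty_isBilimit_iff] at hb
  obtain ⟨⟨b1, b2⟩, b3, b4⟩ := hb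
  refine ⟨⟨?_, ?_⟩, ⟨?_, ?_⟩, ?_⟩
  · rintro ⟨T⟩ f
    choose g hg using fun i => P.proj.map_surjective (f i)
    obtain ⟨h, hh⟩ := b1 T g
    exact ⟨P.proj.map h, fun i => (congrArg P.proj.map (hh i)).trans (hg i)⟩
  · rintro ⟨T⟩ ⟨k⟩ ⟨k'⟩ h
    change b.pt ⟶ T at k k'
    choose p hp e using fun i => rel_of_proj (P := P) (f := b.ι i ≫ k') (g := b.ι i ≫ k) (h i).symm
    obtain ⟨U, hU⟩ := b1 b.pt fun i => smulHom (p i).hom (b.ι i)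
    exact ⟨P.proj.map U, fun i => (congrArg P.proj.map (hU i)).trans (proj_smulHom (hp i) _),
      congrArg P.proj.map (b2 _ k' (U ≫ k) fun i => by
        rw [reassoc_of% hU i, smulHom_comp_left, e i])⟩
  · rintro ⟨T⟩ f
    choose g hg using fun i => P.proj.map_surjective (f i)
    obtain ⟨h, hh⟩ := b3 T g
    exact ⟨P.proj.map h, fun i => (congrArg P.proj.map (hh i)).trans (hg i)⟩
  · rintro ⟨T⟩ ⟨k⟩ ⟨k'⟩ h
    change T ⟶ b.pt at k k'
    choose p hp e using fun i => rel_of_proj (P := P) (f := k' ≫ b.π i) (g := k ≫ b.π i) (h i).symm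
    obtain ⟨U, hU⟩ := b3 b.pt fun i => smulHom (p i).hom (b.π i)
    exact ⟨P.proj.map U, fun i => (congrArg P.proj.map (hU i)).trans (proj_smulHom (hp i) _),
      congrArg P.proj.map (b4 _ k' (k ≫ U) fun i => by
        rw [Category.assoc, hU i, smulHom_comp_right, e i])⟩
  -- Acting by scalars on the coprojections or on the projections amounts to the same thing: off the
  -- diagonal both sides are zero, and on it the scalars coincide.
  · have key : ∀ (p : Fin n → Aut (𝟙_ C)) (i j), smulHom (p i).hom (b.ι i ≫ b.π j) =
        smulHom (p j).hom (b.ι i ≫ b.π j) := fun p i j => by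
      by_cases h : i = j
      · rw [h]
      · rw [b.ι_π, dif_neg h, smulHom_zero, smulHom_zero]
    rintro ⟨U⟩
    change b.pt ⟶ b.pt at U
    constructor
    · intro h j
      choose p hp e using fun i => rel_of_proj (P := P) (f := b.ι i ≫ U) (g := b.ι i) (h i)
      refine (congrArg P.proj.map (b2 _ (U ≫ b.π j) (smulHom (p j).hom (b.π j)) fun i => ?_)).trans
        (proj_smulHom (hp j) _)
      rw [reassoc_of% e i, smulHom_comp_left, smulHom_comp_right, key]
    · intro h i
      choose p hp e using fun j => rel_of_proj (P := P) (f := U ≫ b.π j) (g := b.π j) (h j)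
      refine (congrArg P.proj.map (b4 _ (b.ι i ≫ U) (smulHom (p i).hom (b.ι i)) fun j => ?_)).trans
        (proj_smulHom (hp i) _)
      rw [Category.assoc, e j, smulHom_comp_left, smulHom_comp_right, key]

end GlobalPhases

theorem BiprodCat.quotient {C : Type u} [Category.{v} C] [MonoidalCategory C] (hC : BiprodCat C)
    (P : GlobalPhases C) : PhasedBiprodCat P.Quotient := by
  have := hC.coprodCat.finite
  refine ⟨?_, GlobalPhases.distributivePhasedCoproducts_quotient hC.distrib⟩
  obtain ⟨⟨_, _⟩, -⟩ := hC
  exact ⟨inferInstance, fun n X => ⟨_, GlobalPhases.isPhasedBiproductFamily_projBicone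
    ⟨biproduct.isBilimit fun i => (X i).as⟩⟩⟩

/-! ### Biproducts in `GPCat W` -/

namespace GPCat

variable {B : Type u} [Category.{v} B] [MonoidalCategory B] [HasZeroMorphisms B]
  {W : ∀ ⦃A E : B⦄, (A ⟶ E) → (𝟙_ B ⟶ E) → Prop} (hW : Admissible W)
  (hB : HasBinaryPhasedBiproducts B)

namespace Admissible

include hW hB in
-- A morphism over zero has to be the projection to `I` followed by `Y.inr`, and this composite is
-- invariant under phases.
lemma hom_ext_of_baseMap_zero {X Y : GPCat W} {f g : X ⟶ Y} (hf : baseMap f = 0)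
    (hg : baseMap g = 0) : f = g := by
  obtain ⟨πA, πI, h⟩ := hB.exists_proj (hW.isPhasedCoproduct X)
  have key : ∀ f : X ⟶ Y, baseMap f = 0 → f.hom = πI ≫ Y.inr := fun f hf =>
    h.coprod.eq_of_components
      (by rw [reassoc_of% h.inl_snd, inl_hom, hf, zero_comp, zero_comp])
      (by rw [reassoc_of% h.inr_snd, inr_hom])
      fun U hU => by rw [reassoc_of% ((h.phases U).1 hU).2]
  exact hom_ext ((key f hf).trans (key g hg).symm)

/-- The zero morphisms are those over zero morphisms. -/
noncomputable abbrev zeroMorphisms : HasZeroMorphisms (GPCat W) where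
  zero X Y := ⟨(hW.exists_hom (X := X) (Y := Y) 0).choose⟩
  comp_zero {X Y} f Z := hW.hom_ext_of_baseMap_zero hB
    (by
      rw [hW.baseMap_comp]
      exact (congrArg (baseMap f ≫ ·) (hW.exists_hom (X := Y) (Y := Z) 0).choose_spec).trans
        comp_zero)
    (hW.exists_hom (X := X) (Y := Z) 0).choose_spec
  zero_comp X {Y Z} f := hW.hom_ext_of_baseMap_zero hB
    (by
      rw [hW.baseMap_comp]
      exact (congrArg (· ≫ baseMap f) (hW.exists_hom (X := X) (Y := Y) 0).choose_spec).trans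
        zero_comp)
    (hW.exists_hom (X := X) (Y := Z) 0).choose_spec

end Admissible

namespace Admissible

variable [HasZeroMorphisms (GPCat W)]

include hW hB

omit hB in
-- No particular choice of zero morphisms on `GPCat W` is assumed; each zero morphism factors
-- through a morphism with zero base map.
lemma baseMap_zero (X Y : GPCat W) : baseMap (0 : X ⟶ Y) = 0 := by
  obtain ⟨f, hf⟩ := hW.exists_hom (X := X) (Y := Y) 0
  have h : (0 : X ⟶ Y) = f ≫ (0 : Y ⟶ Y) := comp_zero.symm
  rw [h, hW.baseMap_comp, hf, zero_comp]

lemma eq_zero {X Y : GPCat W} {f : X ⟶ Y} (hf : baseMap f = 0) : f = 0 :=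
  hW.hom_ext_of_baseMap_zero hB hf (hW.baseMap_zero X Y)

variable {X Y Z : GPCat W} {i : X ⟶ Z} {j : Y ⟶ Z} {p : Z ⟶ X} {q : Z ⟶ Y}

lemma isPhasedBiproduct_baseMap (h : IsPhasedCoproduct (baseMap i) (baseMap j)) (h1 : i ≫ p = 𝟙 X)
    (h2 : j ≫ p = 0) (h3 : i ≫ q = 0) (h4 : j ≫ q = 𝟙 Y) :
    IsPhasedBiproduct (baseMap i) (baseMap j) (baseMap p) (baseMap q) :=
  hB.isPhasedBiproduct h (by rw [← hW.baseMap_comp, h1, hW.baseMap_id])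
    (by rw [← hW.baseMap_comp, h2, hW.baseMap_zero])
    (by rw [← hW.baseMap_comp, h3, hW.baseMap_zero])
    (by rw [← hW.baseMap_comp, h4, hW.baseMap_id])

/-- Morphisms into a biproduct with given components. -/
lemma exists_lift_biproduct (h : IsPhasedCoproduct (baseMap i) (baseMap j)) (h1 : i ≫ p = 𝟙 X)
    (h2 : j ≫ p = 0) (h3 : i ≫ q = 0) (h4 : j ≫ q = 𝟙 Y) {T : GPCat W} (f : T ⟶ X) (g : T ⟶ Y) :
    ∃ k : T ⟶ Z, k ≫ p = f ∧ k ≫ q = g := by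
  have hb := hW.isPhasedBiproduct_baseMap hB h h1 h2 h3 h4
  -- A lift of the bases has the required components up to phases `a` and `b` of `X` and `Y`. The
  -- diagonal endomorphism `s` of the coproduct corrects both.
  obtain ⟨k₀, e1, e2⟩ := hb.prod.exists_lift (baseMap f) (baseMap g)
  obtain ⟨k, rfl⟩ := hW.exists_hom k₀
  obtain ⟨a, -, rfl⟩ := hW.exists_phase_comp ((hW.baseMap_comp k p).trans e1)
  obtain ⟨b, -, rfl⟩ := hW.exists_phase_comp ((hW.baseMap_comp k q).trans e2)
  obtain ⟨s, s1, s2⟩ := hW.exists_desc i j h (a ≫ i) (b ≫ j)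
  refine ⟨k ≫ s, ?_, ?_⟩
  · rw [Category.assoc, Category.assoc]
    congr 1
    refine hW.desc_unique i j h _ _ ?_ ?_
    · rw [reassoc_of% s1, h1, reassoc_of% h1, Category.comp_id]
    · rw [reassoc_of% s2, h2, reassoc_of% h2, comp_zero, zero_comp]
  · rw [Category.assoc, Category.assoc]
    congr 1
    refine hW.desc_unique i j h _ _ ?_ ?_
    · rw [reassoc_of% s1, h3, reassoc_of% h3, comp_zero, zero_comp]
    · rw [reassoc_of% s2, h4, reassoc_of% h4, Category.comp_id]

/-- Two morphisms into a biproduct with the same components differ by a diagonal phase which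
preserves the components. -/
lemma exists_phases_of_components (h : IsPhasedCoproduct (baseMap i) (baseMap j))
    (h1 : i ≫ p = 𝟙 X) (h2 : j ≫ p = 0) (h3 : i ≫ q = 0) (h4 : j ≫ q = 𝟙 Y) {T : GPCat W}
    (k k' : T ⟶ Z) (hp : k ≫ p = k' ≫ p) (hq : k ≫ q = k' ≫ q) :
    ∃ (a : X ⟶ X) (b : Y ⟶ Y) (s : Z ⟶ Z), i ≫ s = a ≫ i ∧ j ≫ s = b ≫ j ∧ k' = k ≫ s ∧
      (k ≫ p) ≫ a = k ≫ p ∧ (k ≫ q) ≫ b = k ≫ q := by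
  have hb := hW.isPhasedBiproduct_baseMap hB h h1 h2 h3 h4
  obtain ⟨V, hV, e⟩ := hb.prod.exists_phase (baseMap k) (baseMap k')
    (by rw [← hW.baseMap_comp, hp, hW.baseMap_comp])
    (by rw [← hW.baseMap_comp, hq, hW.baseMap_comp])
  -- Because phases for the projections are phases for the coprojections, the lift `v ≫ t` is
  -- diagonal, with components `a` and `b` that are phases of `X` and `Y`.
  rw [← hb.phases] at hV
  obtain ⟨v, rfl⟩ := hW.exists_hom V
  obtain ⟨t, ht, e⟩ := hW.exists_phase_comp ((hW.baseMap_comp k v).trans e.symm)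
  obtain ⟨a, ha, ea⟩ := hW.exists_phase (f := i) (f' := i ≫ v ≫ t)
    (by rw [hW.baseMap_comp, hW.baseMap_comp, ht, Category.comp_id, hV.1])
  obtain ⟨b, hb', eb⟩ := hW.exists_phase (f := j) (f' := j ≫ v ≫ t)
    (by rw [hW.baseMap_comp, hW.baseMap_comp, ht, Category.comp_id, hV.2])
  rw [Category.assoc] at e
  refine ⟨a, b, v ≫ t, ea, eb, e, ?_, ?_⟩
  · rw [Category.assoc, hp, e, Category.assoc]
    congr 1
    refine hW.desc_unique i j h _ _ ?_ ?_
    · rw [reassoc_of% h1, Category.assoc, reassoc_of% ea, h1, Category.comp_id]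
    · rw [reassoc_of% h2, Category.assoc, reassoc_of% eb, h2, zero_comp, comp_zero]
  · rw [Category.assoc, hq, e, Category.assoc]
    congr 1
    refine hW.desc_unique i j h _ _ ?_ ?_
    · rw [reassoc_of% h3, Category.assoc, reassoc_of% ea, h3, zero_comp, comp_zero]
    · rw [reassoc_of% h4, Category.assoc, reassoc_of% eb, h4, Category.comp_id]

theorem isBiproduct (h : IsPhasedCoproduct (baseMap i) (baseMap j)) (h1 : i ≫ p = 𝟙 X)
    (h2 : j ≫ p = 0) (h3 : i ≫ q = 0) (h4 : j ≫ q = 𝟙 Y) : IsBiproduct i j p q where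
  inl_fst := h1
  inr_fst := h2
  inl_snd := h3
  inr_snd := h4
  exists_desc := hW.exists_desc i j h
  desc_unique := hW.desc_unique i j h
  exists_lift := hW.exists_lift_biproduct hB h h1 h2 h3 h4
  lift_unique {T} k k' hp hq := by
    -- Every morphism with the projections of `k` equals `d ≫ m`, with `d` a diagonal of `T` and `m`
    -- the sum of the two projections of `k`. It differs from `d ≫ m` by a diagonal endomorphism
    -- that fixes these projections, and such an endomorphism is already absorbed by `m`.
    obtain ⟨D, i', j', hD⟩ := hW.exists_binaryCofan T T
    obtain ⟨p', p1, p2⟩ := hW.exists_desc i' j' hD (𝟙 T) 0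
    obtain ⟨q', q1, q2⟩ := hW.exists_desc i' j' hD 0 (𝟙 T)
    obtain ⟨d, d1, d2⟩ := hW.exists_lift_biproduct hB hD p1 p2 q1 q2 (𝟙 T) (𝟙 T)
    obtain ⟨m, m1, m2⟩ := hW.exists_desc i' j' hD ((k ≫ p) ≫ i) ((k ≫ q) ≫ j)
    have mp : m ≫ p = p' ≫ k ≫ p := by
      refine hW.desc_unique i' j' hD _ _ ?_ ?_
      · rw [reassoc_of% m1, h1, Category.comp_id, reassoc_of% p1]
      · rw [reassoc_of% m2, h2, comp_zero, comp_zero, reassoc_of% p2, zero_comp]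
    have mq : m ≫ q = q' ≫ k ≫ q := by
      refine hW.desc_unique i' j' hD _ _ ?_ ?_
      · rw [reassoc_of% m1, h3, comp_zero, comp_zero, reassoc_of% q1, zero_comp]
      · rw [reassoc_of% m2, h4, Category.comp_id, reassoc_of% q2]
    have dp : (d ≫ m) ≫ p = k ≫ p := by rw [Category.assoc, mp, reassoc_of% d1]
    have dq : (d ≫ m) ≫ q = k ≫ q := by rw [Category.assoc, mq, reassoc_of% d2]
    have key : ∀ k' : T ⟶ Z, k ≫ p = k' ≫ p → k ≫ q = k' ≫ q → k' = d ≫ m := by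
      intro k' hp hq
      obtain ⟨a, b, s, e1, e2, rfl, e3, e4⟩ := hW.exists_phases_of_components hB h h1 h2 h3 h4
        (d ≫ m) k' (dp.trans hp) (dq.trans hq)
      rw [dp] at e3
      rw [dq] at e4
      rw [Category.assoc]
      congr 1
      refine hW.desc_unique i' j' hD _ _ ?_ ?_
      · rw [reassoc_of% m1, m1, e1, ← Category.assoc, ← Category.assoc, e3]
      · rw [reassoc_of% m2, m2, e2, ← Category.assoc, ← Category.assoc, e4]
    rw [key k rfl rfl, ← key k' hp hq]

lemma exists_isBiproduct (X Y : GPCat W) : ∃ (Z : GPCat W) (i : X ⟶ Z) (j : Y ⟶ Z) (p : Z ⟶ X)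
    (q : Z ⟶ Y), IsBiproduct i j p q := by
  obtain ⟨Z, i, j, h⟩ := hW.exists_binaryCofan X Y
  obtain ⟨p, h1, h2⟩ := hW.exists_desc i j h (𝟙 X) 0
  obtain ⟨q, h3, h4⟩ := hW.exists_desc i j h 0 (𝟙 Y)
  exact ⟨Z, i, j, p, q, hW.isBiproduct hB h h1 h2 h3 h4⟩

omit [HasZeroMorphisms B] hB in
lemma exists_id_eq_zero : ∃ Z : GPCat W, 𝟙 Z = 0 := by
  obtain ⟨Z, ⟨hZ⟩, -⟩ := hW.exists_isInitial
  exact ⟨Z, hZ.hom_ext _ _⟩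

theorem hasFiniteBiproducts : HasFiniteBiproducts (GPCat W) where
  out n := ⟨fun X => by
    obtain ⟨b, ⟨hb⟩, -⟩ := exists_finite_isBilimit (C := GPCat W) (fun _ _ => True)
      (fun _ _ => trivial) hW.exists_id_eq_zero (fun X Y => by
        obtain ⟨Z, i, j, p, q, h⟩ := hW.exists_isBiproduct hB X Y
        exact ⟨Z, i, j, p, q, h, trivial, trivial⟩) n X
    exact HasBiproduct.mk ⟨b, hb⟩⟩

end Admissible

end GPCat

theorem PhasedBiprodCat.biprodCat_GP {B : Type u} [Category.{v} B] [MonoidalCategory B]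
    (hB : PhasedBiprodCat B) [MonoidalCategory (GP B)] (τ : GPTensor B) : BiprodCat (GP B) := by
  have hW := hB.phasedCoprodCat.admissible
  refine ⟨?_, τ.distributiveCoproducts hW⟩
  obtain ⟨⟨_, h⟩, -⟩ := hB
  have h2 := hasBinaryPhasedBiproducts_of_finite h
  exact ⟨hW.zeroMorphisms h2, @Admissible.hasFiniteBiproducts _ _ _ _ _ hW h2 (hW.zeroMorphisms h2)⟩

/-! ### Phased dagger biproducts -/

section

variable {C : Type u} [Category.{v} C]

lemma dag_zero [Dagger C] [HasZeroMorphisms C] (X Y : C) : dag (0 : X ⟶ Y) = 0 := by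
  have h : dag (0 : X ⟶ Y) = dag (dag (0 : Y ⟶ Y)) ≫ dag (0 : X ⟶ Y) := by
    rw [← Dagger.dag_comp, zero_comp]
  rw [h, Dagger.dag_dag, zero_comp]

section Zero

variable [MonoidalCategory C] [HasZeroMorphisms C] (hf : HasFinitePhasedCoproducts C)
  (hd : DistributivePhasedCoproducts C)

include hf hd

/-- An initial `Z` is a phased coproduct of two copies of itself along identities. By distributivity
so is `A ⊗ Z`, so parallel morphisms out of `A ⊗ Z` coincide, and zero morphisms factor through `Z`.
-/
lemma DistributivePhasedCoproducts.whiskerLeft_zero (A X Y : C) : A ◁ (0 : X ⟶ Y) = 0 := by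
  obtain ⟨Z, -, hZ⟩ := hf.exists_initial
  have h : IsPhasedCoproduct (𝟙 Z) (𝟙 Z) :=
    ⟨fun f g => ⟨f, Category.id_comp f, hZ _ _ _⟩, fun h h' _ _ => ⟨𝟙 Z, IsPhase.id _ _, hZ _ _ _⟩⟩
  obtain ⟨k, h1, h2⟩ := (hd.whiskerLeft h A).exists_desc (A ◁ (0 : Z ⟶ Y)) 0
  have e : A ◁ (0 : Z ⟶ Y) = 0 := h1.symm.trans h2
  rw [← zero_comp (X := X) (f := (0 : Z ⟶ Y)), MonoidalCategory.whiskerLeft_comp, e, comp_zero]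

lemma DistributivePhasedCoproducts.zero_tensor {X Y X' Y' : C} (f : X ⟶ Y) :
    (f ⊗ₘ (0 : X' ⟶ Y')) = 0 := by
  rw [MonoidalCategory.tensorHom_def, hd.whiskerLeft_zero hf, comp_zero]

end Zero

variable [Dagger C]

lemma isPhasedDaggerBiproduct_iff [HasZeroMorphisms C] {A B E : C} {κA : A ⟶ E} {κB : B ⟶ E} :
    IsPhasedDaggerBiproduct κA κB ↔ IsPhasedBiproduct κA κB (dag κA) (dag κB) := by
  constructor
  · rintro ⟨z, h⟩
    convert h
    exact Subsingleton.elim _ _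
  · exact fun h => ⟨_, h⟩

lemma HasBinaryPhasedBiproducts.isPhasedDaggerBiproduct [HasZeroMorphisms C]
    (hC : HasBinaryPhasedBiproducts C) {A B E : C} {κA : A ⟶ E} {κB : B ⟶ E}
    (h : IsPhasedCoproduct κA κB) (hA : κA ≫ dag κA = 𝟙 A) (hB : κB ≫ dag κB = 𝟙 B)
    (h0 : κA ≫ dag κB = 0) : IsPhasedDaggerBiproduct κA κB := by
  refine isPhasedDaggerBiproduct_iff.2 (hC.isPhasedBiproduct h hA ?_ h0 hB)
  have := congrArg dag h0
  rwa [Dagger.dag_comp, Dagger.dag_dag, dag_zero] at this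

lemma IsPhasedDaggerBiproduct.isPhasedCoproduct {A B E : C} {κA : A ⟶ E} {κB : B ⟶ E}
    (h : IsPhasedDaggerBiproduct κA κB) : IsPhasedCoproduct κA κB := by
  obtain ⟨_, h⟩ := h
  exact h.coprod

variable [MonoidalCategory C]

namespace PhasedDaggerBiprodCat

variable (hC : PhasedDaggerBiprodCat C)

include hC

theorem phasedBiprodCat : PhasedBiprodCat C := by
  obtain ⟨⟨_, h⟩, hd, -⟩ := hC
  exact ⟨⟨inferInstance, fun n X => (h n X).imp fun b hb => hb.1⟩, hd⟩

lemma hasBinaryPhasedBiproducts [z' : HasZeroMorphisms C] : HasBinaryPhasedBiproducts C := by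
  obtain ⟨⟨z, h⟩, hd, -⟩ := hC
  obtain rfl : z = z' := Subsingleton.elim _ _
  exact hasBinaryPhasedBiproducts_of_finite fun n X => (h n X).imp fun b hb => hb.1

lemma exists_binary (A B : C) : ∃ (E : C) (κA : A ⟶ E) (κB : B ⟶ E),
    IsPhasedDaggerBiproduct κA κB := by
  obtain ⟨⟨z, h⟩, -, -⟩ := hC
  obtain ⟨b, hb, hd⟩ := h 2 ![A, B]
  have := hb.binary
  rw [hd, hd] at this
  exact ⟨b.pt, b.ι 0, b.ι 1, z, this⟩

lemma admissible : Admissible (B := C) fun _ _ inl inr => IsPhasedDaggerBiproduct inl inr where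
  cat := hC.phasedBiprodCat.phasedCoprodCat
  coprod _ _ _ _ h := h.isPhasedCoproduct
  exists_obj A := hC.exists_binary A _

end PhasedDaggerBiprodCat

end

/-! ### The dagger category `GP†(B)` -/

namespace GPCat

variable {B : Type u} [Category.{v} B] [MonoidalCategory B] [Dagger B]
  (hB : PhasedDaggerBiprodCat B)

include hB

lemma baseMap_dag {X Y : GPDag B} (f : X ⟶ Y) : baseMap (dag f) = dag (baseMap f) :=
  hB.admissible.baseMap_eq (dag f)
    (X.prop.dag_diag Y.prop f.hom (baseMap f) (inl_hom f) (inr_hom f)).1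

/-- A morphism over an isometry is an isometry. -/
lemma comp_dag_eq_id {X Y : GPDag B} (f : X ⟶ Y) (h : baseMap f ≫ dag (baseMap f) = 𝟙 _) :
    f ≫ dag f = 𝟙 X := by
  have hW := hB.admissible
  -- `f ≫ dag f` lies over the identity and is therefore a phase; being positive, it is trivial.
  refine hom_ext (hB.positiveFree _ _ X.prop (f ≫ dag f).hom
    (Admissible.isPhase_of_baseMap ?_) ⟨_, f.hom, rfl⟩)
  rw [hW.baseMap_comp, baseMap_dag hB, h]

lemma isUnitary_of_baseMap {X Y : GPDag B} (e : X ≅ Y) (e' : X.base ≅ Y.base)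
    (h : baseMap e.hom = e'.hom) (he' : IsUnitary e') : IsUnitary e := by
  rw [isUnitary_iff] at *
  exact comp_dag_eq_id hB _ (by rw [h, he'])

section Tensor

variable [DaggerMonoidal B] [MonoidalCategory (GPDag B)] (τ : GPDagTensor B)

/-- The morphisms `c` are isometries. -/
lemma c_comp_dag (X Y : GPDag B) : τ.c X Y ≫ dag (τ.c X Y) = 𝟙 _ := by
  have hW := hB.admissible
  have hfin := hW.cat.finite
  obtain ⟨z, -⟩ := id hB.finite
  have hX := isPhasedDaggerBiproduct_iff.1 X.prop
  have hY := isPhasedDaggerBiproduct_iff.1 Y.prop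
  have hXY := isPhasedDaggerBiproduct_iff.1 (X ⊗ Y).prop
  have hz : ∀ {X Y X' Y' : B} (f : X ⟶ Y), (f ⊗ₘ (0 : X' ⟶ Y')) = 0 := fun f =>
    hB.distrib.zero_tensor hfin f
  have hu : IsUnitary (τ.baseIso X Y) := isUnitary_eqToIso _
  have hr : dag (ρ_ (𝟙_ B)).inv = (ρ_ (𝟙_ B)).hom :=
    IsUnitary.dag_inv (DaggerMonoidal.rightUnitor_unitary _)
  -- `e1` and `e2` compute `c` followed by the daggers of its values on the two summands. The mixed
  -- terms vanish because a tensor with a zero morphism is zero.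
  have e1 : τ.c X Y ≫ (dag X.inl ⊗ₘ dag Y.inl) = dag (X ⊗ Y).inl ≫ (τ.baseIso X Y).hom :=
    hXY.coprod.eq_of_components
      (by rw [τ.inl_c_assoc, tensorHom_comp_tensorHom, hX.inl_fst, hY.inl_fst, id_tensorHom_id,
        reassoc_of% hXY.inl_fst, Category.comp_id])
      (by rw [τ.inr_c_assoc, tensorHom_comp_tensorHom, hY.inr_fst, hz, comp_zero,
        reassoc_of% hXY.inr_fst, zero_comp])
      fun U hU => by rw [reassoc_of% ((hXY.phases U).1 hU).1]
  have e2 : τ.c X Y ≫ (dag X.inr ⊗ₘ dag Y.inr) ≫ (ρ_ (𝟙_ B)).hom = dag (X ⊗ Y).inr :=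
    hXY.coprod.eq_of_components
      (by rw [τ.inl_c_assoc, tensorHom_comp_tensorHom_assoc, hY.inl_snd, hz, zero_comp, comp_zero,
        hXY.inl_snd])
      (by rw [τ.inr_c_assoc, tensorHom_comp_tensorHom_assoc, hX.inr_snd, hY.inr_snd,
        id_tensorHom_id, Category.id_comp, Iso.inv_hom_id, hXY.inr_snd])
      fun U hU => ((hXY.phases U).1 hU).2
  have d1 := congrArg dag (τ.inl_c' X Y)
  have d2 := congrArg dag (τ.inr_c X Y)
  simp only [Dagger.dag_comp, DaggerMonoidal.dag_tensor, hr] at d1 d2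
  rw [IsUnitary] at hu
  -- The positive endomorphism `c ≫ dag c` preserves the projections, so it is a phase and hence the
  -- identity.
  refine hB.positiveFree _ _ (X ⊗ Y).prop _ ((hXY.phases _).2 ⟨?_, ?_⟩) ⟨_, _, rfl⟩
  · rw [Category.assoc, d1, reassoc_of% e1, hu, Iso.hom_inv_id, Category.comp_id]
  · rw [Category.assoc, d2, e2]

/-- As `c` is an isometry, the tensor has this closed form, which visibly commutes with the dagger.
-/
lemma tensorHom_hom {X Y X' Y' : GPDag B} (f : X ⟶ Y) (g : X' ⟶ Y') :
    (f ⊗ₘ g).hom = τ.c X X' ≫ (f.hom ⊗ₘ g.hom) ≫ dag (τ.c Y Y') := by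
  have := congrArg (· ≫ dag (τ.c Y Y')) (τ.tensorHom_c f g)
  simpa only [Category.assoc, c_comp_dag hB τ, Category.comp_id] using this

include τ

/-- The coherence isomorphisms lie over unitaries of `B`, and `isUnitary_of_baseMap` lifts
unitarity. -/
theorem daggerMonoidal : DaggerMonoidal (GPDag B) where
  dag_tensor f g := by
    apply hom_ext
    rw [tensorHom_hom hB τ]
    change dag (f ⊗ₘ g).hom = τ.c _ _ ≫ (dag f.hom ⊗ₘ dag g.hom) ≫ dag (τ.c _ _)
    rw [tensorHom_hom hB τ, Dagger.dag_comp, Dagger.dag_comp, Dagger.dag_dag,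
      DaggerMonoidal.dag_tensor, Category.assoc]
  associator_unitary X Y Z := by
    have hb : ∀ X Y, IsUnitary (τ.baseIso X Y) := fun X Y => isUnitary_eqToIso _
    refine isUnitary_of_baseMap hB _ (τ.baseIso (X ⊗ Y) Z ≪≫ (τ.baseIso X Y ⊗ᵢ Iso.refl Z.base) ≪≫
      α_ _ _ _ ≪≫ (Iso.refl X.base ⊗ᵢ (τ.baseIso Y Z).symm) ≪≫ (τ.baseIso X (Y ⊗ Z)).symm) ?_
      ((hb _ _).trans (((hb _ _).tensor (isUnitary_refl _)).trans
        ((DaggerMonoidal.associator_unitary _ _ _).trans (((isUnitary_refl _).tensor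
          (hb _ _).symm).trans (hb _ _).symm))))
    have := τ.baseMap_associator hB.admissible X Y Z
    rw [← cancel_mono ((τ.baseIso X (Y ⊗ Z)).hom ≫ X.base ◁ (τ.baseIso Y Z).hom), this]
    simp [← MonoidalCategory.whiskerLeft_comp]
  leftUnitor_unitary X := by
    have hb : ∀ X Y, IsUnitary (τ.baseIso X Y) := fun X Y => isUnitary_eqToIso _
    have hu : IsUnitary τ.unitIso := isUnitary_eqToIso _
    exact isUnitary_of_baseMap hB _ (τ.baseIso _ X ≪≫ (τ.unitIso ⊗ᵢ Iso.refl X.base) ≪≫ λ_ _)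
      (by simp [τ.baseMap_leftUnitor hB.admissible])
      ((hb _ _).trans ((hu.tensor (isUnitary_refl _)).trans (DaggerMonoidal.leftUnitor_unitary _)))
  rightUnitor_unitary X := by
    have hb : ∀ X Y, IsUnitary (τ.baseIso X Y) := fun X Y => isUnitary_eqToIso _
    have hu : IsUnitary τ.unitIso := isUnitary_eqToIso _
    exact isUnitary_of_baseMap hB _ (τ.baseIso X _ ≪≫ (Iso.refl X.base ⊗ᵢ τ.unitIso) ≪≫ ρ_ _)
      (by simp [τ.baseMap_rightUnitor hB.admissible])
      ((hb _ _).trans (((isUnitary_refl _).tensor hu).trans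
        (DaggerMonoidal.rightUnitor_unitary _)))

omit τ [DaggerMonoidal B] in
lemma allUnitary {Q : GlobalPhases (GPDag B)} (hQ : Q.carrier = phases _) : Q.AllUnitary where
  unitary p hp := by
    rw [hQ] at hp
    exact isUnitary_of_baseMap hB p (Iso.refl _)
      ((TensorStructure.mem_phases_iff hB.admissible p).1 hp) (isUnitary_refl _)

omit [DaggerMonoidal B] in
-- Multiplication by a phase scalar on an object is a phase of its total object in `B`, and the
-- dagger and composition of `GP†(B)` are those of `B`.
lemma positiveFree {Q : GlobalPhases (GPDag B)} (hQ : Q.carrier = phases _) :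
    Q.PositiveFree := by
  rintro p hp X ⟨Y, g, hg⟩
  have hW := hB.admissible
  rw [hQ, TensorStructure.mem_phases_iff hW] at hp
  have hb := τ.baseMap_smulHom hW hp (𝟙 X)
  rw [hW.baseMap_id] at hb
  exact hom_ext (hB.positiveFree _ _ X.prop _ (Admissible.isPhase_of_baseMap hb)
    ⟨_, g.hom, congrArg Hom.hom hg⟩)

omit τ [DaggerMonoidal B] [MonoidalCategory (GPDag B)] in
lemma hasFiniteDaggerBiproducts : HasFiniteDaggerBiproducts (GPDag B) := by
  have hW := hB.admissible
  obtain ⟨z, -⟩ := id hB.finite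
  have h2 := hB.hasBinaryPhasedBiproducts
  let _ := hW.zeroMorphisms h2
  refine ⟨inferInstance, exists_finite_isBilimit (C := GPDag B) (fun i p => p = dag i) ?_
    hW.exists_id_eq_zero fun X Y => ?_⟩
  · rintro X Y Z i j _ _ rfl rfl
    exact (Dagger.dag_comp i j).symm
  · obtain ⟨E, κ, κ', h⟩ := hB.exists_binary X.base Y.base
    obtain ⟨Z, rfl⟩ := hW.exists_over E
    obtain ⟨i, rfl⟩ := hW.exists_hom κ
    obtain ⟨j, rfl⟩ := hW.exists_hom κ'
    rw [isPhasedDaggerBiproduct_iff] at h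
    refine ⟨Z, i, j, dag i, dag j, hW.isBiproduct h2 h.coprod (comp_dag_eq_id hB i h.inl_fst)
      (hW.eq_zero h2 ?_) (hW.eq_zero h2 ?_) (comp_dag_eq_id hB j h.inr_snd), rfl, rfl⟩
    · rw [hW.baseMap_comp, baseMap_dag hB, h.inr_fst]
    · rw [hW.baseMap_comp, baseMap_dag hB, h.inl_snd]

omit [DaggerMonoidal B] in
theorem daggerBiprodCat : DaggerBiprodCat (GPDag B) where
  finite := hasFiniteDaggerBiproducts hB
  distrib := τ.distributiveCoproducts hB.admissible

end Tensor

end GPCat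

/-! ### Dagger biproducts and the quotient `A/P` -/

theorem DaggerBiprodCat.biprodCat {C : Type u} [Category.{v} C] [MonoidalCategory C] [Dagger C]
    (hC : DaggerBiprodCat C) : BiprodCat C := by
  obtain ⟨⟨z, h⟩, hd⟩ := hC
  refine ⟨⟨z, ⟨fun n => ⟨fun X => ?_⟩⟩⟩, hd⟩
  obtain ⟨b, ⟨hb⟩, -⟩ := h n X
  exact HasBiproduct.mk ⟨b, hb⟩

namespace GlobalPhases

variable {C : Type u} [Category.{v} C] [MonoidalCategory C] {P : GlobalPhases C}

lemma eq_zero_of_proj [HasZeroMorphisms C] {X Y : C} {f : X ⟶ Y} (h : P.proj.map f = 0) :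
    f = 0 := by
  obtain ⟨p, -, rfl⟩ := rel_of_proj (P := P) (f := f) (g := 0) h
  exact smulHom_zero _ _ _

variable [Dagger C] [DaggerMonoidal C] [P.AllUnitary] (hP : P.PositiveFree)

include hP

/-- An isometry of the quotient satisfies `f ≫ dag f = p · 𝟙 X`, and the right-hand side is
positive. -/
lemma comp_dag_eq_id_of_proj {X Y : C} {f : X ⟶ Y}
    (h : P.proj.map f ≫ dag (P.proj.map f) = 𝟙 _) : f ≫ dag f = 𝟙 X := by
  obtain ⟨p, hp, e⟩ := rel_of_proj (P := P) (f := f ≫ dag f) (g := 𝟙 X) h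
  rw [e]
  exact hP p hp X ⟨_, _, e.symm⟩

lemma isUnitary_of_proj {X Y : C} {e : X ≅ Y} (h : IsUnitary (P.proj.mapIso e)) :
    IsUnitary e := by
  rw [isUnitary_iff] at *
  exact comp_dag_eq_id_of_proj hP h

omit [DaggerMonoidal C] [P.AllUnitary] in
-- If `i ≫ g ≫ dag g = p · i`, composing with `dag i` exhibits `p · 𝟙 A` as positive, and so `p`
-- acts trivially.
lemma comp_eq_of_proj {A E X : C} {i : A ⟶ E} {g : E ⟶ X} (hi : i ≫ dag i = 𝟙 A)
    (h : P.proj.map (i ≫ g ≫ dag g) = P.proj.map i) : i ≫ g ≫ dag g = i := by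
  obtain ⟨p, hp, e⟩ := rel_of_proj h
  have h1 : smulHom p.hom (𝟙 A) = (i ≫ g) ≫ dag (i ≫ g) := by
    rw [Dagger.dag_comp, ← hi, ← smulHom_comp_left, ← e]
    simp only [Category.assoc]
  rw [e, smulHom_eq, hP p hp A ⟨_, _, h1⟩, Category.id_comp]

/-- A positive phase acts by one scalar on each summand. By `comp_eq_of_proj` both act trivially, so
already the representative `g ≫ dag g` is the identity of the coproduct. -/
lemma positiveFreePhases_quotient [HasFiniteCoproducts C] : PositiveFreePhases P.Quotient := by
  rintro ⟨A⟩ ⟨B⟩ ⟨E⟩ ⟨i⟩ ⟨j⟩ h U hU ⟨⟨X⟩, ⟨g⟩, rfl⟩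
  have hc := (nonempty_isColimit_iff _ _).1
    (nonempty_isColimit_of_proj (P := P) (i := i) (j := j) h.isPhasedCoproduct)
  obtain ⟨z, h⟩ := h
  have hi : i ≫ dag i = 𝟙 A := comp_dag_eq_id_of_proj hP h.inl_fst
  have hj : j ≫ dag j = 𝟙 B := comp_dag_eq_id_of_proj hP h.inr_snd
  have : g ≫ dag g = 𝟙 E := hc.2 _ _ _
    ((comp_eq_of_proj hP hi hU.1).trans (Category.comp_id i).symm)
    ((comp_eq_of_proj hP hj hU.2).trans (Category.comp_id j).symm)
  exact congrArg P.proj.map this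

end GlobalPhases

section

variable {C : Type u} [Category.{v} C] [MonoidalCategory C] [Dagger C] [DaggerMonoidal C]
  (hC : DaggerBiprodCat C) {P : GlobalPhases C} [P.AllUnitary] (hP : P.PositiveFree)

include hC hP

theorem DaggerBiprodCat.quotient : PhasedDaggerBiprodCat P.Quotient := by
  have := hC.biprodCat.coprodCat.finite
  refine ⟨?_, GlobalPhases.distributivePhasedCoproducts_quotient hC.distrib,
    GlobalPhases.positiveFreePhases_quotient hP⟩
  obtain ⟨⟨_, h⟩, -⟩ := hC
  refine ⟨inferInstance, fun n X => ?_⟩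
  obtain ⟨b, hb, hd⟩ := h n fun i => (X i).as
  exact ⟨_, GlobalPhases.isPhasedBiproductFamily_projBicone hb,
    fun i => congrArg P.proj.map (hd i)⟩

/-! ### The dagger equivalence between `A` and `GP†(A/P)` -/

namespace GPCat

open GlobalPhases

omit hC in
lemma rep_relations [HasZeroMorphisms C] (X : GPDag P.Quotient) :
    (inlRep X ≫ dag (inlRep X) = 𝟙 _ ∧ inlRep X ≫ dag (inrRep X) = 0) ∧
      inrRep X ≫ dag (inlRep X) = 0 ∧ inrRep X ≫ dag (inrRep X) = 𝟙 _ := by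
  have h := isPhasedDaggerBiproduct_iff.1 X.prop
  rw [← proj_inlRep, ← proj_inrRep] at h
  exact ⟨⟨comp_dag_eq_id_of_proj hP h.inl_fst, eq_zero_of_proj (P := P) h.inl_snd⟩,
    eq_zero_of_proj (P := P) h.inr_fst, comp_dag_eq_id_of_proj hP h.inr_snd⟩

/-- The dagger of `homRep f` represents `dag f`. That it also has the right normalization is the
adjoint of `e`, which is checked on the two summands by orthogonality. -/
lemma homRep_dag {X Y : GPDag P.Quotient} (f : X ⟶ Y) : homRep (dag f) = dag (homRep f) := by
  obtain ⟨z, -⟩ := hC.finite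
  have hW := (hC.quotient hP).admissible
  have hC' := hC.biprodCat.coprodCat
  obtain ⟨⟨-, hX⟩, -, hX'⟩ := rep_relations hP X
  obtain ⟨⟨-, hY⟩, -, hY'⟩ := rep_relations hP Y
  have e : homRep f ≫ dag (inrRep Y) = dag (inrRep X) :=
    ((nonempty_isColimit_iff _ _).1 (nonempty_isColimit_rep hW hC' X)).2 _ _ _
      (by rw [← Category.assoc, inlRep_homRep, Category.assoc, hY, hX, comp_zero])
      (by rw [← Category.assoc, inrRep_homRep, hY', hX'])
  refine homRep_eq hW hC' _ (congrArg dag (proj_homRep f)) ?_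
  have := congrArg dag e
  rwa [Dagger.dag_comp, Dagger.dag_dag, Dagger.dag_dag] at this

lemma baseRep_dag {X Y : GPDag P.Quotient} (f : X ⟶ Y) : baseRep (dag f) = dag (baseRep f) := by
  obtain ⟨z, -⟩ := hC.finite
  have hW := (hC.quotient hP).admissible
  have hC' := hC.biprodCat.coprodCat
  obtain ⟨⟨hX, -⟩, hX', -⟩ := rep_relations hP X
  obtain ⟨⟨hY, -⟩, hY', -⟩ := rep_relations hP Y
  have e : homRep f ≫ dag (inlRep Y) = dag (inlRep X) ≫ baseRep f :=
    ((nonempty_isColimit_iff _ _).1 (nonempty_isColimit_rep hW hC' X)).2 _ _ _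
      (by rw [← Category.assoc, inlRep_homRep, Category.assoc, hY, ← Category.assoc, hX,
        Category.id_comp, Category.comp_id])
      (by rw [← Category.assoc, inrRep_homRep, hY', ← Category.assoc, hX', zero_comp])
  refine baseRep_eq hW hC' _ ?_
  have := congrArg dag e
  rwa [Dagger.dag_comp, Dagger.dag_comp, Dagger.dag_dag, Dagger.dag_dag,
    ← homRep_dag hC hP] at this

variable [MonoidalCategory (GPDag P.Quotient)] (τ : GPDagTensor P.Quotient)

include τ

theorem phaseDaggerMonEquiv_quotient {Q : GlobalPhases (GPDag P.Quotient)}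
    (hQ : Q.carrier = phases _) : PhaseDaggerMonEquiv P Q := by
  have hB := hC.quotient hP
  have hW := hB.admissible
  have hC' := hC.biprodCat.coprodCat
  have := daggerMonoidal hB τ
  obtain ⟨e⟩ := exists_unit_repFunctor τ
  obtain ⟨M, hM⟩ := (repTensorator hW hC' τ).exists_monoidal e
  have h1 : ∀ {X Y : GPDag P.Quotient} (f : X ⟶ Y), (repFunctor hW hC').map (dag f) =
      dag ((repFunctor hW hC').map f) := fun f => baseRep_dag hC hP f
  have h2 : ∀ X Y, IsUnitary (Functor.Monoidal.μIso (repFunctor hW hC') X Y) := fun X Y => by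
    rw [hM]
    -- In the quotient the comparison of tensors is a transported identity, hence unitary.
    -- Positive-freeness makes it unitary in `A`.
    have h : P.proj.mapIso (repμ τ X Y) = τ.baseIso X Y := Iso.ext (proj_repμ τ X Y)
    exact (isUnitary_of_proj (P := P) hP (h ▸ isUnitary_eqToIso (τ.base_tensor X Y))).symm
  refine PhaseDaggerMonEquiv.symm ⟨_, M,
    { map_dag := h1
      μ_unitary := h2
      ε_unitary := isUnitary_εIso _ h1 h2
      full := inferInstance
      faithful := inferInstance
      unitarily_surj := fun A => ?_ }, matchesPhases_repFunctor hW hC' hQ e⟩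
  obtain ⟨X, hX⟩ := hW.exists_over ⟨A⟩
  exact ⟨X, eqToIso (congrArg CategoryTheory.Quotient.as hX), isUnitary_eqToIso _⟩

end GPCat

end

/-! ### Functoriality of `GP†(B)` -/

namespace GPCat

open Functor.Monoidal Functor.LaxMonoidal Functor.OplaxMonoidal

theorem phaseDaggerMonEquiv_of_daggerMonEquiv {B : Type u} [Category.{v} B] [MonoidalCategory B]
    [Dagger B] [DaggerMonoidal B] {B' : Type u'} [Category.{v'} B'] [MonoidalCategory B']
    [Dagger B'] [DaggerMonoidal B'] (h : DaggerMonEquiv B B') (hB : PhasedDaggerBiprodCat B)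
    (hB' : PhasedDaggerBiprodCat B') [MonoidalCategory (GPDag B)] (τ : GPDagTensor B)
    [MonoidalCategory (GPDag B')] (τ' : GPDagTensor B') {Q : GlobalPhases (GPDag B)}
    {Q' : GlobalPhases (GPDag B')} (hQ : Q.carrier = phases _) (hQ' : Q'.carrier = phases _) :
    PhaseDaggerMonEquiv Q Q' := by
  obtain ⟨F, _, hF⟩ := h
  have := hF.full
  have := hF.faithful
  have : F.IsEquivalence := isEquivalence_of F hF.full hF.faithful
    ⟨fun Y => (hF.unitarily_surj Y).imp fun _ h => ⟨h.choose⟩⟩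
  have hW := hB.admissible
  have hW' := hB'.admissible
  have := daggerMonoidal hB τ
  have := daggerMonoidal hB' τ'
  let W' : ∀ ⦃A E : B'⦄, (A ⟶ E) → (𝟙_ B' ⟶ E) → Prop :=
    fun _ _ inl inr => IsPhasedDaggerBiproduct inl inr
  have hw : ∀ ⦃A E : B⦄ (κ : A ⟶ E) (κI : 𝟙_ B ⟶ E), IsPhasedDaggerBiproduct κ κI →
      IsPhasedDaggerBiproduct (F.map κ) (ε F ≫ F.map κI) := fun A E κ κI h => by
    obtain ⟨_, -⟩ := id hB'.finite
    have hc : IsPhasedCoproduct (F.map κ) (ε F ≫ F.map κI) := by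
      simpa using (h.isPhasedCoproduct.map F).iso_comp (𝟙 _) (ε F)
    obtain ⟨_, h⟩ := h
    have hε := (isUnitary_iff _).1 hF.ε_unitary
    -- Only the phased coproduct is transported along `F`. That the daggers are the projections
    -- follows from the isometry and orthogonality relations, which determine projections uniquely.
    refine hB'.hasBinaryPhasedBiproducts.isPhasedDaggerBiproduct hc ?_ ?_ ?_
    · rw [← hF.map_dag, ← F.map_comp, h.inl_fst, F.map_id]
    · rw [Dagger.dag_comp, ← hF.map_dag, Category.assoc, ← F.map_comp_assoc, h.inr_snd, F.map_id,
        Category.id_comp]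
      exact hε
    · rw [Dagger.dag_comp, ← hF.map_dag, ← F.map_comp_assoc, h.inl_snd, F.map_zero, zero_comp]
  obtain ⟨e⟩ := TensorStructure.exists_unit_mapFunctor F hw hW' τ τ'
  obtain ⟨M, hM⟩ := (TensorStructure.mapTensorator F hw hW' τ τ').exists_monoidal e
  have h1 : ∀ {X Y : GPDag B} (f : X ⟶ Y), (mapFunctor (W' := W') F hw).map (dag f) =
      dag ((mapFunctor (W' := W') F hw).map f) :=
    fun f => hom_ext (hF.map_dag f.hom)
  have h2 : ∀ X Y, IsUnitary (μIso (mapFunctor (W' := W') F hw) X Y) := fun X Y => by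
    rw [hM]
    exact (isUnitary_of_baseMap hB' _ _ (TensorStructure.baseMap_mapμ F hw hW' τ τ' X Y)
      (((isUnitary_eqToIso _).map hF.map_dag).trans
        ((hF.μ_unitary _ _).symm.trans (isUnitary_eqToIso _).symm))).symm
  refine ⟨_, M,
    { map_dag := h1
      μ_unitary := h2
      ε_unitary := isUnitary_εIso _ h1 h2
      full := inferInstance
      faithful := inferInstance
      unitarily_surj := fun Y => ?_ }, TensorStructure.matchesPhases_mapFunctor (W' := W') F hw hW hW' hQ hQ'⟩
  obtain ⟨A, a, ha⟩ := hF.unitarily_surj Y.base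
  obtain ⟨X, rfl⟩ := hW.exists_over A
  obtain ⟨k, hk⟩ := hW'.exists_iso_over (X := (mapFunctor (W' := W') F hw).obj X) (Y := Y) a
  exact ⟨X, k, isUnitary_of_baseMap hB' k a hk ha⟩

end GPCat

/-! ### The correspondence respects and reflects equivalence -/

theorem GPCat.exists_globalPhases {B : Type u} [Category.{v} B] [MonoidalCategory B]
    {W : ∀ ⦃A E : B⦄, (A ⟶ E) → (𝟙_ B ⟶ E) → Prop} (hW : Admissible W)
    [MonoidalCategory (GPCat W)] (τ : TensorStructure W) :
    ∃ Q : GlobalPhases (GPCat W), Q.carrier = phases W :=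
  ⟨τ.globalPhases hW, rfl⟩

section Plain

variable {C : Type u} [Category.{v} C] [MonoidalCategory C]
  {D : Type u'} [Category.{v'} D] [MonoidalCategory D]

/-- For the reverse implication, apply `GP` to the equivalence of quotients and conjugate with the
equivalences between the original categories and `GP` of their quotients. -/
theorem CoprodCat.phaseMonEquiv_iff (hC : CoprodCat C) (hD : CoprodCat D) (P : GlobalPhases C)
    (P' : GlobalPhases D) : PhaseMonEquiv P P' ↔ MonEquiv P.Quotient P'.Quotient := by
  refine ⟨PhaseMonEquiv.quotient, fun h => ?_⟩
  have hW := (hC.quotient P).admissible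
  have hW' := (hD.quotient P').admissible
  obtain ⟨_, ⟨τ⟩⟩ := hW.exists_tensorStructure
  obtain ⟨_, ⟨τ'⟩⟩ := hW'.exists_tensorStructure
  obtain ⟨Q, hQ⟩ := exists_globalPhases hW τ
  obtain ⟨Q', hQ'⟩ := exists_globalPhases hW' τ'
  exact ((phaseMonEquiv_quotient hW hC τ hQ).trans (phaseMonEquiv_of_monEquiv h (hC.quotient P)
    (hD.quotient P') τ τ' hQ hQ')).trans (phaseMonEquiv_quotient hW' hD τ' hQ').symm

/-- For the reverse implication, divide by the global phases and use that `GP(B)/P` recovers `B` on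
both sides. -/
theorem PhasedCoprodCat.monEquiv_iff (hC : PhasedCoprodCat C) (hD : PhasedCoprodCat D)
    [MonoidalCategory (GP C)] (τ : GPTensor C) [MonoidalCategory (GP D)] (τ' : GPTensor D)
    {Q : GlobalPhases (GP C)} {Q' : GlobalPhases (GP D)} (hQ : Q.carrier = phases _)
    (hQ' : Q'.carrier = phases _) : MonEquiv C D ↔ PhaseMonEquiv Q Q' :=
  ⟨fun h => phaseMonEquiv_of_monEquiv h hC hD τ τ' hQ hQ', fun h =>
    ((τ.monEquiv_quotient hC.admissible hQ).trans h.quotient).trans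
      (τ'.monEquiv_quotient hD.admissible hQ').symm⟩

end Plain

section Dagger

variable {C : Type u} [Category.{v} C] [MonoidalCategory C] [Dagger C] [DaggerMonoidal C]
  {D : Type u'} [Category.{v'} D] [MonoidalCategory D] [Dagger D] [DaggerMonoidal D]

theorem DaggerBiprodCat.phaseDaggerMonEquiv_iff (hC : DaggerBiprodCat C) (hD : DaggerBiprodCat D)
    {P : GlobalPhases C} [P.AllUnitary] {P' : GlobalPhases D} [P'.AllUnitary]
    (hP : P.PositiveFree) (hP' : P'.PositiveFree) :
    PhaseDaggerMonEquiv P P' ↔ DaggerMonEquiv P.Quotient P'.Quotient := by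
  refine ⟨PhaseDaggerMonEquiv.quotient, fun h => ?_⟩
  have hW := (hC.quotient hP).admissible
  have hW' := (hD.quotient hP').admissible
  obtain ⟨_, ⟨τ⟩⟩ := hW.exists_tensorStructure
  obtain ⟨_, ⟨τ'⟩⟩ := hW'.exists_tensorStructure
  have := daggerMonoidal (hC.quotient hP) τ
  have := daggerMonoidal (hD.quotient hP') τ'
  obtain ⟨Q, hQ⟩ := exists_globalPhases hW τ
  obtain ⟨Q', hQ'⟩ := exists_globalPhases hW' τ'
  exact ((phaseDaggerMonEquiv_quotient hC hP τ hQ).trans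
    (phaseDaggerMonEquiv_of_daggerMonEquiv h (hC.quotient hP) (hD.quotient hP') τ τ' hQ
      hQ')).trans (phaseDaggerMonEquiv_quotient hD hP' τ' hQ').symm

theorem PhasedDaggerBiprodCat.daggerMonEquiv_iff (hC : PhasedDaggerBiprodCat C)
    (hD : PhasedDaggerBiprodCat D) [MonoidalCategory (GPDag C)] (τ : GPDagTensor C)
    [MonoidalCategory (GPDag D)] (τ' : GPDagTensor D) {Q : GlobalPhases (GPDag C)}
    {Q' : GlobalPhases (GPDag D)} (hQ : Q.carrier = phases _) (hQ' : Q'.carrier = phases _) :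
    DaggerMonEquiv C D ↔ PhaseDaggerMonEquiv Q Q' := by
  refine ⟨fun h => phaseDaggerMonEquiv_of_daggerMonEquiv h hC hD τ τ' hQ hQ', fun h => ?_⟩
  have := daggerMonoidal hC τ
  have := daggerMonoidal hD τ'
  have := allUnitary hC hQ
  have := allUnitary hD hQ'
  exact ((daggerMonEquiv_quotient τ hC.admissible hQ).trans h.quotient).trans
    (daggerMonEquiv_quotient τ' hD.admissible hQ').symm

end Dagger

end PhasedCoprod

/-! ### Assembly of the coproduct, biproduct and dagger cases -/

theorem mainTheorem4 :
    -- (I) coproducts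
    -- `A ↦ A/P` is well defined, and `A ≃ GP(A/P)`, compatibly with the global phases
    (∀ (A : Type u) [Category.{v} A] [MonoidalCategory A] (P : GlobalPhases A), CoprodCat A →
      PhasedCoprodCat P.Quotient ∧
      ∀ [MonoidalCategory (GP P.Quotient)] (_ : GPTensor P.Quotient)
        (Q : GlobalPhases (GP P.Quotient)), Q.carrier = phases _ → PhaseMonEquiv P Q) ∧
    -- `B ↦ GP(B)` is well defined, and `B ≃ GP(B)/P`
    (∀ (B : Type u) [Category.{v} B] [MonoidalCategory B], PhasedCoprodCat B →
      (∃ _ : MonoidalCategory (GP B), Nonempty (GPTensor B)) ∧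
      ∀ [MonoidalCategory (GP B)] (_ : GPTensor B),
        CoprodCat (GP B) ∧
        ∃ Q : GlobalPhases (GP B), Q.carrier = phases _ ∧ MonEquiv B Q.Quotient) ∧
    -- both assignments respect and reflect equivalence
    (∀ (A : Type u) [Category.{v} A] [MonoidalCategory A] (P : GlobalPhases A)
      (A' : Type u') [Category.{v'} A'] [MonoidalCategory A'] (P' : GlobalPhases A'),
      CoprodCat A → CoprodCat A' →
      (PhaseMonEquiv P P' ↔ MonEquiv P.Quotient P'.Quotient)) ∧
    (∀ (B : Type u) [Category.{v} B] [MonoidalCategory B]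
      (B' : Type u') [Category.{v'} B'] [MonoidalCategory B'],
      PhasedCoprodCat B → PhasedCoprodCat B' →
      ∀ [MonoidalCategory (GP B)] (_ : GPTensor B)
        [MonoidalCategory (GP B')] (_ : GPTensor B')
        (Q : GlobalPhases (GP B)) (Q' : GlobalPhases (GP B')),
        Q.carrier = phases _ → Q'.carrier = phases _ →
        (MonEquiv B B' ↔ PhaseMonEquiv Q Q')) ∧
    -- (II) biproducts
    (∀ (A : Type u) [Category.{v} A] [MonoidalCategory A] (P : GlobalPhases A), BiprodCat A →
      PhasedBiprodCat P.Quotient ∧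
      ∀ [MonoidalCategory (GP P.Quotient)] (_ : GPTensor P.Quotient)
        (Q : GlobalPhases (GP P.Quotient)), Q.carrier = phases _ → PhaseMonEquiv P Q) ∧
    (∀ (B : Type u) [Category.{v} B] [MonoidalCategory B], PhasedBiprodCat B →
      (∃ _ : MonoidalCategory (GP B), Nonempty (GPTensor B)) ∧
      ∀ [MonoidalCategory (GP B)] (_ : GPTensor B),
        BiprodCat (GP B) ∧
        ∃ Q : GlobalPhases (GP B), Q.carrier = phases _ ∧ MonEquiv B Q.Quotient) ∧
    (∀ (A : Type u) [Category.{v} A] [MonoidalCategory A] (P : GlobalPhases A)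
      (A' : Type u') [Category.{v'} A'] [MonoidalCategory A'] (P' : GlobalPhases A'),
      BiprodCat A → BiprodCat A' →
      (PhaseMonEquiv P P' ↔ MonEquiv P.Quotient P'.Quotient)) ∧
    (∀ (B : Type u) [Category.{v} B] [MonoidalCategory B]
      (B' : Type u') [Category.{v'} B'] [MonoidalCategory B'],
      PhasedBiprodCat B → PhasedBiprodCat B' →
      ∀ [MonoidalCategory (GP B)] (_ : GPTensor B)
        [MonoidalCategory (GP B')] (_ : GPTensor B')
        (Q : GlobalPhases (GP B)) (Q' : GlobalPhases (GP B')),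
        Q.carrier = phases _ → Q'.carrier = phases _ →
        (MonEquiv B B' ↔ PhaseMonEquiv Q Q')) ∧
    -- (III) dagger biproducts
    (∀ (A : Type u) [Category.{v} A] [MonoidalCategory A] [Dagger A] [DaggerMonoidal A]
      (P : GlobalPhases A) [P.AllUnitary], P.PositiveFree → DaggerBiprodCat A →
      DaggerMonoidal P.Quotient ∧ PhasedDaggerBiprodCat P.Quotient ∧
      ∀ [MonoidalCategory (GPDag P.Quotient)] (_ : GPDagTensor P.Quotient)
        (Q : GlobalPhases (GPDag P.Quotient)), Q.carrier = phases _ → PhaseDaggerMonEquiv P Q) ∧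
    (∀ (B : Type u) [Category.{v} B] [MonoidalCategory B] [Dagger B] [DaggerMonoidal B],
      PhasedDaggerBiprodCat B →
      (∃ _ : MonoidalCategory (GPDag B), Nonempty (GPDagTensor B)) ∧
      ∀ [MonoidalCategory (GPDag B)] (_ : GPDagTensor B),
        DaggerBiprodCat (GPDag B) ∧
        ∃ (_ : DaggerMonoidal (GPDag B)) (Q : GlobalPhases (GPDag B)) (_ : Q.AllUnitary),
          Q.carrier = phases _ ∧ Q.PositiveFree ∧ DaggerMonEquiv B Q.Quotient) ∧
    (∀ (A : Type u) [Category.{v} A] [MonoidalCategory A] [Dagger A] [DaggerMonoidal A]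
      (P : GlobalPhases A) [P.AllUnitary]
      (A' : Type u') [Category.{v'} A'] [MonoidalCategory A'] [Dagger A'] [DaggerMonoidal A']
      (P' : GlobalPhases A') [P'.AllUnitary],
      P.PositiveFree → DaggerBiprodCat A → P'.PositiveFree → DaggerBiprodCat A' →
      (PhaseDaggerMonEquiv P P' ↔ DaggerMonEquiv P.Quotient P'.Quotient)) ∧
    (∀ (B : Type u) [Category.{v} B] [MonoidalCategory B] [Dagger B] [DaggerMonoidal B]
      (B' : Type u') [Category.{v'} B'] [MonoidalCategory B'] [Dagger B'] [DaggerMonoidal B'],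
      PhasedDaggerBiprodCat B → PhasedDaggerBiprodCat B' →
      ∀ [MonoidalCategory (GPDag B)] (_ : GPDagTensor B)
        [MonoidalCategory (GPDag B')] (_ : GPDagTensor B')
        (Q : GlobalPhases (GPDag B)) (Q' : GlobalPhases (GPDag B')),
        Q.carrier = phases _ → Q'.carrier = phases _ →
        (DaggerMonEquiv B B' ↔ PhaseDaggerMonEquiv Q Q')) := by
  refine ⟨fun A _ _ P hA => ⟨hA.quotient P, fun τ Q hQ =>
      phaseMonEquiv_quotient (hA.quotient P).admissible hA τ hQ⟩,
    fun B _ _ hB => ⟨hB.admissible.exists_tensorStructure, fun τ =>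
      ⟨τ.coprodCat hB.admissible, ?_⟩⟩,
    fun A _ _ P A' _ _ P' hA hA' => hA.phaseMonEquiv_iff hA' P P',
    fun B _ _ B' _ _ hB hB' _ τ _ τ' Q Q' hQ hQ' => hB.monEquiv_iff hB' τ τ' hQ hQ',
    fun A _ _ P hA => ⟨hA.quotient P, fun τ Q hQ =>
      phaseMonEquiv_quotient (hA.quotient P).phasedCoprodCat.admissible hA.coprodCat τ hQ⟩,
    fun B _ _ hB => ⟨hB.phasedCoprodCat.admissible.exists_tensorStructure, fun τ =>
      ⟨hB.biprodCat_GP τ, ?_⟩⟩,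
    fun A _ _ P A' _ _ P' hA hA' => hA.coprodCat.phaseMonEquiv_iff hA'.coprodCat P P',
    fun B _ _ B' _ _ hB hB' _ τ _ τ' Q Q' hQ hQ' =>
      hB.phasedCoprodCat.monEquiv_iff hB'.phasedCoprodCat τ τ' hQ hQ',
    fun A _ _ _ _ P _ hP hA => ⟨inferInstance, hA.quotient hP, fun τ Q hQ =>
      phaseDaggerMonEquiv_quotient hA hP τ hQ⟩,
    fun B _ _ _ _ hB => ⟨hB.admissible.exists_tensorStructure, fun τ =>
      ⟨daggerBiprodCat hB τ, ?_⟩⟩,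
    fun A _ _ _ _ P _ A' _ _ _ _ P' _ hP hA hP' hA' => hA.phaseDaggerMonEquiv_iff hA' hP hP',
    fun B _ _ _ _ B' _ _ _ _ hB hB' _ τ _ τ' Q Q' hQ hQ' =>
      hB.daggerMonEquiv_iff hB' τ τ' hQ hQ'⟩
  · obtain ⟨Q, hQ⟩ := exists_globalPhases hB.admissible τ
    exact ⟨Q, hQ, τ.monEquiv_quotient hB.admissible hQ⟩
  · have hW := hB.phasedCoprodCat.admissible
    obtain ⟨Q, hQ⟩ := exists_globalPhases hW τ
    exact ⟨Q, hQ, τ.monEquiv_quotient hW hQ⟩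
  · obtain ⟨Q, hQ⟩ := exists_globalPhases hB.admissible τ
    have := daggerMonoidal hB τ
    have := allUnitary hB hQ
    exact ⟨‹_›, Q, ‹_›, hQ, positiveFree hB τ hQ, daggerMonEquiv_quotient τ hB.admissible hQ⟩
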